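/- Let $\alpha\in(0,1)\cup(1,2)$, $\gamma>1/\alpha$ and $b_n=n^\gamma$. Let $\theta$ be standard Pareto (density $\alpha x^{-\alpha-1}$, $x\ge 1$), $R$ standard exponential independent of $\theta$, $\theta(b)=\theta\mathbf 1[\theta<b]+(b+R)\mathbf 1[\theta\ge b]$, and $\eta(b)=\theta(b)$ if $\alpha<1$, $\eta(b)=\theta(b)-E\theta(b)$ if $\alpha>1$. For each $n$ let $\eta_k(b_n)$, $k\in\mathbb Z$, be i.i.d. copies of $\eta(b_n)$. Let $(a_i)_{i\ge 0}$ be a real sequence and let one of the following hold: (LRD) $a_n\sim n^{-\beta}$ with $1/\alpha<\beta<1$; (SRD) $\sum_{i\ge0}|a_i|<\infty$ and $\sum_{i\ge0}a_i\ne0$; (ND) $a_n\sim n^{-\beta}$ with $\max(1,1/\alpha)<\beta<1+1/\alpha$ and $\sum_{i\ge0}a_i=0$. Let $\lambda(n)=cn^{\gamma_1}$, where one of the following holds: (strong) $0<\gamma_1<1$, $c=1$; (weak) $\gamma_1>1$, $c=1$; (moderate) $\gamma_1=1$, $c>0$. In the weak SRD case with $\alpha<1$ assume in addition $\sum_i|a_i|^\alpha<\infty$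 (i.e. the process $\sum_j a_j\eta_{k-j}$ with Pareto innovations is well defined). Put $$\hat X^{(n)}_k=\sum_{0\le j\le\lambda(n)}a_j\,\eta_{k-j}(b_n),\qquad V_n(t)=A_n^{-1}\sum_{k=0}^{\lfloor nt\rfloor}\hat X^{(n)}_k,\qquad A_n=\bigl(\Gamma(1-\alpha)\cos(\pi\alpha/2)\bigr)^{1/\alpha}\,n^{1/\alpha}z_n,$$ where $z_n=1$ under SRD; $z_n=n^{\gamma_1(1-\beta)}$ under LRD or ND with strong tapering; $z_n=n^{1-\beta}$ under LRD or ND with weak or moderate tapering. Let $M_\alpha$ be an $\alpha$-stable random measure on $\mathbb R$ with Lebesgue control measure, totally skewed to the right: independently scattered, $\sigma$-additive almost surely, and $$E e^{isM_\alpha(A)}=\exp\bigl\{-|A|\,|s|^\alpha\bigl(1-i\,\mathrm{sign}(s)\tan(\pi\alpha/2)\bigr)\bigr\}$$ for Borel $A$ of finite Lebesgue measure $|A|$. Define, with $x_+^{1-\beta}=0$ for $x\le0$, $$\mathscr H(u,t)=\begin{cases}\bigl(\sum_{k\ge0}a_k\bigr)\mathbf 1_{[0,t)}(u)&\text{SRD,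 any tapering},\\ (1-\beta)^{-1}\mathbf 1_{[0,t)}(u)&\text{LRD or ND, strong tapering},\\ (1-\beta)^{-1}\bigl((t-u)_+^{1-\beta}-(-u)_+^{1-\beta}\bigr)&\text{LRD or ND, weak tapering},\\ (1-\beta)^{-1}\mathbf 1_{[-c,t]}(u)\bigl(\min(t-u,c)_+^{1-\beta}-(-u)_+^{1-\beta}\bigr)&\text{LRD or ND, moderate tapering}.\end{cases}$$ Then, in all nine cases, the stable stochastic integrals $U(t)=\int_{\mathbb R}\mathscr H(u,t)\,M_\alpha(du)$, $t\ge0$, are well defined, and the finite-dimensional distributions of $\{V_n(t),\ t\ge0\}$ converge weakly, as $n\to\infty$, to those of $\{U(t),\ t\ge0\}$. -/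

import Mathlib

open MeasureTheory ProbabilityTheory Filter Topology Asymptotics

noncomputable section

namespace TaperedLinear

/-! ### Stable random measures and stable stochastic integrals -/

/-- `ν` is the stable law `S_α(σ, b, 0)` (`α ≠ 1`): its characteristic function is
`s ↦ exp (-σ^α |s|^α (1 - i b sign(s) tan(π α / 2)))`. With this sign convention `b = 1` is the
skewness of limits of normalized sums of positive random variables. -/
def IsStableLaw (α σ b : ℝ) (ν : Measure ℝ) : Prop :=
  ∀ s : ℝ, charFun ν s =
    Complex.exp (-((σ ^ α * |s| ^ α : ℝ) : ℂ) *
      (1 - Complex.I * ((b * Real.sign s * Real.tan (Real.pi * α / 2) : ℝ) : ℂ)))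

/-- `M` is an `α`-stable random measure on `ℝ` with Lebesgue control measure and constant skewness
intensity `b`: a family of random variables indexed by the Borel sets of finite Lebesgue measure
which is independently scattered, almost surely `σ`-additive along each disjoint sequence, and such
that `M A` has the law `S_α(|A|^{1/α}, b, 0)`. Values of `M` on other sets play no role. -/
structure IsStableRandomMeasure {Ω : Type*} [MeasurableSpace Ω] (P : Measure Ω) (α b : ℝ)
    (M : Set ℝ → Ω → ℝ) : Prop where
  measurable : ∀ A, MeasurableSet A → volume A < ⊤ → Measurable (M A)
  law : ∀ A, MeasurableSet A → volume A < ⊤ →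
    IsStableLaw α ((volume A).toReal ^ (1 / α)) b (P.map (M A))
  indep : ∀ (k : ℕ) (A : Fin k → Set ℝ), (∀ i, MeasurableSet (A i)) → (∀ i, volume (A i) < ⊤) →
    Pairwise (fun i j => Disjoint (A i) (A j)) → iIndepFun (fun i => M (A i)) P
  sigma_additive : ∀ A : ℕ → Set ℝ, (∀ i, MeasurableSet (A i)) → volume (⋃ i, A i) < ⊤ →
    Pairwise (fun i j => Disjoint (A i) (A j)) →
    ∀ᵐ ω ∂P, Tendsto (fun N => ∑ i ∈ Finset.range N, M (A i) ω) atTop (𝓝 (M (⋃ i, A i) ω))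

/-- The integral `∑ y, y * M {f = y}` of a simple function `f` (the value `0` contributes
nothing). -/
def simpleIntegral {Ω : Type*} (M : Set ℝ → Ω → ℝ) (f : SimpleFunc ℝ ℝ) (ω : Ω) : ℝ :=
  ∑ y ∈ f.range, y * M (f ⁻¹' {y}) ω

/-- `Y` is (a version of) the stochastic integral `∫ f(u) M(du)` of `f ∈ L^α(ℝ)`: the limit in
probability of the integrals of simple functions that vanish outside sets of finite measure and
converge to `f` in `L^α`. -/
def IsStableIntegral {Ω : Type*} [MeasurableSpace Ω] (P : Measure Ω) (α : ℝ)
    (M : Set ℝ → Ω → ℝ) (f : ℝ → ℝ) (Y : Ω → ℝ) : Prop :=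
  MemLp f (ENNReal.ofReal α) volume ∧ Measurable Y ∧
    ∃ s : ℕ → SimpleFunc ℝ ℝ, (∀ n, (s n).FinMeasSupp volume) ∧
      Tendsto (fun n => eLpNorm (fun u => s n u - f u) (ENNReal.ofReal α) volume) atTop (𝓝 0) ∧
      TendstoInMeasure P (fun n => simpleIntegral M (s n)) atTop Y

/-! ### Tapered Pareto innovations -/

/-- The law of `θ 1[θ < b] + (b + R) 1[θ ≥ b]`, where `θ` is standard Pareto with exponent `α`
(density `α x^{-α-1}`, `x ≥ 1`) and `R` is standard exponential, independent of `θ`. -/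
def taperedParetoLaw (α b : ℝ) : Measure ℝ :=
  ((paretoMeasure 1 α).prod (expMeasure 1)).map (fun p => if p.1 < b then p.1 else b + p.2)

/-- The law of the tapered innovation: tapered Pareto, centered by its mean if `α > 1`. -/
def innovationLaw (α b : ℝ) : Measure ℝ :=
  if α < 1 then taperedParetoLaw α b
  else (taperedParetoLaw α b).map (fun x => x - ∫ y, y ∂(taperedParetoLaw α b))

/-! ### The nine cases -/

/-- The three types of tapering of the filter, with level `λ(n) = c n^γ₁`. -/
inductive Tapering
  | strong
  | weak
  | moderate

/-- The three types of dependence: long-range, short-range, negative. -/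
inductive Dependence
  | lrd
  | srd
  | nd

/-- The parameters of the tapering level `λ(n) = c n^γ₁`. -/
def Tapering.Admissible (c γ₁ : ℝ) : Tapering → Prop
  | .strong => 0 < γ₁ ∧ γ₁ < 1 ∧ c = 1
  | .weak => 1 < γ₁ ∧ c = 1
  | .moderate => γ₁ = 1 ∧ 0 < c

/-- The conditions on the filter in the three cases of dependence (`β` plays no role in the
case of short-range dependence). -/
def Dependence.Admissible (α β : ℝ) (a : ℕ → ℝ) : Dependence → Prop
  | .lrd => a ~[atTop] (fun n : ℕ => (n : ℝ) ^ (-β)) ∧ 1 / α < β ∧ β < 1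
  | .srd => Summable (fun i => |a i|) ∧ ∑' i, a i ≠ 0
  | .nd => a ~[atTop] (fun n : ℕ => (n : ℝ) ^ (-β)) ∧ max 1 (1 / α) < β ∧ β < 1 + 1 / α ∧
      ∑' i, a i = 0

/-- The growth `z_n` of the sums of filter coefficients. -/
def growth (β γ₁ : ℝ) (n : ℕ) : Tapering → Dependence → ℝ
  | _, .srd => 1
  | .strong, .lrd | .strong, .nd => (n : ℝ) ^ (γ₁ * (1 - β))
  | .weak, .lrd | .weak, .nd | .moderate, .lrd | .moderate, .nd => (n : ℝ) ^ (1 - β)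

/-- The normalizing sequence `A_n = (Γ(1-α) cos(πα/2))^{1/α} n^{1/α} z_n`. The constant is the
scale parameter of the stable limit of `n^{-1/α} ∑_{k ≤ n} η_k` for (centered) standard Pareto
variables `η_k`; it is positive for `α ∈ (0,1) ∪ (1,2)`. -/
def normalization (α β γ₁ : ℝ) (τ : Tapering) (δ : Dependence) (n : ℕ) : ℝ :=
  (Real.Gamma (1 - α) * Real.cos (Real.pi * α / 2)) ^ (1 / α) * (n : ℝ) ^ (1 / α) *
    growth β γ₁ n τ δ

/-- The kernel `u ↦ H(u, t, c)` of the limit process. Here `x_+^{1-β}` is `0` for `x ≤ 0`,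
also when `1 - β < 0`; this agrees with `(max x 0) ^ (1 - β)` as `β ≠ 1`. -/
def kernel (a : ℕ → ℝ) (β c t u : ℝ) : Tapering → Dependence → ℝ
  | _, .srd => (∑' k, a k) * (Set.Ico 0 t).indicator 1 u
  | .strong, .lrd | .strong, .nd => (1 - β)⁻¹ * (Set.Ico 0 t).indicator 1 u
  | .weak, .lrd | .weak, .nd =>
      (1 - β)⁻¹ * ((max (t - u) 0) ^ (1 - β) - (max (-u) 0) ^ (1 - β))
  | .moderate, .lrd | .moderate, .nd =>
      (1 - β)⁻¹ * (Set.Icc (-c) t).indicator 1 u *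
        ((min (t - u) c) ^ (1 - β) - (max (-u) 0) ^ (1 - β))

/-! ### Linear processes with tapered filter -/

/-- The filter truncated at level `l`. -/
def taperedFilter (a : ℕ → ℝ) (l : ℝ) (i : ℕ) : ℝ :=
  if (i : ℝ) ≤ l then a i else 0

/-- `X_k = ∑_{j ≥ 0} ā_j ξ_{k-j}` (a finite sum, since `ā_j = 0` for `j > l`). -/
def linearProcess {Ω : Type*} (a : ℕ → ℝ) (l : ℝ) (ξ : ℤ → Ω → ℝ) (k : ℤ) (ω : Ω) : ℝ :=
  ∑' j : ℕ, taperedFilter a l j * ξ (k - j) ω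

/-- `V_n(t) = A_n⁻¹ ∑_{k=0}^{⌊nt⌋} X_k^{(n)}`, with filter level `λ(n) = c n^γ₁` and with
innovations `ξ`. -/
def normalizedSum {Ω : Type*} (α β γ₁ c : ℝ) (a : ℕ → ℝ) (τ : Tapering) (δ : Dependence)
    (n : ℕ) (ξ : ℤ → Ω → ℝ) (t : ℝ) (ω : Ω) : ℝ :=
  (normalization α β γ₁ τ δ n)⁻¹ *
    ∑ k ∈ Finset.range (⌊(n : ℝ) * t⌋₊ + 1), linearProcess a (c * (n : ℝ) ^ γ₁) ξ k ω

end TaperedLinear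

end

noncomputable section

namespace TaperedLinear

/-! ### The characteristic exponent of stable laws -/

/-! By the Cramér–Wold device and Lévy's continuity theorem it suffices to find the limit of the
characteristic function of `∑ l, θ l * V_n (t l)`. Exchanging sums turns this variable into a finite
weighted sum of i.i.d. innovations, in which `ξ i` has coefficient `f_n i * C ^ (-1/α) * n ^ (-1/α)`
with `C = Γ(1-α) cos(πα/2)`; here `f_n i` is a combination of differences of partial sums of the
truncated filter, divided by `z_n`. Let `φ_n x` be the characteristic function of the innovation at
`x * C ^ (-1/α) * n ^ (-1/α)`, let `Ψ_n = n (φ_n - 1)`, and let `h_n u = f_n ⌊n u⌋`. Grid cells have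
length `1/n`, so `∑ (φ_n (f_n i) - 1)` is exactly `∫ Ψ_n (h_n u) du`. Replacing the product of the
`φ_n (f_n i)` by the exponential of this sum costs at most a constant times `∫ |Ψ_n (h_n u)|² / n
du`, which vanishes (`tendsto_charFun_weightedSum`).

Two independent facts then give the limit. On the side of the innovations, `Ψ_n` converges to the
stable exponent along convergent arguments (`tendsto_charFun_innovationLaw`), and `|Ψ_n x| ≤ K
|x|^α` uniformly in `n` (`exists_norm_charFun_innovationLaw_sub_one_le`). The constant `C` comes
from a Gamma integral continued to the imaginary axis (`integral_expRemainder_I_mul`). The tapering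
is invisible because `b_n = n ^ γ` lies far beyond the typical maximum `n ^ (1/α)`.

On the side of the filter, the step functions converge almost everywhere to the kernel, with control
in `L^α` (`exists_dominatedConv_normalizedWeight`). Under LRD and ND the partial sums of the filter
behave like `m ^ (1-β) / (1-β)`; under ND this uses that the total sum is zero. The regime of
tapering is decided by whether the time distance or the filter length is the shorter. Under SRD the
partial sums converge, and the contribution of the innovations before time zero vanishes by a Cesàro
argument.

Dominated convergence (`DominatedConv.tendsto_integral`) yields `exp ∫ ψ (∑ l, θ l * H(u, t l)) du`
with `ψ` the stable exponent, which is the joint characteristic function of the stable integrals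
(`charFun_isStableIntegral`). Domination also places the kernels in `L^α`, so the integrals exist.
-/

/-- The characteristic exponent of the standard totally right-skewed `α`-stable law. -/
def stableExponent (α s : ℝ) : ℂ :=
  -((|s| ^ α : ℝ) : ℂ) * (1 - Complex.I * ((Real.sign s * Real.tan (Real.pi * α / 2) : ℝ) : ℂ))

lemma isStableLaw_one_iff {α σ : ℝ} {ν : Measure ℝ} :
    IsStableLaw α σ 1 ν ↔ ∀ s, charFun ν s = Complex.exp ((σ ^ α : ℝ) * stableExponent α s) := by
  refine forall_congr' fun s => ?_
  rw [stableExponent, one_mul]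
  push_cast
  rw [show ∀ a b c : ℂ, a * (-b * c) = -(a * b) * c by intros; ring]

/-- The Taylor remainder `exp z - 1 - e z` of the exponential, for `e = 0` or `e = 1`. -/
def expRemainder (e : ℝ) (z : ℂ) : ℂ := Complex.exp z - 1 - e * z

lemma continuous_expRemainder (e : ℝ) : Continuous (expRemainder e) := by
  unfold expRemainder; fun_prop

/-- The exponential is bounded by 1 on the closed left half-plane, so the remainder has order `e +
1` at zero and only order `e` at infinity. This is what makes it integrable against `y ^ (-α - 1)`
when `e < α < e + 1`; hence `e = 0` serves `α < 1` and `e = 1` serves `α > 1`. -/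
lemma norm_expRemainder_le {e : ℝ} (he : e = 0 ∨ e = 1) {z : ℂ} (hz : z.re ≤ 0) :
    ‖expRemainder e z‖ ≤ 3 * min (‖z‖ ^ e) (‖z‖ ^ (e + 1)) := by
  have h1 : ‖Complex.exp z - 1‖ ≤ 2 := by
    refine (norm_sub_le _ _).trans ?_
    have : ‖Complex.exp z‖ ≤ 1 := by rw [Complex.norm_exp]; exact Real.exp_le_one_iff.2 hz
    simp only [norm_one]; linarith
  have h2 : ‖Complex.exp z - 1‖ ≤ 2 * ‖z‖ := by
    rcases le_total ‖z‖ 1 with h | h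
    · exact Complex.norm_exp_sub_one_le h
    · linarith
  have h0 := norm_nonneg z
  rcases he with rfl | rfl
  · simp only [expRemainder, Complex.ofReal_zero, zero_mul, sub_zero, Real.rpow_zero, zero_add,
      Real.rpow_one]
    rw [mul_min_of_nonneg _ _ (by norm_num), le_min_iff]
    constructor <;> linarith
  · simp only [expRemainder, Complex.ofReal_one, one_mul, Real.rpow_one]
    rw [show (1 : ℝ) + 1 = (2 : ℕ) by norm_num, Real.rpow_natCast]
    have h3 : ‖Complex.exp z - 1 - z‖ ≤ 3 * ‖z‖ := (norm_sub_le _ _).trans (by linarith)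
    rw [mul_min_of_nonneg _ _ (by norm_num), le_min_iff]
    refine ⟨h3, ?_⟩
    rcases le_total ‖z‖ 1 with h | h
    · exact (Complex.norm_exp_sub_one_sub_id_le h).trans (by nlinarith)
    · nlinarith

lemma min_rpow_le {x e p : ℝ} (hx : 0 ≤ x) (he : 0 ≤ e) (h1 : e ≤ p) (h2 : p ≤ e + 1) :
    min (x ^ e) (x ^ (e + 1)) ≤ x ^ p := by
  rcases hx.eq_or_lt with rfl | hx
  · refine (min_le_right _ _).trans ?_
    rw [Real.zero_rpow (by linarith)]
    exact Real.rpow_nonneg le_rfl _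
  rcases le_total x 1 with h | h
  · exact (min_le_right _ _).trans (Real.rpow_le_rpow_of_exponent_ge hx h h2)
  · exact (min_le_left _ _).trans (Real.rpow_le_rpow_of_exponent_le h h1)

lemma integrableOn_min_rpow {e α : ℝ} (h1 : e < α) (h2 : α < e + 1) :
    IntegrableOn (fun y : ℝ => min (y ^ e) (y ^ (e + 1)) * y ^ (-α - 1)) (Set.Ioi 0) := by
  have hm : Measurable (fun y : ℝ => min (y ^ e) (y ^ (e + 1)) * y ^ (-α - 1)) := by fun_prop
  rw [← Set.Ioc_union_Ioi_eq_Ioi zero_le_one]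
  refine IntegrableOn.union ?_ ?_
  · have : IntegrableOn (fun y : ℝ => y ^ (e - α)) (Set.Ioc 0 1) := by
      rw [← intervalIntegrable_iff_integrableOn_Ioc_of_le zero_le_one]
      exact intervalIntegral.intervalIntegrable_rpow' (by linarith)
    refine Integrable.mono' this hm.aestronglyMeasurable ?_
    filter_upwards [ae_restrict_mem measurableSet_Ioc] with y hy
    have hy0 : 0 < y := hy.1
    rw [Real.norm_of_nonneg (by positivity), show e - α = (e + 1) + (-α - 1) by ring,
      Real.rpow_add hy0 (e + 1) (-α - 1)]
    exact mul_le_mul_of_nonneg_right (min_le_right _ _) (by positivity)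
  · have : IntegrableOn (fun y : ℝ => y ^ (e - α - 1)) (Set.Ioi 1) :=
      integrableOn_Ioi_rpow_of_lt (by linarith) zero_lt_one
    refine Integrable.mono' this hm.aestronglyMeasurable ?_
    filter_upwards [ae_restrict_mem measurableSet_Ioi] with y hy
    have hy0 : 0 < y := zero_lt_one.trans hy
    rw [Real.norm_of_nonneg (by positivity), show e - α - 1 = e + (-α - 1) by ring,
      Real.rpow_add hy0 e (-α - 1)]
    exact mul_le_mul_of_nonneg_right (min_le_left _ _) (by positivity)

/-- The bound depends on `r` only through `M`, so it dominates a whole family of parameters,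
including a sequence that reaches the imaginary axis. -/
lemma norm_expRemainder_mul_le {e M : ℝ} (he : e = 0 ∨ e = 1) {r : ℂ} (hr : 0 ≤ r.re)
    (hM : ‖r‖ ≤ M) {y : ℝ} (hy : 0 ≤ y) :
    ‖expRemainder e (-(r * y))‖ ≤ 3 * (M ^ e + M ^ (e + 1)) * min (y ^ e) (y ^ (e + 1)) := by
  have he0 : 0 ≤ e := by rcases he with rfl | rfl <;> norm_num
  have hM0 : 0 ≤ M := (norm_nonneg _).trans hM
  refine (norm_expRemainder_le he (by simp; positivity)).trans ?_
  have hn : ‖-(r * y)‖ = ‖r‖ * y := by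
    rw [norm_neg, norm_mul, Complex.norm_real, Real.norm_of_nonneg hy]
  rw [hn, mul_assoc]
  gcongr
  rw [Real.mul_rpow (norm_nonneg _) hy, Real.mul_rpow (norm_nonneg _) hy,
    mul_min_of_nonneg _ _ (by positivity)]
  have h1 : ‖r‖ ^ e ≤ M ^ e + M ^ (e + 1) :=
    (Real.rpow_le_rpow (norm_nonneg _) hM he0).trans (le_add_of_nonneg_right (by positivity))
  have h2 : ‖r‖ ^ (e + 1) ≤ M ^ e + M ^ (e + 1) :=
    (Real.rpow_le_rpow (norm_nonneg _) hM (by positivity)).trans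
      (le_add_of_nonneg_left (by positivity))
  gcongr

/-- The Laplace transform of `t ^ (a - 1)` on the right half-plane. -/
lemma integral_rpow_mul_cexp_neg_mul {a : ℝ} (ha : 0 < a) {r : ℂ} (hr : 0 < r.re) :
    ∫ t in Set.Ioi (0 : ℝ), ((t ^ (a - 1) : ℝ) : ℂ) * Complex.exp (-(r * t)) =
      r ^ (-a : ℂ) * Complex.Gamma a := by
  -- The integral is the complex moment generating function, at `z = -r`, of the measure `t ^ (a -
  -- 1) dt`. Both sides are analytic for `z.re < 0`, so by the identity theorem the real case is
  -- enough.
  set μ : Measure ℝ := (volume.restrict (Set.Ioi 0)).withDensity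
    (fun t => ENNReal.ofReal (t ^ (a - 1))) with hμ
  have hmeas : Measurable fun t : ℝ => Real.toNNReal (t ^ (a - 1)) := by fun_prop
  have hint : ∀ z : ℂ, complexMGF id μ z =
      ∫ t in Set.Ioi (0 : ℝ), ((t ^ (a - 1) : ℝ) : ℂ) * Complex.exp (z * t) := by
    intro z
    rw [complexMGF, hμ]
    erw [integral_withDensity_eq_integral_smul hmeas]
    refine setIntegral_congr_fun measurableSet_Ioi fun t ht => ?_
    have : 0 ≤ t ^ (a - 1) := Real.rpow_nonneg (le_of_lt ht) _
    simp [NNReal.smul_def, Real.coe_toNNReal _ this]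
  have hset : {z : ℂ | z.re < 0} ⊆ {z : ℂ | z.re ∈ interior (integrableExpSet id μ)} := by
    intro z hz
    refine interior_maximal (t := Set.Iio 0) ?_ isOpen_Iio hz
    intro x hx
    have hx : x < 0 := hx
    simp only [integrableExpSet, Set.mem_ofPred_eq, id]
    rw [hμ]
    erw [integrable_withDensity_iff_integrable_smul hmeas]
    have := integrableOn_rpow_mul_exp_neg_mul_rpow (p := 1) (s := a - 1) (b := -x)
      (by linarith) one_pos (by linarith)
    refine IntegrableOn.congr_fun this (fun t ht => ?_) measurableSet_Ioi
    have : 0 ≤ t ^ (a - 1) := Real.rpow_nonneg (le_of_lt ht) _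
    simp [NNReal.smul_def, Real.coe_toNNReal _ this]
  have hA : AnalyticOnNhd ℂ (complexMGF id μ) {z | z.re < 0} := analyticOnNhd_complexMGF.mono hset
  have hB : AnalyticOnNhd ℂ (fun z : ℂ => (-z) ^ (-a : ℂ) * Complex.Gamma a) {z | z.re < 0} := by
    refine DifferentiableOn.analyticOnNhd (fun z hz => ?_)
      (isOpen_Iio.preimage Complex.continuous_re)
    refine DifferentiableAt.differentiableWithinAt ?_
    refine DifferentiableAt.mul_const ?_ _
    refine DifferentiableAt.cpow_const (by fun_prop) ?_
    left; simpa using hz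
  have hEq : Set.EqOn (complexMGF id μ) (fun z : ℂ => (-z) ^ (-a : ℂ) * Complex.Gamma a)
      {z | z.re < 0} := by
    refine AnalyticOnNhd.eqOn_of_preconnected_of_frequently_eq hA hB
      (convex_halfSpace_re_lt 0).isPreconnected (z₀ := ((-1 : ℝ) : ℂ)) (by simp) ?_
    have h_real : ∃ᶠ (x : ℝ) in 𝓝[≠] (-1), complexMGF id μ x =
        (-(x : ℂ)) ^ (-a : ℂ) * Complex.Gamma a := by
      refine Eventually.frequently ?_
      have : ∀ᶠ x : ℝ in 𝓝[≠] (-1), x < 0 :=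
        eventually_nhdsWithin_of_eventually_nhds (eventually_lt_nhds (by norm_num))
      filter_upwards [this] with x hx
      have := Complex.integral_cpow_mul_exp_neg_mul_Ioi (a := a) (r := -x) (by simpa) (by linarith)
      rw [hint]
      rw [Complex.cpow_neg, ← Complex.inv_cpow, ← one_div]
      · rw [Complex.ofReal_neg] at this
        rw [← this]
        refine setIntegral_congr_fun measurableSet_Ioi fun t ht => ?_
        simp only [neg_mul, neg_neg]
        rw [Complex.ofReal_cpow (le_of_lt ht)]
        simp
      · rw [← Complex.ofReal_neg, Complex.arg_ofReal_of_nonneg (by linarith)]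
        exact Real.pi_ne_zero.symm
    -- A sequence of reals accumulating at `-1` also accumulates there in the complex plane.
    rw [frequently_iff_seq_forall] at h_real ⊢
    obtain ⟨xs, hx_tendsto, hx_eq⟩ := h_real
    refine ⟨fun n ↦ xs n, ?_, fun n ↦ hx_eq n⟩
    rw [tendsto_nhdsWithin_iff] at hx_tendsto ⊢
    refine ⟨(Complex.continuous_ofReal.tendsto _).comp hx_tendsto.1, ?_⟩
    filter_upwards [hx_tendsto.2] with n hn
    simpa using fun h => hn (Complex.ofReal_injective (by simpa using h))
  have := hEq (x := -r) (by simpa using hr)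
  rw [hint] at this
  simpa using this

lemma integrableOn_expRemainder {e α : ℝ} (he : e = 0 ∨ e = 1) (h1 : e < α) (h2 : α < e + 1)
    {r : ℂ} (hr : 0 ≤ r.re) :
    IntegrableOn (fun y : ℝ => expRemainder e (-(r * y)) * ((α * y ^ (-α - 1) : ℝ) : ℂ))
      (Set.Ioi 0) := by
  have hα : 0 ≤ α := by rcases he with rfl | rfl <;> linarith
  refine Integrable.mono' (((integrableOn_min_rpow h1 h2).const_mul
    (3 * (‖r‖ ^ e + ‖r‖ ^ (e + 1)))).const_mul α) ?_ ?_
  · have := (continuous_expRemainder e).measurable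
    exact Measurable.aestronglyMeasurable (by fun_prop)
  · filter_upwards [ae_restrict_mem measurableSet_Ioi] with y hy
    have hy : 0 < y := hy
    rw [norm_mul, Complex.norm_real, Real.norm_of_nonneg (by positivity)]
    calc _ ≤ 3 * (‖r‖ ^ e + ‖r‖ ^ (e + 1)) * min (y ^ e) (y ^ (e + 1)) * (α * y ^ (-α - 1)) := by
          gcongr
          exact norm_expRemainder_mul_le he hr le_rfl hy.le
      _ = _ := by ring

/-- Integration by parts with antiderivative `-y ^ (-α)` of the density. The boundary terms vanish
at zero because the remainder is `O(y ^ (e + 1))`, and at infinity because it is `O(y ^ e)`. -/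
lemma integral_expRemainder_mul_eq {e α : ℝ} (he : e = 0 ∨ e = 1) (h1 : e < α) (h2 : α < e + 1)
    {r : ℂ} (hr : 0 < r.re)
    (hi : IntegrableOn (fun y : ℝ => (-r * (Complex.exp (-(r * y)) - e)) * ((-y ^ (-α) : ℝ) : ℂ))
      (Set.Ioi 0)) :
    ∫ y in Set.Ioi (0 : ℝ), expRemainder e (-(r * y)) * ((α * y ^ (-α - 1) : ℝ) : ℂ) =
      -∫ y in Set.Ioi (0 : ℝ), (-r * (Complex.exp (-(r * y)) - e)) * ((-y ^ (-α) : ℝ) : ℂ) := by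
  have hb : ∀ y : ℝ, 0 < y → ‖expRemainder e (-(r * y)) * ((-y ^ (-α) : ℝ) : ℂ)‖ ≤
      3 * (‖r‖ ^ e + ‖r‖ ^ (e + 1)) * min (y ^ e) (y ^ (e + 1)) * y ^ (-α) := by
    intro y hy
    rw [norm_mul, Complex.norm_real, norm_neg, Real.norm_of_nonneg (by positivity)]
    gcongr
    exact norm_expRemainder_mul_le he hr.le le_rfl hy.le
  have := integral_Ioi_mul_deriv_eq_deriv_mul (a := 0) (a' := (0 : ℂ)) (b' := (0 : ℂ))
    (u := fun y : ℝ => expRemainder e (-(r * y)))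
    (v := fun y : ℝ => ((-y ^ (-α) : ℝ) : ℂ))
    (u' := fun y : ℝ => -r * (Complex.exp (-(r * y)) - e))
    (v' := fun y : ℝ => ((α * y ^ (-α - 1) : ℝ) : ℂ)) ?_ ?_
    (integrableOn_expRemainder he h1 h2 hr.le) hi ?_ ?_
  · rw [this]; simp
  · intro y hy
    have hl : HasDerivAt (fun y : ℝ => -(r * (y : ℂ))) (-r) y := by
      have := ((Complex.ofRealCLM.hasDerivAt (x := y)).const_mul r).neg
      simp only [Complex.ofRealCLM_apply, Complex.ofReal_one, mul_one] at this
      exact this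
    have := ((hl.cexp).sub_const 1).sub (hl.const_mul (e : ℂ))
    refine this.congr_deriv (by ring)
  · intro y hy
    have hy : 0 < y := hy
    have := ((Real.hasDerivAt_rpow_const (x := y) (p := -α) (Or.inl hy.ne')).neg).ofReal_comp
    refine this.congr_deriv (by push_cast; ring)
  · refine squeeze_zero_norm' (a := fun y => 3 * (‖r‖ ^ e + ‖r‖ ^ (e + 1)) * y ^ (e + 1 - α)) ?_ ?_
    · filter_upwards [self_mem_nhdsWithin] with y hy
      have hy : 0 < y := hy
      refine (hb y hy).trans ?_
      rw [sub_eq_add_neg, Real.rpow_add hy (e + 1) (-α), ← mul_assoc]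
      gcongr
      exact min_le_right _ _
    · have : Tendsto (fun y : ℝ => y ^ (e + 1 - α)) (𝓝[>] 0) (𝓝 0) := by
        have := (Real.continuousAt_rpow_const 0 (e + 1 - α) (Or.inr (by linarith))).tendsto
        rw [Real.zero_rpow (by linarith)] at this
        exact this.mono_left nhdsWithin_le_nhds
      simpa using this.const_mul (3 * (‖r‖ ^ e + ‖r‖ ^ (e + 1)))
  · refine squeeze_zero_norm' (a := fun y => 3 * (‖r‖ ^ e + ‖r‖ ^ (e + 1)) * y ^ (-(α - e))) ?_ ?_
    · filter_upwards [eventually_gt_atTop 0] with y hy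
      refine (hb y hy).trans ?_
      rw [show -(α - e) = e + -α by ring, Real.rpow_add hy e (-α), ← mul_assoc]
      gcongr
      exact min_le_left _ _
    · simpa using (tendsto_rpow_neg_atTop (y := α - e) (by linarith)).const_mul
        (3 * (‖r‖ ^ e + ‖r‖ ^ (e + 1)))

/-- After one integration by parts what remains is the Laplace transform of `y ^ (-α)`, a Gamma
integral with parameter `1 - α > 0`. -/
lemma integral_expRemainder_zero {α : ℝ} (h1 : 0 < α) (h2 : α < 1) {r : ℂ} (hr : 0 < r.re) :
    ∫ y in Set.Ioi (0 : ℝ), expRemainder 0 (-(r * y)) * ((α * y ^ (-α - 1) : ℝ) : ℂ) =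
      -(r ^ (α : ℂ) * Complex.Gamma (1 - α)) := by
  have hr0 : r ≠ 0 := by rintro rfl; simp at hr
  have key := integral_rpow_mul_cexp_neg_mul (a := 1 - α) (by linarith) hr
  have hint : IntegrableOn (fun t : ℝ => ((t ^ (-α) : ℝ) : ℂ) * Complex.exp (-(r * t)))
      (Set.Ioi 0) := by
    have := integrableOn_rpow_mul_exp_neg_mul_rpow (p := 1) (s := -α) (b := r.re)
      (by linarith) one_pos hr
    refine Integrable.mono' this (Measurable.aestronglyMeasurable (by fun_prop)) ?_
    filter_upwards [ae_restrict_mem measurableSet_Ioi] with y hy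
    have hy : 0 < y := hy
    rw [norm_mul, Complex.norm_real, Complex.norm_exp, Real.norm_of_nonneg (by positivity)]
    simp
  have heq : (fun y : ℝ => (-r * (Complex.exp (-(r * y)) - ((0 : ℝ) : ℂ))) * ((-y ^ (-α) : ℝ) : ℂ))
      = fun y => r * (((y ^ (-α) : ℝ) : ℂ) * Complex.exp (-(r * y))) := by
    funext y; push_cast; ring
  rw [integral_expRemainder_mul_eq (Or.inl rfl) h1 (by linarith) hr
    (by rw [heq]; exact hint.const_mul r), heq, integral_const_mul]
  rw [show (1 - α - 1 : ℝ) = -α by ring] at key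
  rw [key, ← mul_assoc, show (α : ℂ) = 1 + -((1 - α : ℝ) : ℂ) by push_cast; ring,
    Complex.cpow_add _ _ hr0, Complex.cpow_one]
  push_cast
  simp

/-- For `e = 1`, differentiating the first-order remainder gives a multiple of the zeroth-order one,
so an integration by parts reduces `α` to `α - 1`. The functional equation of `Γ` restores the same
formula. -/
lemma integral_expRemainder {e α : ℝ} (he : e = 0 ∨ e = 1) (h1 : e < α) (h2 : α < e + 1)
    {r : ℂ} (hr : 0 < r.re) :
    ∫ y in Set.Ioi (0 : ℝ), expRemainder e (-(r * y)) * ((α * y ^ (-α - 1) : ℝ) : ℂ) =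
      -(r ^ (α : ℂ) * Complex.Gamma (1 - α)) := by
  rcases he with rfl | rfl
  · exact integral_expRemainder_zero h1 (by linarith) hr
  have hr0 : r ≠ 0 := by rintro rfl; simp at hr
  have hα : ((α : ℂ) - 1) ≠ 0 := by
    rw [← Complex.ofReal_one, ← Complex.ofReal_sub]; exact_mod_cast (by linarith : α - 1 ≠ 0)
  have key := integral_expRemainder_zero (α := α - 1) (by linarith) (by linarith) hr
  have hint := integrableOn_expRemainder (α := α - 1) (Or.inl rfl) (by linarith) (by linarith) hr.le
  have heq : (fun y : ℝ => (-r * (Complex.exp (-(r * y)) - ((1 : ℝ) : ℂ))) * ((-y ^ (-α) : ℝ) : ℂ))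
      = fun y : ℝ => (r / (α - 1)) *
        (expRemainder 0 (-(r * y)) * (((α - 1) * y ^ (-(α - 1) - 1) : ℝ) : ℂ)) := by
    funext y
    rw [show -(α - 1) - 1 = -α by ring, expRemainder]
    push_cast
    field_simp
    ring
  rw [integral_expRemainder_mul_eq (Or.inr rfl) h1 (by linarith) hr
    (by rw [heq]; exact hint.const_mul _), heq, integral_const_mul, key]
  have hG : Complex.Gamma (1 - ((α - 1 : ℝ) : ℂ)) = (1 - α) * Complex.Gamma (1 - α) := by
    rw [← Complex.Gamma_add_one]
    · congr 1; push_cast; ring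
    · rw [← neg_sub]; exact neg_ne_zero.2 hα
  have hp : r ^ (α : ℂ) = r * r ^ ((α - 1 : ℝ) : ℂ) := by
    nth_rw 2 [← Complex.cpow_one r]
    rw [← Complex.cpow_add _ _ hr0]
    congr 1; push_cast; ring
  rw [hG, hp]
  push_cast
  field_simp
  ring

lemma cos_pi_mul_div_two_ne_zero {α : ℝ} (h0 : 0 < α) (h2 : α < 2) (h1 : α ≠ 1) :
    Real.cos (Real.pi * α / 2) ≠ 0 := by
  have hp := Real.pi_pos
  rcases lt_or_gt_of_ne h1 with h | h
  · exact (Real.cos_pos_of_mem_Ioo ⟨by nlinarith, by nlinarith⟩).ne'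
  · exact (Real.cos_neg_of_pi_div_two_lt_of_lt (by nlinarith) (by nlinarith)).ne

/-- For `α < 1` both factors are positive, for `α > 1` both are negative. -/
lemma Gamma_mul_cos_pos {α : ℝ} (h0 : 0 < α) (h2 : α < 2) (h1 : α ≠ 1) :
    0 < Real.Gamma (1 - α) * Real.cos (Real.pi * α / 2) := by
  have hp := Real.pi_pos
  rcases lt_or_gt_of_ne h1 with h | h
  · exact mul_pos (Real.Gamma_pos_of_pos (by linarith))
      (Real.cos_pos_of_mem_Ioo ⟨by nlinarith, by nlinarith⟩)
  · have hc := Real.cos_neg_of_pi_div_two_lt_of_lt (x := Real.pi * α / 2)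
      (by nlinarith) (by nlinarith)
    have hG : 0 < (1 - α) * Real.Gamma (1 - α) := by
      rw [← Real.Gamma_add_one (by linarith)]
      exact Real.Gamma_pos_of_pos (by linarith)
    nlinarith [mul_pos hG (show 0 < α - 1 by linarith)]

/-- The principal argument of `-is` is `∓π/2` according to the sign of `s`. The power therefore has
modulus `|s| ^ α` and angle `∓πα/2`, and factoring out the cosine produces the tangent in the stable
exponent. -/
lemma cpow_neg_I_mul {α : ℝ} (h0 : 0 < α) (h2 : α < 2) (h1 : α ≠ 1) (s : ℝ) :
    (-(Complex.I * s)) ^ (α : ℂ) =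
      -((Real.cos (Real.pi * α / 2) : ℝ) * stableExponent α s) := by
  have hc := cos_pi_mul_div_two_ne_zero h0 h2 h1
  have hpos : ∀ x : ℝ, 0 < x → ∀ w : ℂ, w ≠ 0 →
      ((x : ℂ) * w) ^ (α : ℂ) = ((x ^ α : ℝ) : ℂ) * Complex.exp (Complex.log w * α) := by
    intro x hx w hw
    rw [Complex.cpow_def_of_ne_zero (mul_ne_zero (by exact_mod_cast hx.ne') hw),
      Complex.log_ofReal_mul hx hw, add_mul, Complex.exp_add, Real.rpow_def_of_pos hx]
    push_cast
    rfl
  have hs : ∀ σ : ℝ, ((Real.cos (Real.pi * α / 2) : ℝ) : ℂ) *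
      (1 - Complex.I * ((σ * Real.tan (Real.pi * α / 2) : ℝ) : ℂ)) =
      Real.cos (Real.pi * α / 2) - σ * Real.sin (Real.pi * α / 2) * Complex.I := by
    intro σ
    rw [← Real.tan_mul_cos hc]
    push_cast
    ring
  rw [stableExponent]
  rcases lt_trichotomy s 0 with h | rfl | h
  · rw [show -(Complex.I * s) = ((-s : ℝ) : ℂ) * Complex.I by push_cast; ring,
      hpos _ (by linarith) _ Complex.I_ne_zero, Real.sign_of_neg h, abs_of_neg h, Complex.log_I,
      mul_left_comm, hs, show (Real.pi / 2 * Complex.I * α : ℂ) =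
        ((Real.pi * α / 2 : ℝ) : ℂ) * Complex.I by push_cast; ring, Complex.exp_mul_I]
    push_cast
    ring
  · simp [h0.ne']
  · rw [show -(Complex.I * s) = (s : ℂ) * -Complex.I by ring,
      hpos _ h _ (neg_ne_zero.2 Complex.I_ne_zero), Real.sign_of_pos h, abs_of_pos h,
      Complex.log_neg_I, mul_left_comm, hs, show (-(Real.pi / 2) * Complex.I * α : ℂ) =
        ((-(Real.pi * α / 2) : ℝ) : ℂ) * Complex.I by push_cast; ring, Complex.exp_mul_I]
    push_cast
    rw [Complex.cos_neg, Complex.sin_neg]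
    ring

/-- The Lévy–Khintchine representation of the stable exponent. -/
lemma integral_expRemainder_I_mul {e α : ℝ} (he : e = 0 ∨ e = 1) (h1 : e < α) (h2 : α < e + 1)
    (s : ℝ) :
    ∫ y in Set.Ioi (0 : ℝ), expRemainder e (Complex.I * s * y) * ((α * y ^ (-α - 1) : ℝ) : ℂ) =
      (Real.Gamma (1 - α) * Real.cos (Real.pi * α / 2) : ℝ) * stableExponent α s := by
  have h0 : 0 < α := by rcases he with rfl | rfl <;> linarith
  have h2' : α < 2 := by rcases he with rfl | rfl <;> linarith
  have h1' : α ≠ 1 := by rcases he with rfl | rfl <;> [exact (by linarith : α < 1).ne; exact h1.ne']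
  have he0 : 0 ≤ e := by rcases he with rfl | rfl <;> norm_num
  rcases eq_or_ne s 0 with rfl | hs
  · rw [← neg_inj, ← mul_neg]
    simp [expRemainder, stableExponent, h0.ne']
  -- The Gamma formula holds only for `0 < r.re`; the point `-is` is approached from inside this
  -- half-plane, and both sides pass to the limit.
  set r : ℕ → ℂ := fun n => ((1 / ((n : ℝ) + 1) : ℝ) : ℂ) - Complex.I * s with hr
  have hre : ∀ n, 0 < (r n).re := by
    intro n
    simp only [hr, Complex.sub_re, Complex.ofReal_re, Complex.mul_re, Complex.I_re, zero_mul,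
      Complex.I_im, Complex.ofReal_im, mul_zero, sub_zero]
    positivity
  have hlim : Tendsto r atTop (𝓝 (-(Complex.I * s))) := by
    have := (Complex.continuous_ofReal.tendsto 0).comp (tendsto_one_div_add_atTop_nhds_zero_nat (𝕜 := ℝ))
    simpa [hr] using this.sub_const (Complex.I * s)
  have hM : ∀ n, ‖r n‖ ≤ 1 + |s| := by
    intro n
    refine (norm_sub_le _ _).trans (add_le_add ?_ (by simp))
    rw [Complex.norm_real, Real.norm_of_nonneg (by positivity)]
    exact div_le_one_of_le₀ (by linarith [n.cast_nonneg (α := ℝ)]) (by positivity)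
  have hT : Tendsto (fun n => ∫ y in Set.Ioi (0 : ℝ),
      expRemainder e (-(r n * y)) * ((α * y ^ (-α - 1) : ℝ) : ℂ)) atTop
      (𝓝 (∫ y in Set.Ioi (0 : ℝ),
        expRemainder e (Complex.I * s * y) * ((α * y ^ (-α - 1) : ℝ) : ℂ))) := by
    refine tendsto_integral_of_dominated_convergence (fun y =>
      α * (3 * ((1 + |s|) ^ e + (1 + |s|) ^ (e + 1)) *
        (min (y ^ e) (y ^ (e + 1)) * y ^ (-α - 1)))) ?_ ?_ ?_ ?_
    · intro n
      exact (integrableOn_expRemainder he h1 h2 (hre n).le).aestronglyMeasurable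
    · exact ((integrableOn_min_rpow h1 h2).const_mul _).const_mul _
    · intro n
      filter_upwards [ae_restrict_mem measurableSet_Ioi] with y hy
      have hy : 0 < y := hy
      rw [norm_mul, Complex.norm_real, Real.norm_of_nonneg (by positivity)]
      calc _ ≤ 3 * ((1 + |s|) ^ e + (1 + |s|) ^ (e + 1)) * min (y ^ e) (y ^ (e + 1)) *
            (α * y ^ (-α - 1)) := by
            gcongr
            exact norm_expRemainder_mul_le he (hre n).le (hM n) hy.le
        _ = _ := by ring
    · refine ae_of_all _ fun y => Tendsto.mul_const _ ?_
      refine ((continuous_expRemainder e).tendsto _).comp ?_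
      have := (hlim.mul_const (y : ℂ)).neg
      simpa using this
  refine tendsto_nhds_unique hT ?_
  simp_rw [fun n => integral_expRemainder he h1 h2 (hre n)]
  have hc : ContinuousAt (fun z : ℂ => z ^ (α : ℂ)) (-(Complex.I * s)) := by
    refine continuousAt_cpow_const (Or.inr ?_)
    simpa using hs
  have := ((hc.tendsto.comp hlim).mul_const (Complex.Gamma (1 - α))).neg
  rw [cpow_neg_I_mul h0 h2' h1'] at this
  have hG : Complex.Gamma (1 - α) = ((Real.Gamma (1 - α) : ℝ) : ℂ) := by
    rw [← Complex.Gamma_ofReal]; push_cast; rfl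
  convert this using 2
  · rfl
  · rw [hG]
    push_cast
    ring

/-! ### The tapered Pareto law -/

section Pareto

variable {E : Type*} [NormedAddCommGroup E] [NormedSpace ℝ E]

lemma paretoMeasure_one_eq {α : ℝ} :
    paretoMeasure 1 α = (volume.restrict (Set.Ioi 1)).withDensity
      (fun x => ((α * x ^ (-α - 1)).toNNReal : ENNReal)) := by
  rw [paretoMeasure, restrict_Ioi_eq_restrict_Ici, ← withDensity_indicator measurableSet_Ici]
  congr 1
  funext x
  rw [paretoPDF_eq, Set.indicator_apply]
  simp only [Set.mem_Ici]
  split_ifs with h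
  · rw [Real.one_rpow, mul_one, neg_add']
    rfl
  · simp

lemma integral_paretoMeasure {α : ℝ} (hα : 0 < α) (f : ℝ → E) :
    ∫ x, f x ∂(paretoMeasure 1 α) = ∫ x in Set.Ioi (1 : ℝ), (α * x ^ (-α - 1)) • f x := by
  rw [paretoMeasure_one_eq, integral_withDensity_eq_integral_smul (by fun_prop)]
  refine setIntegral_congr_fun measurableSet_Ioi fun x hx => ?_
  have hx : 1 < x := hx
  simp only [NNReal.smul_def]
  rw [Real.coe_toNNReal _ (by positivity)]

lemma integrable_paretoMeasure_iff {α : ℝ} (hα : 0 < α) {f : ℝ → E} :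
    Integrable f (paretoMeasure 1 α) ↔
      IntegrableOn (fun x => (α * x ^ (-α - 1)) • f x) (Set.Ioi 1) := by
  rw [paretoMeasure_one_eq, integrable_withDensity_iff_integrable_smul (by fun_prop)]
  refine integrableOn_congr_fun (fun x hx => ?_) measurableSet_Ioi
  have hx : 1 < x := hx
  simp only [NNReal.smul_def]
  rw [Real.coe_toNNReal _ (by positivity)]

lemma ae_one_lt_paretoMeasure {α : ℝ} : ∀ᵐ x ∂(paretoMeasure 1 α), 1 < x := by
  rw [paretoMeasure_one_eq]
  exact (withDensity_absolutelyContinuous _ _).ae_le (ae_restrict_mem measurableSet_Ioi)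

lemma integrable_rpow_paretoMeasure {α p : ℝ} (hα : 0 < α) (hp : p < α) :
    Integrable (fun x => x ^ p) (paretoMeasure 1 α) := by
  rw [integrable_paretoMeasure_iff hα]
  refine IntegrableOn.congr_fun
    ((integrableOn_Ioi_rpow_of_lt (a := p - α - 1) (by linarith) zero_lt_one).const_mul α)
    (fun x hx => ?_) measurableSet_Ioi
  have hx : 0 < x := zero_lt_one.trans hx
  rw [smul_eq_mul, mul_assoc, ← Real.rpow_add hx]
  ring_nf

lemma setIntegral_Ici_rpow_paretoMeasure {α p b : ℝ} (hα : 0 < α) (hp : p < α) (hb : 1 ≤ b) :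
    ∫ x in Set.Ici b, x ^ p ∂(paretoMeasure 1 α) = α / (α - p) * b ^ (p - α) := by
  rw [← integral_indicator measurableSet_Ici, integral_paretoMeasure hα]
  have hb0 : 0 < b := by linarith
  have : ∀ x, (α * x ^ (-α - 1)) • (Set.Ici b).indicator (fun x => x ^ p) x =
      (Set.Ici b).indicator (fun x => α * x ^ (p - α - 1)) x := by
    intro x
    by_cases hx : x ∈ Set.Ici b
    · have hx0 : 0 < x := hb0.trans_le hx
      rw [Set.indicator_of_mem hx, Set.indicator_of_mem hx, smul_eq_mul, mul_assoc,
        ← Real.rpow_add hx0]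
      ring_nf
    · simp [Set.indicator_of_notMem hx]
  simp_rw [this]
  rw [← integral_Ici_eq_integral_Ioi, setIntegral_indicator measurableSet_Ici,
    Set.inter_eq_right.2 (Set.Ici_subset_Ici.2 hb), integral_Ici_eq_integral_Ioi,
    integral_const_mul, integral_Ioi_rpow_of_lt (by linarith) hb0]
  rw [show p - α - 1 + 1 = p - α by ring, div_mul_eq_mul_div, mul_div_assoc,
    ← neg_sub α p, div_neg, neg_div, neg_neg]

lemma paretoMeasure_real_Ici {α b : ℝ} (hα : 0 < α) (hb : 1 ≤ b) :
    (paretoMeasure 1 α).real (Set.Ici b) = b ^ (-α) := by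
  have := setIntegral_Ici_rpow_paretoMeasure (p := 0) hα hα hb
  simpa [hα.ne'] using this

instance : IsProbabilityMeasure (expMeasure 1) := isProbabilityMeasure_expMeasure one_pos

lemma expMeasure_one_eq : expMeasure 1 = (volume.restrict (Set.Ioi 0)).withDensity
      (fun x => ((Real.exp (-x)).toNNReal : ENNReal)) := by
  rw [restrict_Ioi_eq_restrict_Ici, ← withDensity_indicator measurableSet_Ici]
  change volume.withDensity (exponentialPDF 1) = _
  congr 1
  funext x
  rw [exponentialPDF_eq, Set.indicator_apply]
  simp only [Set.mem_Ici]
  split_ifs with h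
  · simp [ENNReal.ofReal]
  · simp

lemma ae_nonneg_expMeasure : ∀ᵐ x ∂(expMeasure 1), 0 ≤ x := by
  rw [expMeasure_one_eq]
  filter_upwards [(withDensity_absolutelyContinuous _ _).ae_le (ae_restrict_mem measurableSet_Ioi)]
    with x hx
  exact le_of_lt hx

lemma integrable_one_add_rpow_expMeasure {p : ℝ} (h2 : p ≤ 2) :
    Integrable (fun x => (1 + x) ^ p) (expMeasure 1) := by
  have key : Integrable (fun x : ℝ => (1 + x) ^ 2) (expMeasure 1) := by
    rw [expMeasure_one_eq, integrable_withDensity_iff_integrable_smul (by fun_prop)]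
    have h := fun s hs => integrableOn_rpow_mul_exp_neg_mul_rpow (p := 1) (s := s) (b := 1)
      hs one_pos one_pos
    refine IntegrableOn.congr_fun (((h 0 (by norm_num)).add ((h 1 (by norm_num)).const_mul 2)).add
      (h 2 (by norm_num))) (fun x hx => ?_) measurableSet_Ioi
    have hx : 0 < x := hx
    simp only [NNReal.smul_def, Pi.add_apply]
    rw [Real.coe_toNNReal _ (by positivity)]
    simp
    ring
  refine Integrable.mono' key (Measurable.aestronglyMeasurable (by fun_prop)) ?_
  filter_upwards [ae_nonneg_expMeasure] with x hx
  rw [Real.norm_of_nonneg (by positivity), ← Real.rpow_natCast]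
  exact Real.rpow_le_rpow_of_exponent_le (by linarith) (by exact_mod_cast h2)

/-- Splitting according to whether the Pareto variable lies below `b` reduces integrals to a
truncated Pareto integral and an exponential integral weighted by the tail mass. -/
lemma taperedParetoLaw_eq {α : ℝ} (hα : 0 < α) (b : ℝ) :
    taperedParetoLaw α b = (paretoMeasure 1 α).restrict (Set.Iio b) +
      paretoMeasure 1 α (Set.Ici b) • (expMeasure 1).map (fun r => b + r) := by
  have := isProbabilityMeasure_paretoMeasure one_pos hα
  have hm : Measurable (fun p : ℝ × ℝ => if p.1 < b then p.1 else b + p.2) :=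
    Measurable.ite (measurableSet_lt measurable_fst measurable_const) measurable_fst
      (measurable_const.add measurable_snd)
  ext A hA
  rw [taperedParetoLaw, Measure.map_apply hm hA, Measure.add_apply, Measure.smul_apply,
    Measure.map_apply (by fun_prop) hA, Measure.restrict_apply hA, smul_eq_mul,
    ← Measure.prod_prod]
  have : (fun p : ℝ × ℝ => if p.1 < b then p.1 else b + p.2) ⁻¹' A =
      ((A ∩ Set.Iio b) ×ˢ Set.univ) ∪ (Set.Ici b ×ˢ ((fun r => b + r) ⁻¹' A)) := by
    ext ⟨x, y⟩
    simp only [Set.mem_preimage, Set.mem_union, Set.mem_prod, Set.mem_inter_iff, Set.mem_Iio,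
      Set.mem_univ, and_true, Set.mem_Ici]
    split_ifs with h
    · simp [h]
    · simp [h, not_lt.1 h]
  rw [this, measure_union, Measure.prod_prod, measure_univ, mul_one]
  · rw [Set.disjoint_left]
    rintro ⟨x, y⟩ h1 h2
    exact not_lt.2 (Set.mem_Ici.1 h2.1) (Set.mem_Iio.1 h1.1.2)
  · exact measurableSet_Ici.prod (hA.preimage (by fun_prop))

lemma isProbabilityMeasure_taperedParetoLaw {α : ℝ} (hα : 0 < α) (b : ℝ) :
    IsProbabilityMeasure (taperedParetoLaw α b) := by
  have := isProbabilityMeasure_paretoMeasure one_pos hα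
  refine Measure.isProbabilityMeasure_map (Measurable.aemeasurable ?_)
  exact Measurable.ite (measurableSet_lt measurable_fst measurable_const) measurable_fst
      (measurable_const.add measurable_snd)

omit [NormedSpace ℝ E] in
lemma integrable_taperedParetoLaw {α b : ℝ} (hα : 0 < α) {f : ℝ → E}
    (hm : StronglyMeasurable f)
    (h1 : Integrable f (paretoMeasure 1 α)) (h2 : Integrable (fun r => f (b + r)) (expMeasure 1)) :
    Integrable f (taperedParetoLaw α b) := by
  have := isProbabilityMeasure_paretoMeasure one_pos hα
  rw [taperedParetoLaw_eq hα]
  refine h1.restrict.add_measure (Integrable.smul_measure ?_ (measure_ne_top _ _))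
  rwa [integrable_map_measure hm.aestronglyMeasurable (by fun_prop)]

lemma integral_taperedParetoLaw {α b : ℝ} (hα : 0 < α) (hb : 1 ≤ b) {f : ℝ → E}
    (hm : StronglyMeasurable f)
    (h1 : Integrable f (paretoMeasure 1 α)) (h2 : Integrable (fun r => f (b + r)) (expMeasure 1)) :
    ∫ x, f x ∂(taperedParetoLaw α b) = ∫ x in Set.Iio b, f x ∂(paretoMeasure 1 α) +
      (b ^ (-α)) • ∫ r, f (b + r) ∂(expMeasure 1) := by
  have := isProbabilityMeasure_paretoMeasure one_pos hα
  rw [taperedParetoLaw_eq hα, integral_add_measure h1.restrict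
    (Integrable.smul_measure
      (by rwa [integrable_map_measure hm.aestronglyMeasurable (by fun_prop)])
      (measure_ne_top _ _)), integral_smul_measure, integral_map (by fun_prop)
      hm.aestronglyMeasurable, ← paretoMeasure_real_Ici hα hb]
  rfl

end Pareto

/-! ### Remainder integrals of the Pareto and tapered Pareto laws. -/

lemma zero_le_of_eq_zero_or_one {e : ℝ} (he : e = 0 ∨ e = 1) : 0 ≤ e := by
  rcases he with rfl | rfl <;> norm_num

/-- The free exponent interpolates between the two orders of the remainder: `p = α` gives bounds
uniform in the tapering level, and `p = e` is used where a Pareto moment of order below `α` is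
needed. -/
lemma norm_expRemainder_I_mul_le {e p : ℝ} (he : e = 0 ∨ e = 1) (h1 : e ≤ p) (h2 : p ≤ e + 1)
    {s x : ℝ} (hx : 0 ≤ x) : ‖expRemainder e (Complex.I * s * x)‖ ≤ 3 * |s| ^ p * x ^ p := by
  refine (norm_expRemainder_le he (by simp)).trans ?_
  have : ‖Complex.I * s * x‖ = |s| * x := by
    rw [norm_mul, norm_mul, Complex.norm_I, one_mul, Complex.norm_real, Complex.norm_real,
      Real.norm_of_nonneg hx, Real.norm_eq_abs]
  rw [this, mul_assoc, ← Real.mul_rpow (abs_nonneg s) hx]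
  gcongr
  exact min_rpow_le (by positivity) (zero_le_of_eq_zero_or_one he) h1 h2

lemma stronglyMeasurable_expRemainder_I_mul (e s : ℝ) :
    StronglyMeasurable fun x : ℝ => expRemainder e (Complex.I * s * x) := by
  have := (continuous_expRemainder e)
  exact Continuous.stronglyMeasurable (by fun_prop)

lemma integrable_expRemainder_paretoMeasure {e α : ℝ} (he : e = 0 ∨ e = 1) (h1 : e < α) (s : ℝ) :
    Integrable (fun x : ℝ => expRemainder e (Complex.I * s * x)) (paretoMeasure 1 α) := by
  have he0 := zero_le_of_eq_zero_or_one he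
  refine Integrable.mono' ((integrable_rpow_paretoMeasure (he0.trans_lt h1) h1).const_mul
    (3 * |s| ^ e)) (stronglyMeasurable_expRemainder_I_mul e s).aestronglyMeasurable ?_
  filter_upwards [ae_one_lt_paretoMeasure] with x hx
  exact norm_expRemainder_I_mul_le he le_rfl (by linarith) (by linarith)

/-- As `1 ≤ b` and `0 ≤ r`, `b + r ≤ b * (1 + r)`, which separates the level from the exponential
variable; the latter then contributes only a constant. -/
lemma norm_expRemainder_shift_le {e p b : ℝ} (he : e = 0 ∨ e = 1) (h1 : e ≤ p) (h2 : p ≤ e + 1)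
    (hb : 1 ≤ b) (s : ℝ) : ∀ᵐ r ∂(expMeasure 1),
    ‖expRemainder e (Complex.I * s * (b + r : ℝ))‖ ≤ 3 * |s| ^ p * b ^ p * (1 + r) ^ p := by
  have he0 := zero_le_of_eq_zero_or_one he
  filter_upwards [ae_nonneg_expMeasure] with r hr
  refine (norm_expRemainder_I_mul_le he h1 h2 (by linarith)).trans ?_
  rw [mul_assoc (3 * |s| ^ p), ← Real.mul_rpow (by linarith) (by linarith)]
  have : b + r ≤ b * (1 + r) := by nlinarith
  have : (b + r) ^ p ≤ (b * (1 + r)) ^ p :=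
    Real.rpow_le_rpow (by linarith) this (he0.trans h1)
  gcongr

lemma integrable_expRemainder_shift {e b : ℝ} (he : e = 0 ∨ e = 1) (hb : 1 ≤ b) (s : ℝ) :
    Integrable (fun r : ℝ => expRemainder e (Complex.I * s * (b + r : ℝ))) (expMeasure 1) := by
  have he2 : e ≤ 2 := by rcases he with rfl | rfl <;> norm_num
  refine Integrable.mono' ((integrable_one_add_rpow_expMeasure he2).const_mul
    (3 * |s| ^ e * b ^ e)) ?_ (norm_expRemainder_shift_le he le_rfl (by linarith) hb s)
  exact ((stronglyMeasurable_expRemainder_I_mul e s).comp_measurable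
    (by fun_prop : Measurable fun r : ℝ => b + r)).aestronglyMeasurable

lemma norm_integral_expRemainder_shift_le {e p b : ℝ} (he : e = 0 ∨ e = 1) (h1 : e ≤ p)
    (h2 : p ≤ e + 1) (hb : 1 ≤ b) (s : ℝ) :
    ‖∫ r : ℝ, expRemainder e (Complex.I * s * (b + r : ℝ)) ∂(expMeasure 1)‖ ≤
      3 * |s| ^ p * b ^ p * ∫ r : ℝ, (1 + r) ^ p ∂(expMeasure 1) := by
  have hp2 : p ≤ 2 := by rcases he with rfl | rfl <;> linarith
  rw [← integral_const_mul]
  exact norm_integral_le_of_norm_le ((integrable_one_add_rpow_expMeasure hp2).const_mul _)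
    (norm_expRemainder_shift_le he h1 h2 hb s)

lemma integral_min_rpow_mul {e α s : ℝ} (hs : 0 < s) :
    ∫ y in Set.Ioi (0 : ℝ), min ((s * y) ^ e) ((s * y) ^ (e + 1)) * y ^ (-α - 1) =
      s ^ α * ∫ y in Set.Ioi (0 : ℝ), min (y ^ e) (y ^ (e + 1)) * y ^ (-α - 1) := by
  have := integral_comp_mul_left_Ioi
    (fun y : ℝ => min (y ^ e) (y ^ (e + 1)) * y ^ (-α - 1)) 0 hs
  rw [mul_zero, smul_eq_mul, inv_mul_eq_div, eq_div_iff hs.ne'] at this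
  rw [← this, mul_comm, mul_assoc, ← integral_mul_const]
  refine setIntegral_congr_fun measurableSet_Ioi fun y hy => ?_
  have hy : 0 < y := hy
  rw [Real.mul_rpow (x := s) (z := -α - 1) hs.le hy.le]
  have : s ^ α * (s * s ^ (-α - 1)) = 1 := by
    nth_rw 2 [← Real.rpow_one s]
    rw [← Real.rpow_add hs, ← Real.rpow_add hs]
    simp
  linear_combination (-(min ((s * y) ^ e) ((s * y) ^ (e + 1)) * y ^ (-α - 1))) * this

/-- Uniform bound for the remainder of the characteristic function of the tapered Pareto law. -/
lemma exists_norm_integral_expRemainder_le {e α : ℝ} (he : e = 0 ∨ e = 1) (h1 : e < α)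
    (h2 : α < e + 1) : ∃ K, 0 ≤ K ∧ ∀ b s : ℝ, 1 ≤ b →
    ‖∫ x : ℝ, expRemainder e (Complex.I * s * x) ∂(taperedParetoLaw α b)‖ ≤ K * |s| ^ α := by
  have he0 := zero_le_of_eq_zero_or_one he
  have hα : 0 < α := he0.trans_lt h1
  have := isProbabilityMeasure_paretoMeasure one_pos hα
  set J := ∫ y in Set.Ioi (0 : ℝ), min (y ^ e) (y ^ (e + 1)) * y ^ (-α - 1) with hJ
  set R := ∫ r : ℝ, (1 + r) ^ α ∂(expMeasure 1) with hR
  have hJ0 : 0 ≤ J := setIntegral_nonneg measurableSet_Ioi fun y hy => by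
    have hy : 0 < y := hy
    positivity
  have hR0 : 0 ≤ R := integral_nonneg_of_ae (by
    filter_upwards [ae_nonneg_expMeasure] with r hr
    simp only [Pi.zero_apply]; positivity)
  refine ⟨3 * α * J + 3 * R, by positivity, fun b s hb => ?_⟩
  rcases eq_or_ne s 0 with rfl | hs
  · simp [expRemainder, hα.ne']
  have hs : 0 < |s| := abs_pos.2 hs
  have hb0 : 0 < b := by linarith
  rw [integral_taperedParetoLaw hα hb (stronglyMeasurable_expRemainder_I_mul e s)
    (integrable_expRemainder_paretoMeasure he h1 s) (integrable_expRemainder_shift he hb s)]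
  refine (norm_add_le _ _).trans ?_
  rw [add_mul]
  refine add_le_add ?_ ?_
  · have hg : IntegrableOn
        (fun y => α * (3 * (min ((|s| * y) ^ e) ((|s| * y) ^ (e + 1)) * y ^ (-α - 1))))
        (Set.Ioi 0) := by
      refine (((integrableOn_min_rpow h1 h2).const_mul (3 * (|s| ^ e + |s| ^ (e + 1)))).const_mul
        α).mono' (Measurable.aestronglyMeasurable (by fun_prop)) ?_
      filter_upwards [ae_restrict_mem measurableSet_Ioi] with y hy
      have hy : 0 < y := hy
      rw [Real.norm_of_nonneg (by positivity), mul_assoc 3, ← mul_assoc (_ + _)]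
      gcongr
      rw [Real.mul_rpow hs.le hy.le, Real.mul_rpow hs.le hy.le,
        mul_min_of_nonneg _ _ (by positivity)]
      have : |s| ^ e ≤ |s| ^ e + |s| ^ (e + 1) := le_add_of_nonneg_right (by positivity)
      have : |s| ^ (e + 1) ≤ |s| ^ e + |s| ^ (e + 1) := le_add_of_nonneg_left (by positivity)
      gcongr
    calc ‖∫ x in Set.Iio b, expRemainder e (Complex.I * s * x) ∂(paretoMeasure 1 α)‖
        ≤ ∫ x in Set.Iio b, ‖expRemainder e (Complex.I * s * x)‖ ∂(paretoMeasure 1 α) :=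
          norm_integral_le_integral_norm _
      _ ≤ ∫ x, ‖expRemainder e (Complex.I * s * x)‖ ∂(paretoMeasure 1 α) :=
          setIntegral_le_integral (integrable_expRemainder_paretoMeasure he h1 s).norm
            (ae_of_all _ fun _ => norm_nonneg _)
      _ ≤ ∫ y in Set.Ioi (1 : ℝ),
          α * (3 * (min ((|s| * y) ^ e) ((|s| * y) ^ (e + 1)) * y ^ (-α - 1))) := by
          rw [integral_paretoMeasure hα]
          refine setIntegral_mono_on ?_ (hg.mono_set (Set.Ioi_subset_Ioi zero_le_one))
            measurableSet_Ioi fun y hy => ?_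
          · exact (integrable_paretoMeasure_iff hα).1
              (integrable_expRemainder_paretoMeasure he h1 s).norm
          · have hy : 0 < y := zero_lt_one.trans hy
            have h : ‖Complex.I * s * y‖ = |s| * y := by
              rw [norm_mul, norm_mul, Complex.norm_I, one_mul, Complex.norm_real,
                Complex.norm_real, Real.norm_of_nonneg hy.le, Real.norm_eq_abs]
            have := norm_expRemainder_le he (z := Complex.I * s * y) (by simp)
            rw [h] at this
            rw [smul_eq_mul, mul_assoc]
            refine mul_le_mul_of_nonneg_left ?_ hα.le
            rw [mul_comm, ← mul_assoc]
            gcongr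
      _ ≤ ∫ y in Set.Ioi (0 : ℝ),
          α * (3 * (min ((|s| * y) ^ e) ((|s| * y) ^ (e + 1)) * y ^ (-α - 1))) := by
          refine setIntegral_mono_set hg ?_ (Set.Ioi_subset_Ioi zero_le_one).eventuallyLE
          filter_upwards [ae_restrict_mem measurableSet_Ioi] with y hy
          have hy : 0 < y := hy
          simp only [Pi.zero_apply]
          positivity
      _ = 3 * α * J * |s| ^ α := by
          rw [integral_const_mul, integral_const_mul, integral_min_rpow_mul hs]
          ring
  -- The mass `b ^ (-α)` above the level cancels the `b ^ α` coming from the shifted exponential, so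
  -- the bound is free of `b`.
  · rw [norm_smul, Real.norm_of_nonneg (by positivity)]
    have := norm_integral_expRemainder_shift_le he h1.le h2.le hb s
    calc _ ≤ b ^ (-α) * (3 * |s| ^ α * b ^ α * R) := by gcongr
      _ = (b ^ (-α) * b ^ α) * (3 * R * |s| ^ α) := by ring
      _ = _ := by rw [← Real.rpow_add hb0]; simp

/-- The effect of the tempering on the remainder. -/
lemma exists_norm_integral_expRemainder_sub_le {e α : ℝ} (he : e = 0 ∨ e = 1) (h1 : e < α) :
    ∃ K, 0 ≤ K ∧ ∀ b s : ℝ, 1 ≤ b →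
    ‖∫ x : ℝ, expRemainder e (Complex.I * s * x) ∂(taperedParetoLaw α b) -
      ∫ x : ℝ, expRemainder e (Complex.I * s * x) ∂(paretoMeasure 1 α)‖ ≤
      K * |s| ^ e * b ^ (e - α) := by
  have he0 := zero_le_of_eq_zero_or_one he
  have hα : 0 < α := he0.trans_lt h1
  set R := ∫ r : ℝ, (1 + r) ^ e ∂(expMeasure 1) with hR
  have hR0 : 0 ≤ R := integral_nonneg_of_ae (by
    filter_upwards [ae_nonneg_expMeasure] with r hr
    simp only [Pi.zero_apply]; positivity)
  have hd : 0 < α - e := by linarith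
  -- The two summands bound what the tapering removes, through the Pareto tail moment of order `e`,
  -- and what it inserts, through the shifted exponential.
  refine ⟨3 * (α / (α - e)) + 3 * R, by positivity, fun b s hb => ?_⟩
  have hb0 : 0 < b := by linarith
  have hi := integrable_expRemainder_paretoMeasure he h1 s
  rw [integral_taperedParetoLaw hα hb (stronglyMeasurable_expRemainder_I_mul e s)
    hi (integrable_expRemainder_shift he hb s), ← integral_add_compl measurableSet_Iio hi,
    add_sub_add_left_eq_sub, Set.compl_Iio]
  refine (norm_sub_le _ _).trans ?_
  rw [add_comm, add_mul, add_mul]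
  refine add_le_add ?_ ?_
  · have := norm_integral_le_of_norm_le
      (f := fun x : ℝ => expRemainder e (Complex.I * s * x))
      (g := fun x => 3 * |s| ^ e * x ^ e) (μ := (paretoMeasure 1 α).restrict (Set.Ici b))
      ((integrable_rpow_paretoMeasure hα h1).restrict.const_mul _)
      (by
        filter_upwards [ae_restrict_mem measurableSet_Ici] with x hx
        exact norm_expRemainder_I_mul_le he le_rfl (by linarith) (hb0.le.trans hx))
    rw [integral_const_mul, setIntegral_Ici_rpow_paretoMeasure hα h1 hb] at this
    exact this.trans (le_of_eq (by ring))
  · rw [norm_smul, Real.norm_of_nonneg (by positivity)]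
    have := norm_integral_expRemainder_shift_le he le_rfl (by linarith) hb s
    calc _ ≤ b ^ (-α) * (3 * |s| ^ e * b ^ e * R) := by gcongr
      _ = 3 * R * |s| ^ e * (b ^ e * b ^ (-α)) := by ring
      _ = _ := by rw [← Real.rpow_add hb0, ← sub_eq_add_neg]

/-- The Pareto law belongs to the domain of attraction of the stable law. -/
lemma tendsto_integral_expRemainder_paretoMeasure {e α : ℝ} (he : e = 0 ∨ e = 1) (h1 : e < α)
    (h2 : α < e + 1) {v : ℕ → ℝ} {w : ℝ} (hv : Tendsto v atTop (𝓝 w)) :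
    Tendsto (fun n : ℕ => (n : ℂ) * ∫ x : ℝ,
        expRemainder e (Complex.I * (v n * (n : ℝ) ^ (-1 / α) : ℝ) * x) ∂(paretoMeasure 1 α)) atTop
      (𝓝 ((Real.Gamma (1 - α) * Real.cos (Real.pi * α / 2) : ℝ) * stableExponent α w)) := by
  have he0 := zero_le_of_eq_zero_or_one he
  have hα : 0 < α := he0.trans_lt h1
  rw [← integral_expRemainder_I_mul he h1 h2]
  have hε : Tendsto (fun n : ℕ => (n : ℝ) ^ (-1 / α)) atTop (𝓝 0) := by
    have := (tendsto_rpow_neg_atTop (y := 1 / α) (by positivity)).comp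
      tendsto_natCast_atTop_atTop
    exact this.congr fun n => by simp [neg_div]
  -- The substitution `y = n ^ (-1/α) x` turns `n` times the Pareto law into the Lévy density `α y ^
  -- (-α - 1)` restricted to `y > n ^ (-1/α)`; the restriction disappears in the limit.
  have hscale : ∀ᶠ n : ℕ in atTop, ∫ y in Set.Ioi (0 : ℝ),
      (Set.Ioi ((n : ℝ) ^ (-1 / α))).indicator (fun y : ℝ => expRemainder e
        (Complex.I * v n * y) * ((α * y ^ (-α - 1) : ℝ) : ℂ)) y = (n : ℂ) * ∫ x : ℝ,
        expRemainder e (Complex.I * (v n * (n : ℝ) ^ (-1 / α) : ℝ) * x)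
          ∂(paretoMeasure 1 α) := by
    filter_upwards [eventually_gt_atTop 0] with n hn
    have hn0 : (0 : ℝ) < n := by exact_mod_cast hn
    set ε := (n : ℝ) ^ (-1 / α) with hεd
    have hε0 : 0 < ε := by positivity
    have hεα : ε ^ α = (n : ℝ)⁻¹ := by
      rw [hεd, ← Real.rpow_mul hn0.le, div_mul_cancel₀ _ hα.ne', Real.rpow_neg_one]
    rw [setIntegral_indicator measurableSet_Ioi, Set.inter_eq_right.2
      (Set.Ioi_subset_Ioi hε0.le), integral_paretoMeasure hα]
    have := integral_comp_mul_left_Ioi (fun y : ℝ => expRemainder e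
        (Complex.I * v n * y) * ((α * y ^ (-α - 1) : ℝ) : ℂ)) 1 hε0
    rw [mul_one, eq_inv_smul_iff₀ hε0.ne'] at this
    rw [← this, ← integral_smul, ← integral_const_mul]
    refine setIntegral_congr_fun measurableSet_Ioi fun y hy => ?_
    have hy : 0 < y := zero_lt_one.trans hy
    simp only [Complex.real_smul]
    rw [Real.mul_rpow hε0.le hy.le]
    have h3 : ε * ε ^ (-α - 1) = n := by
      nth_rw 1 [← Real.rpow_one ε]
      rw [← Real.rpow_add hε0, show 1 + (-α - 1) = -α by ring, Real.rpow_neg hε0.le, hεα, inv_inv]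
    rw [show (n : ℂ) = ((n : ℝ) : ℂ) by norm_cast, ← h3]
    push_cast
    ring_nf
  refine Tendsto.congr' hscale ?_
  -- A convergent sequence is bounded, which makes the domination uniform in `n`.
  obtain ⟨N, hN⟩ : ∃ M, ∀ n, |v n| ≤ M := by
    obtain ⟨M, hM⟩ := (hv.abs.bddAbove_range)
    exact ⟨M, fun n => hM ⟨n, rfl⟩⟩
  have hN0 : 0 ≤ N := (abs_nonneg _).trans (hN 0)
  have hbound : ∀ n : ℕ, ∀ y : ℝ, 0 < y → ‖expRemainder e (Complex.I * v n * y) *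
      ((α * y ^ (-α - 1) : ℝ) : ℂ)‖ ≤
      α * (3 * (N ^ e + N ^ (e + 1)) * (min (y ^ e) (y ^ (e + 1)) * y ^ (-α - 1))) := by
    intro n y hy
    rw [norm_mul, Complex.norm_real, Real.norm_of_nonneg (by positivity)]
    have := norm_expRemainder_mul_le he (r := -(Complex.I * v n)) (M := N) (by simp)
      (by simpa using hN n) hy.le
    rw [neg_mul, neg_neg] at this
    calc _ ≤ 3 * (N ^ e + N ^ (e + 1)) * min (y ^ e) (y ^ (e + 1)) *
            (α * y ^ (-α - 1)) := by gcongr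
      _ = _ := by ring
  refine tendsto_integral_of_dominated_convergence (fun y =>
      α * (3 * (N ^ e + N ^ (e + 1)) * (min (y ^ e) (y ^ (e + 1)) * y ^ (-α - 1)))) ?_ ?_ ?_ ?_
  · intro n
    have := (continuous_expRemainder e).measurable
    exact (Measurable.indicator (by fun_prop) measurableSet_Ioi).aestronglyMeasurable
  · exact ((integrableOn_min_rpow h1 h2).const_mul _).const_mul _
  · intro n
    filter_upwards [ae_restrict_mem measurableSet_Ioi] with y hy
    exact (norm_indicator_le_norm_self _ _).trans (hbound n y hy)
  · filter_upwards [ae_restrict_mem measurableSet_Ioi] with y hy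
    have : Tendsto (fun n => expRemainder e (Complex.I * v n * y) *
        ((α * y ^ (-α - 1) : ℝ) : ℂ)) atTop
        (𝓝 (expRemainder e (Complex.I * w * y) * ((α * y ^ (-α - 1) : ℝ) : ℂ))) := by
      refine Tendsto.mul_const _ (((continuous_expRemainder e).tendsto _).comp ?_)
      exact (((Complex.continuous_ofReal.tendsto _).comp hv).const_mul _).mul_const _
    refine this.congr' ?_
    filter_upwards [hε.eventually (eventually_lt_nhds hy)] with n hn
    rw [Set.indicator_of_mem (Set.mem_Ioi.2 hn)]

/-! ### Homogeneity, continuity and growth of the stable exponent. -/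

lemma stableExponent_mul {α κ : ℝ} (hκ : 0 < κ) (s : ℝ) :
    stableExponent α (κ * s) = (κ ^ α : ℝ) * stableExponent α s := by
  rw [stableExponent, stableExponent, abs_mul, abs_of_pos hκ, Real.mul_rpow hκ.le (abs_nonneg s)]
  have : Real.sign (κ * s) = Real.sign s := by
    rcases lt_trichotomy s 0 with h | rfl | h
    · rw [Real.sign_of_neg h, Real.sign_of_neg (mul_neg_of_pos_of_neg hκ h)]
    · simp
    · rw [Real.sign_of_pos h, Real.sign_of_pos (mul_pos hκ h)]
  rw [this]
  push_cast
  ring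

/-- The jump of the sign at zero is absorbed by the factor `|s| ^ α`. -/
lemma continuous_stableExponent {α : ℝ} (hα : 0 < α) : Continuous (stableExponent α) := by
  have h1 : Continuous fun s : ℝ => |s| ^ α := by
    exact continuous_abs.rpow_const fun _ => Or.inr hα.le
  have h2 : Continuous fun s : ℝ => |s| ^ α * Real.sign s := by
    rw [continuous_iff_continuousAt]
    intro s
    rcases lt_trichotomy s 0 with h | rfl | h
    · refine (h1.continuousAt (x := s)).neg.congr ?_
      filter_upwards [eventually_lt_nhds h] with x hx
      rw [Real.sign_of_neg hx, mul_neg_one, Pi.neg_apply]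
    · rw [ContinuousAt, Real.sign_zero, mul_zero]
      have h3 : Tendsto (fun s : ℝ => |s| ^ α) (𝓝 0) (𝓝 0) := by
        simpa [hα.ne'] using h1.tendsto 0
      refine squeeze_zero_norm (fun x => ?_) h3
      rw [norm_mul, Real.norm_of_nonneg (by positivity)]
      refine mul_le_of_le_one_right (by positivity) ?_
      rcases Real.sign_apply_eq x with h | h | h <;> simp [h]
    · refine (h1.continuousAt (x := s)).congr ?_
      filter_upwards [eventually_gt_nhds h] with x hx
      rw [Real.sign_of_pos hx, mul_one]
  have : stableExponent α = fun s => -((|s| ^ α : ℝ) : ℂ) +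
      Complex.I * ((|s| ^ α * Real.sign s * Real.tan (Real.pi * α / 2) : ℝ) : ℂ) := by
    funext s
    rw [stableExponent]
    push_cast
    ring
  rw [this]
  fun_prop

lemma exists_norm_stableExponent_le (α : ℝ) :
    ∃ K, 0 ≤ K ∧ ∀ s, ‖stableExponent α s‖ ≤ K * |s| ^ α := by
  refine ⟨1 + |Real.tan (Real.pi * α / 2)|, by positivity, fun s => ?_⟩
  rw [stableExponent, norm_mul, norm_neg, Complex.norm_real, Real.norm_of_nonneg (by positivity),
    mul_comm]
  gcongr
  refine (norm_sub_le _ _).trans ?_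
  rw [norm_one, norm_mul, Complex.norm_I, one_mul, Complex.norm_real, Real.norm_eq_abs, abs_mul]
  gcongr
  refine mul_le_of_le_one_left (abs_nonneg _) ?_
  rcases Real.sign_apply_eq s with h | h | h <;> simp [h]

/-! ### Characteristic functions of the tapered innovations. -/

section Innovation

variable {α : ℝ}

lemma charFun_taperedParetoLaw_of_lt_one (h0 : 0 < α) (b s : ℝ) :
    charFun (taperedParetoLaw α b) s =
      1 + ∫ x : ℝ, expRemainder 0 (Complex.I * s * x) ∂(taperedParetoLaw α b) := by
  have := isProbabilityMeasure_taperedParetoLaw h0 b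
  simp only [expRemainder, Complex.ofReal_zero, zero_mul, sub_zero]
  rw [integral_sub _ (integrable_const _), charFun_apply_real]
  · simp [mul_comm, mul_left_comm]
  · refine Integrable.of_bound (Measurable.aestronglyMeasurable (by fun_prop)) 1
      (ae_of_all _ fun x => ?_)
    rw [Complex.norm_exp]; simp

/-- The part above the level contributes at most a constant times `b ^ (1 - α) ≤ 1` to the mean, so
the centering stays bounded as the level grows. -/
lemma integrable_id_taperedParetoLaw (h1 : 1 < α) :
    (∀ b, Integrable (fun x : ℝ => x) (taperedParetoLaw α b)) ∧
    ∃ M, 0 ≤ M ∧ ∀ b, 1 ≤ b → |∫ x, x ∂(taperedParetoLaw α b)| ≤ M := by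
  have h0 : 0 < α := by linarith
  have hP : Integrable (fun x : ℝ => x) (paretoMeasure 1 α) := by
    simpa using integrable_rpow_paretoMeasure h0 h1
  have hE1 : Integrable (fun x : ℝ => 1 + x) (expMeasure 1) := by
    simpa using integrable_one_add_rpow_expMeasure one_le_two
  have hE : ∀ b : ℝ, Integrable (fun x : ℝ => b + x) (expMeasure 1) := fun b => by
    have := hE1.add (integrable_const (b - 1))
    refine this.congr (ae_of_all _ fun x => ?_)
    simp only [Pi.add_apply]; ring
  refine ⟨fun b => integrable_taperedParetoLaw h0 stronglyMeasurable_id hP (hE b),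
    ∫ x, |x| ∂(paretoMeasure 1 α) + ∫ x, (1 + x) ∂(expMeasure 1), ?_, fun b hb => ?_⟩
  · refine add_nonneg (integral_nonneg fun _ => abs_nonneg _) (integral_nonneg_of_ae ?_)
    filter_upwards [ae_nonneg_expMeasure] with r hr
    simp only [Pi.zero_apply]; linarith
  · have hb0 : 0 < b := by linarith
    rw [integral_taperedParetoLaw (f := fun x => x) h0 hb stronglyMeasurable_id hP (hE b)]
    refine (abs_add_le _ _).trans (add_le_add ?_ ?_)
    · refine abs_integral_le_integral_abs.trans ?_
      exact setIntegral_le_integral hP.abs (ae_of_all _ fun _ => abs_nonneg _)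
    · have : ‖∫ r, (b + r) ∂(expMeasure 1)‖ ≤ ∫ r, b * (1 + r) ∂(expMeasure 1) := by
        refine norm_integral_le_of_norm_le (hE1.const_mul b) ?_
        filter_upwards [ae_nonneg_expMeasure] with r hr
        rw [Real.norm_of_nonneg (by linarith)]
        nlinarith
      rw [integral_const_mul, Real.norm_eq_abs] at this
      rw [smul_eq_mul, abs_mul, abs_of_pos (by positivity)]
      calc _ ≤ b ^ (-α) * (b * ∫ r, (1 + r) ∂(expMeasure 1)) := by gcongr
        _ = b ^ (1 - α) * ∫ r, (1 + r) ∂(expMeasure 1) := by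
            rw [← mul_assoc, show 1 - α = -α + 1 by ring, Real.rpow_add hb0, Real.rpow_one]
        _ ≤ _ := by
            refine mul_le_of_le_one_left (integral_nonneg_of_ae ?_)
              (Real.rpow_le_one_of_one_le_of_nonpos hb (by linarith))
            filter_upwards [ae_nonneg_expMeasure] with r hr
            simp only [Pi.zero_apply]; linarith

lemma charFun_taperedParetoLaw_of_one_lt (h1 : 1 < α) (b s : ℝ) :
    charFun (taperedParetoLaw α b) s =
      1 + Complex.I * (s * ∫ x, x ∂(taperedParetoLaw α b) : ℝ) +
        ∫ x : ℝ, expRemainder 1 (Complex.I * s * x) ∂(taperedParetoLaw α b) := by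
  have h0 : 0 < α := by linarith
  have := isProbabilityMeasure_taperedParetoLaw h0 b
  have hi := (integrable_id_taperedParetoLaw h1).1 b
  have he : Integrable (fun x : ℝ => Complex.exp (Complex.I * s * x)) (taperedParetoLaw α b) := by
    refine Integrable.of_bound (Measurable.aestronglyMeasurable (by fun_prop)) 1
      (ae_of_all _ fun x => ?_)
    rw [Complex.norm_exp]; simp
  simp only [expRemainder, Complex.ofReal_one, one_mul]
  have he' : Integrable (fun x : ℝ => Complex.exp (Complex.I * s * x) - 1)
      (taperedParetoLaw α b) := he.sub (integrable_const _)
  have hi' : Integrable (fun x : ℝ => Complex.I * s * (x : ℂ)) (taperedParetoLaw α b) :=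
    hi.ofReal.const_mul _
  rw [integral_sub he' hi', integral_const_mul, integral_complex_ofReal, integral_sub he (integrable_const _), charFun_apply_real]
  simp [mul_comm, mul_left_comm]
  ring

/-- With `y = s m` and `m` the mean, this expands `exp (-iy) (1 + iy + R) - 1`. Grouped in this way,
the first two terms are jointly of second order in `y`, and only the remainder `R` matters in the
limit. -/
lemma charFun_innovationLaw_of_one_lt (h1 : 1 < α) (b s : ℝ) :
    charFun (innovationLaw α b) s - 1 =
      expRemainder 1 (-(Complex.I * (s * ∫ x, x ∂(taperedParetoLaw α b) : ℝ))) +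
      expRemainder 0 (-(Complex.I * (s * ∫ x, x ∂(taperedParetoLaw α b) : ℝ))) *
        (Complex.I * (s * ∫ x, x ∂(taperedParetoLaw α b) : ℝ)) +
      Complex.exp (-(Complex.I * (s * ∫ x, x ∂(taperedParetoLaw α b) : ℝ))) *
        ∫ x : ℝ, expRemainder 1 (Complex.I * s * x) ∂(taperedParetoLaw α b) := by
  set m := ∫ x, x ∂(taperedParetoLaw α b) with hm
  have : charFun (innovationLaw α b) s =
      Complex.exp (-(Complex.I * (s * m : ℝ))) * charFun (taperedParetoLaw α b) s := by
    rw [innovationLaw, if_neg (not_lt.2 h1.le)]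
    simp_rw [sub_eq_add_neg]
    rw [charFun_map_add_const, mul_comm]
    congr 2
    simp
    ring
  rw [this, charFun_taperedParetoLaw_of_one_lt h1, ← hm]
  simp only [expRemainder]
  push_cast
  ring

lemma charFun_innovationLaw_of_lt_one (h0 : 0 < α) (h1 : α < 1) (b s : ℝ) :
    charFun (innovationLaw α b) s - 1 =
      ∫ x : ℝ, expRemainder 0 (Complex.I * s * x) ∂(taperedParetoLaw α b) := by
  rw [innovationLaw, if_pos h1, charFun_taperedParetoLaw_of_lt_one h0]
  ring

/-- Used with `p = α` for the bound uniform in the level, and with `p = 2` to see that the centering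
error is negligible. -/
lemma norm_centering_le {p : ℝ} (hp1 : 1 ≤ p) (hp2 : p ≤ 2) (y : ℝ) :
    ‖expRemainder 1 (-(Complex.I * y)) +
      expRemainder 0 (-(Complex.I * y)) * (Complex.I * y)‖ ≤ 6 * |y| ^ p := by
  have hy : ‖-(Complex.I * y)‖ = |y| := by simp
  have hb1 := norm_expRemainder_le (Or.inr rfl) (z := -(Complex.I * y)) (by simp)
  have hb2 := norm_expRemainder_le (Or.inl rfl) (z := -(Complex.I * y)) (by simp)
  rw [hy] at hb1 hb2
  have h1 := min_rpow_le (abs_nonneg y) zero_le_one hp1 (by linarith)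
  have h2 := min_rpow_le (abs_nonneg y) (le_refl 0) (p := p - 1) (by linarith) (by linarith)
  refine (norm_add_le _ _).trans ?_
  rw [norm_mul, ← norm_neg (Complex.I * y), hy]
  have h3 : |y| ^ (p - 1) * |y| = |y| ^ p := by
    rcases eq_or_ne y 0 with rfl | hy
    · simp [Real.zero_rpow (by linarith : p ≠ 0)]
    · rw [Real.rpow_sub_one (abs_pos.2 hy).ne', div_mul_cancel₀ _ (abs_pos.2 hy).ne']
  calc _ ≤ 3 * |y| ^ p + 3 * |y| ^ (p - 1) * |y| := by
        gcongr
        · exact hb1.trans (by gcongr)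
        · exact hb2.trans (by gcongr)
    _ = 6 * |y| ^ p := by rw [mul_assoc, h3]; ring

/-- Uniformity in `b` and homogeneity of degree `α` in `s` are what permit dominated convergence in
`L^α`: after the scaling by `n ^ (-1/α)`, the factor `n` is exactly compensated. -/
lemma exists_norm_charFun_innovationLaw_sub_one_le (h0 : 0 < α) (h2 : α < 2) (h1 : α ≠ 1) :
    ∃ K, 0 ≤ K ∧ ∀ b s : ℝ, 1 ≤ b → ‖charFun (innovationLaw α b) s - 1‖ ≤ K * |s| ^ α := by
  rcases lt_or_gt_of_ne h1 with h | h
  · obtain ⟨K, hK0, hK⟩ := exists_norm_integral_expRemainder_le (Or.inl rfl) h0 (by linarith)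
    refine ⟨K, hK0, fun b s hb => ?_⟩
    rw [charFun_innovationLaw_of_lt_one h0 h]
    exact hK b s hb
  · have h : 1 < α := h
    obtain ⟨K, hK0, hK⟩ := exists_norm_integral_expRemainder_le (Or.inr rfl) h (by linarith)
    obtain ⟨-, M, hM0, hM⟩ := integrable_id_taperedParetoLaw h
    refine ⟨6 * M ^ α + K, by positivity, fun b s hb => ?_⟩
    rw [charFun_innovationLaw_of_one_lt h, add_mul]
    refine (norm_add_le _ _).trans (add_le_add ?_ ?_)
    · refine (norm_centering_le h.le h2.le _).trans ?_
      rw [abs_mul, Real.mul_rpow (abs_nonneg _) (abs_nonneg _), mul_assoc, mul_comm (|s| ^ α)]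
      gcongr
      exact hM b hb
    · rw [norm_mul, Complex.norm_exp]
      simpa using hK b s hb

/-- The tapered Pareto innovations are in the domain of attraction of the stable law. -/
lemma tendsto_charFun_innovationLaw {γ : ℝ} (h0 : 0 < α) (h2 : α < 2) (h1 : α ≠ 1)
    (hγ : 1 / α < γ) {v : ℕ → ℝ} {w : ℝ} (hv : Tendsto v atTop (𝓝 w)) :
    Tendsto (fun n : ℕ => (n : ℂ) * (charFun (innovationLaw α ((n : ℝ) ^ γ))
      (v n * ((Real.Gamma (1 - α) * Real.cos (Real.pi * α / 2)) ^ (-1 / α) *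
        (n : ℝ) ^ (-1 / α))) - 1)) atTop (𝓝 (stableExponent α w)) := by
  set C := Real.Gamma (1 - α) * Real.cos (Real.pi * α / 2) with hC
  have hC0 : 0 < C := Gamma_mul_cos_pos h0 h2 h1
  set κ := C ^ (-1 / α) with hκ
  have hκ0 : 0 < κ := by positivity
  have hκα : κ ^ α = C⁻¹ := by
    rw [hκ, ← Real.rpow_mul hC0.le, div_mul_cancel₀ _ h0.ne', Real.rpow_neg_one]
  have hγ0 : 0 < γ := lt_trans (by positivity) hγ
  set s : ℕ → ℝ := fun n => v n * (κ * (n : ℝ) ^ (-1 / α)) with hs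
  have hvκ : Tendsto (fun n => κ * v n) atTop (𝓝 (κ * w)) := hv.const_mul κ
  have hb : ∀ n : ℕ, 0 < n → 1 ≤ (n : ℝ) ^ γ := fun n hn =>
    Real.one_le_rpow (by exact_mod_cast hn) hγ0.le
  have hsn : ∀ n : ℕ, ∀ p : ℝ, |s n| ^ p = |κ * v n| ^ p * (n : ℝ) ^ (-p / α) := by
    intro n p
    have : s n = κ * v n * (n : ℝ) ^ (-1 / α) := by rw [hs]; ring
    rw [this, abs_mul, Real.mul_rpow (abs_nonneg _) (abs_nonneg _),
      abs_of_nonneg (Real.rpow_nonneg (Nat.cast_nonneg n) (-1 / α)),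
      ← Real.rpow_mul (Nat.cast_nonneg n)]
    congr 2
    ring
  have hpow : ∀ q : ℝ, q < 0 → Tendsto (fun n : ℕ => (n : ℝ) ^ q) atTop (𝓝 0) := by
    intro q hq
    have := (tendsto_rpow_neg_atTop (y := -q) (by linarith)).comp
      tendsto_natCast_atTop_atTop
    exact this.congr fun n => by simp
  have hD : ∀ e : ℝ, e = 0 ∨ e = 1 → e < α → α < e + 1 →
      Tendsto (fun n : ℕ => (n : ℂ) * ∫ x : ℝ, expRemainder e (Complex.I * s n * x)
        ∂(taperedParetoLaw α ((n : ℝ) ^ γ))) atTop (𝓝 (stableExponent α w)) := by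
    intro e he he1 he2
    have he0 := zero_le_of_eq_zero_or_one he
    have hP := tendsto_integral_expRemainder_paretoMeasure he he1 he2 hvκ
    rw [stableExponent_mul hκ0, hκα, ← mul_assoc, ← hC, ← Complex.ofReal_mul,
      mul_inv_cancel₀ hC0.ne', Complex.ofReal_one, one_mul] at hP
    obtain ⟨K, hK0, hK⟩ := exists_norm_integral_expRemainder_sub_le he he1
    have hdiff : Tendsto (fun n : ℕ => (n : ℂ) * (∫ x : ℝ, expRemainder e (Complex.I * s n * x)
        ∂(taperedParetoLaw α ((n : ℝ) ^ γ)) - ∫ x : ℝ, expRemainder e (Complex.I * s n * x)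
        ∂(paretoMeasure 1 α))) atTop (𝓝 0) := by
      refine squeeze_zero_norm' (a := fun n : ℕ => K * |κ * v n| ^ e *
        (n : ℝ) ^ (1 + -e / α + γ * (e - α))) ?_ ?_
      · filter_upwards [eventually_gt_atTop 0] with n hn
        have hn0 : (0 : ℝ) < n := by exact_mod_cast hn
        rw [norm_mul, Complex.norm_natCast]
        calc _ ≤ (n : ℝ) * (K * |s n| ^ e * ((n : ℝ) ^ γ) ^ (e - α)) := by
              gcongr
              exact hK _ _ (hb n hn)
          _ = _ := by
              rw [hsn, ← Real.rpow_mul hn0.le, Real.rpow_add hn0, Real.rpow_add hn0, Real.rpow_one]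
              ring
      · have h3 : Tendsto (fun n => K * |κ * v n| ^ e) atTop (𝓝 (K * |κ * w| ^ e)) :=
          (hvκ.abs.rpow_const (Or.inr he0)).const_mul K
        -- The exponent equals `(1/α - γ) (α - e)`. This is where `γ > 1/α` makes the tapering
        -- negligible.
        have h4 : 1 + -e / α + γ * (e - α) < 0 := by
          have : 1 + -e / α = (1 / α) * (α - e) := by field_simp; ring
          rw [this]
          nlinarith
        simpa using h3.mul (hpow _ h4)
    have := hdiff.add hP
    rw [zero_add] at this
    refine this.congr fun n => ?_
    have : s n = κ * v n * (n : ℝ) ^ (-1 / α) := by rw [hs]; ring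
    rw [this]
    ring
  rcases lt_or_gt_of_ne h1 with h | h
  · refine (hD 0 (Or.inl rfl) h0 (by linarith)).congr fun n => ?_
    rw [charFun_innovationLaw_of_lt_one h0 h]
  · have h : 1 < α := h
    have hD1 := hD 1 (Or.inr rfl) h (by linarith)
    obtain ⟨-, M, hM0, hM⟩ := integrable_id_taperedParetoLaw h
    set m : ℕ → ℝ := fun n => ∫ x, x ∂(taperedParetoLaw α ((n : ℝ) ^ γ)) with hm
    have hsm : ∀ p : ℝ, 0 < p → ∀ᶠ n : ℕ in atTop,
        |s n * m n| ^ p ≤ M ^ p * |κ * v n| ^ p * (n : ℝ) ^ (-p / α) := by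
      intro p hp
      filter_upwards [eventually_gt_atTop 0] with n hn
      rw [abs_mul, Real.mul_rpow (abs_nonneg _) (abs_nonneg _), mul_comm, hsn, mul_assoc]
      gcongr
      exact hM _ (hb n hn)
    have hlim : ∀ p q : ℝ, 0 < p → q < 0 →
        Tendsto (fun n : ℕ => M ^ p * |κ * v n| ^ p * (n : ℝ) ^ q) atTop (𝓝 0) := by
      intro p q hp hq
      simpa using ((hvκ.abs.rpow_const (p := p) (Or.inr hp.le)).const_mul (M ^ p)).mul (hpow q hq)
    have hsm0 : Tendsto (fun n => s n * m n) atTop (𝓝 0) := by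
      refine squeeze_zero_norm' (a := fun n : ℕ => M ^ (1 : ℝ) * |κ * v n| ^ (1 : ℝ) *
        (n : ℝ) ^ (-1 / α)) ?_ (hlim 1 _ one_pos (div_neg_of_neg_of_pos (by norm_num) h0))
      filter_upwards [hsm 1 one_pos] with n hn
      rwa [Real.rpow_one] at hn
    have hE : Tendsto (fun n => Complex.exp (-(Complex.I * (s n * m n : ℝ)))) atTop (𝓝 1) := by
      have : Continuous fun y : ℝ => Complex.exp (-(Complex.I * y)) := by fun_prop
      have h3 := (this.tendsto 0).comp hsm0
      simp only [Complex.ofReal_zero, mul_zero, neg_zero, Complex.exp_zero] at h3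
      exact h3
    -- The mean is bounded and `s n` is of order `n ^ (-1/α)`, so the centering error is `O(n ^ (1 -
    -- 2/α))`, which vanishes because `α < 2`.
    have hA : Tendsto (fun n : ℕ => (n : ℂ) * (expRemainder 1 (-(Complex.I * (s n * m n : ℝ))) +
        expRemainder 0 (-(Complex.I * (s n * m n : ℝ))) * (Complex.I * (s n * m n : ℝ)))) atTop
        (𝓝 0) := by
      refine squeeze_zero_norm' (a := fun n : ℕ => 6 * (M ^ (2 : ℝ) * |κ * v n| ^ (2 : ℝ) *
        (n : ℝ) ^ (1 + -2 / α))) ?_ ?_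
      · filter_upwards [hsm 2 two_pos, eventually_gt_atTop 0] with n hn hn0
        have hn0 : (0 : ℝ) < n := by exact_mod_cast hn0
        rw [norm_mul, Complex.norm_natCast]
        calc _ ≤ (n : ℝ) * (6 * |s n * m n| ^ (2 : ℝ)) := by
              gcongr
              exact norm_centering_le one_le_two le_rfl _
          _ ≤ (n : ℝ) * (6 * (M ^ (2 : ℝ) * |κ * v n| ^ (2 : ℝ) * (n : ℝ) ^ (-2 / α))) := by gcongr
          _ = _ := by rw [Real.rpow_add hn0, Real.rpow_one]; ring
      · have : 1 + -2 / α < 0 := by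
          have : 2 / α > 1 := by rw [gt_iff_lt, lt_div_iff₀ h0]; linarith
          rw [neg_div]; linarith
        simpa using (hlim 2 _ two_pos this).const_mul 6
    have := hA.add (hE.mul hD1)
    rw [zero_add, one_mul] at this
    refine this.congr fun n => ?_
    rw [charFun_innovationLaw_of_one_lt h]
    ring

end Innovation

/-! ### Finite additivity of stable random measures -/

section RandomMeasure

variable {Ω : Type*} [MeasurableSpace Ω] {P : Measure Ω} [IsProbabilityMeasure P] {α : ℝ}
  {M : Set ℝ → Ω → ℝ}

omit [IsProbabilityMeasure P] in
lemma IsStableRandomMeasure.charFun_eq (hM : IsStableRandomMeasure P α 1 M) (hα : 0 < α)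
    {A : Set ℝ} (hA : MeasurableSet A) (hf : volume A < ⊤) (s : ℝ) :
    charFun (P.map (M A)) s = Complex.exp (volume.real A * stableExponent α s) := by
  rw [isStableLaw_one_iff.1 (hM.law A hA hf), ← Real.rpow_mul ENNReal.toReal_nonneg,
    one_div_mul_cancel hα.ne', Real.rpow_one]
  rfl

lemma IsStableRandomMeasure.empty (hM : IsStableRandomMeasure P α 1 M) (hα : 0 < α) :
    ∀ᵐ ω ∂P, M ∅ ω = 0 := by
  have hm := hM.measurable ∅ MeasurableSet.empty (by simp)
  have := Measure.isProbabilityMeasure_map (μ := P) hm.aemeasurable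
  have h : P.map (M ∅) = Measure.dirac 0 := by
    refine Measure.ext_of_charFun (funext fun s => ?_)
    rw [hM.charFun_eq hα MeasurableSet.empty (by simp), charFun_dirac]
    simp
  have h2 : ∀ᵐ x ∂(P.map (M ∅)), x = 0 := by
    rw [h, ae_dirac_eq]
    exact Filter.eventually_pure.2 rfl
  exact (ae_map_iff hm.aemeasurable (measurableSet_singleton (0 : ℝ))).1 h2

/-- Apply σ-additivity to the sequence `A, B, ∅, ∅, …`: the partial sums are eventually constant
because `M ∅` vanishes almost surely. -/
lemma IsStableRandomMeasure.union (hM : IsStableRandomMeasure P α 1 M) (hα : 0 < α)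
    {A B : Set ℝ} (hA : MeasurableSet A) (hB : MeasurableSet B) (hfA : volume A < ⊤)
    (hfB : volume B < ⊤) (hd : Disjoint A B) :
    ∀ᵐ ω ∂P, M (A ∪ B) ω = M A ω + M B ω := by
  set S : ℕ → Set ℝ := fun i => if i = 0 then A else if i = 1 then B else ∅ with hS
  have hU : ⋃ i, S i = A ∪ B := by
    ext x
    simp only [Set.mem_iUnion, Set.mem_union]
    constructor
    · rintro ⟨i, hi⟩
      simp only [hS] at hi
      split_ifs at hi
      · exact Or.inl hi
      · exact Or.inr hi
      · exact hi.elim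
    · rintro (h | h)
      · exact ⟨0, by simpa [hS] using h⟩
      · exact ⟨1, by simpa [hS] using h⟩
  have hmeas : ∀ i, MeasurableSet (S i) := by
    intro i
    simp only [hS]
    split_ifs <;> simp [hA, hB]
  have hdis : Pairwise fun i j => Disjoint (S i) (S j) := by
    intro i j hij
    simp only [hS]
    split_ifs with h1 h2 h3 h4 h5 h6 <;> first
      | exact absurd (h1.trans h2.symm) hij
      | exact hd
      | exact hd.symm
      | exact absurd (h4.trans h6.symm) hij
      | simp
  have h := hM.sigma_additive S hmeas (by rw [hU]; exact measure_union_lt_top hfA hfB) hdis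
  filter_upwards [h, hM.empty hα] with ω h1 h0
  rw [hU] at h1
  refine tendsto_nhds_unique h1 (tendsto_const_nhds.congr' ?_)
  filter_upwards [eventually_ge_atTop 2] with N hN
  obtain ⟨k, rfl⟩ := Nat.exists_eq_add_of_le' hN
  rw [Finset.sum_range_succ', Finset.sum_range_succ', Finset.sum_eq_zero]
  · simp [hS, add_comm]
  · intro i _
    simpa [hS] using h0

lemma IsStableRandomMeasure.biUnion_finset (hM : IsStableRandomMeasure P α 1 M) (hα : 0 < α)
    {ι : Type*} {B : ι → Set ℝ} (hB : ∀ i, MeasurableSet (B i))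
    (hd : Pairwise fun i j => Disjoint (B i) (B j)) (T : Finset ι)
    (hf : ∀ i ∈ T, volume (B i) < ⊤) :
    ∀ᵐ ω ∂P, M (⋃ i ∈ T, B i) ω = ∑ i ∈ T, M (B i) ω := by
  classical
  induction T using Finset.induction_on with
  | empty => simpa using hM.empty hα
  | insert i T hi ih =>
    have hfT : volume (⋃ j ∈ T, B j) < ⊤ :=
      (measure_biUnion_lt_top T.finite_toSet fun j hj => hf j (Finset.mem_insert_of_mem hj))
    have := hM.union hα (hB i) (T.measurableSet_biUnion fun j _ => hB j)
      (hf i (Finset.mem_insert_self i T)) hfT (by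
        rw [Set.disjoint_iUnion₂_right]
        intro j hj
        exact hd (by rintro rfl; exact hi hj))
    filter_upwards [this, ih fun j hj => hf j (Finset.mem_insert_of_mem hj)] with ω h1 h2
    rw [Finset.sum_insert hi, ← h2, ← h1, Finset.set_biUnion_insert]

/-- Finite additivity lets an integral be computed on the finer partition into level sets of `p`, so
that several simple functions can share one partition. The fiber over zero may have infinite
measure, and `φ 0 = 0` keeps it out. -/
lemma IsStableRandomMeasure.simpleIntegral_map (hM : IsStableRandomMeasure P α 1 M) (hα : 0 < α)
    {E : Type*} [Zero E] (p : SimpleFunc ℝ E) (hp : p.FinMeasSupp volume) (φ : E → ℝ)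
    (hφ : φ 0 = 0) :
    ∀ᵐ ω ∂P, simpleIntegral M (p.map φ) ω = ∑ v ∈ p.range, φ v * M (p ⁻¹' {v}) ω := by
  classical
  have h1 : ∀ᵐ ω ∂P, ∀ y ∈ (p.map φ).range, y * M ((p.map φ) ⁻¹' {y}) ω =
      ∑ v ∈ p.range with φ v = y, φ v * M (p ⁻¹' {v}) ω := by
    rw [Filter.eventually_all_finset]
    intro y _
    rcases eq_or_ne y 0 with rfl | hy
    · refine ae_of_all _ fun ω => ?_
      rw [zero_mul, Finset.sum_eq_zero]
      intro v hv
      rw [(Finset.mem_filter.1 hv).2, zero_mul]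
    · have := hM.biUnion_finset hα (B := fun v => p ⁻¹' {v}) (fun v => p.measurableSet_fiber v)
        (fun v w hvw => Disjoint.preimage _ (by simpa using hvw)) {v ∈ p.range | φ v = y}
        (fun v hv => SimpleFunc.finMeasSupp_iff.1 hp v (by
          rintro rfl
          exact hy ((Finset.mem_filter.1 hv).2 ▸ hφ)))
      have hset : (p.map φ) ⁻¹' {y} = ⋃ v ∈ p.range.filter (fun v => φ v = y), p ⁻¹' {v} := by
        ext u
        simp
      filter_upwards [this] with ω hω
      rw [hset, hω, Finset.mul_sum]
      refine Finset.sum_congr rfl fun v hv => ?_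
      rw [(Finset.mem_filter.1 hv).2]
  filter_upwards [h1] with ω hω
  rw [simpleIntegral, Finset.sum_congr rfl hω]
  refine Finset.sum_fiberwise_of_maps_to (fun v hv => ?_) _
  rw [SimpleFunc.range_map]
  exact Finset.mem_image_of_mem φ hv

omit [IsProbabilityMeasure P] in
lemma IsStableRandomMeasure.charFun_sum (hM : IsStableRandomMeasure P α 1 M) (hα : 0 < α)
    {E : Type*} [Zero E] (p : SimpleFunc ℝ E) (hp : p.FinMeasSupp volume) (φ : E → ℝ)
    (hφ : φ 0 = 0) :
    charFun (P.map fun ω => ∑ v ∈ p.range, φ v * M (p ⁻¹' {v}) ω) 1 =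
      Complex.exp (∑ v ∈ p.range, volume.real (p ⁻¹' {v}) * stableExponent α (φ v)) := by
  classical
  have hψ : stableExponent α 0 = 0 := by simp [stableExponent, hα.ne']
  -- The value zero is discarded: nothing is known about `M` on a level set of infinite measure, and
  -- both sides have a zero term there.
  set T := p.range.filter (fun v => v ≠ 0) with hT
  have e := T.equivFin
  set B : Fin T.card → Set ℝ := fun i => p ⁻¹' {(e.symm i : E)} with hB
  have hBm : ∀ i, MeasurableSet (B i) := fun i => p.measurableSet_fiber _
  have hBf : ∀ i, volume (B i) < ⊤ := fun i =>
    SimpleFunc.finMeasSupp_iff.1 hp _ (Finset.mem_filter.1 (e.symm i).2).2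
  have hBd : Pairwise fun i j => Disjoint (B i) (B j) := by
    intro i j hij
    refine Disjoint.preimage _ ?_
    rw [Set.disjoint_singleton]
    intro h
    exact hij (e.symm.injective (Subtype.ext h))
  have hsum : ∀ {F : Type} [AddCommMonoid F] (f : E → F), f 0 = 0 →
      ∑ v ∈ p.range, f v = ∑ i : Fin T.card, f (e.symm i) := by
    intro F _ f hf
    rw [← Equiv.sum_comp e, ← Finset.sum_filter_of_ne (p := fun v => v ≠ 0)]
    · rw [← hT, ← Finset.sum_coe_sort]
      simp
    · rintro v _ hv rfl
      exact hv hf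
  have hind := (hM.indep T.card B hBm hBf hBd).comp (fun i x => φ (e.symm i) * x)
    (fun i => by fun_prop)
  have h1 : (fun ω => ∑ v ∈ p.range, φ v * M (p ⁻¹' {v}) ω) =
      fun ω => ∑ i : Fin T.card, ((fun x => φ (e.symm i) * x) ∘ M (B i)) ω := by
    funext ω
    exact hsum (fun v => φ v * M (p ⁻¹' {v}) ω) (by simp [hφ])
  rw [h1, hind.charFun_map_fun_sum_eq_prod (fun i => (Measurable.comp (by fun_prop)
    (hM.measurable (B i) (hBm i) (hBf i))).aemeasurable), Finset.prod_apply,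
    hsum (fun v => (volume.real (p ⁻¹' {v}) * stableExponent α (φ v) : ℂ)) (by simp [hφ, hψ]),
    Complex.exp_sum]
  refine Finset.prod_congr rfl fun i _ => ?_
  rw [← Measure.map_map (by fun_prop) (hM.measurable (B i) (hBm i) (hBf i)), charFun_map_mul,
    mul_one, hM.charFun_eq hα (hBm i) (hBf i)]

/-- The simple function with values in a finite product given by simple functions. -/
def simplePi {m : ℕ} (s : Fin m → SimpleFunc ℝ ℝ) : SimpleFunc ℝ (Fin m → ℝ) where
  toFun u l := s l u
  measurableSet_fiber' v := measurableSet_preimage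
    (measurable_pi_lambda _ fun l => (s l).measurable) (measurableSet_singleton v)
  finite_range' := by
    refine (Set.Finite.pi' fun l => (s l).finite_range).subset ?_
    rintro _ ⟨u, rfl⟩ l
    exact ⟨u, rfl⟩

lemma finMeasSupp_simplePi {m : ℕ} {s : Fin m → SimpleFunc ℝ ℝ}
    (hs : ∀ l, (s l).FinMeasSupp volume) : (simplePi s).FinMeasSupp volume := by
  rw [SimpleFunc.finMeasSupp_iff]
  intro v hv
  obtain ⟨l, hl⟩ := Function.ne_iff.1 hv
  refine lt_of_le_of_lt (measure_mono ?_) (SimpleFunc.finMeasSupp_iff.1 (hs l) (v l) hl)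
  rintro u rfl
  rfl

omit [IsProbabilityMeasure P] in
lemma measurable_simpleIntegral (hM : IsStableRandomMeasure P α 1 M) {f : SimpleFunc ℝ ℝ}
    (hf : f.FinMeasSupp volume) : Measurable (simpleIntegral M f) := by
  refine Finset.measurable_fun_sum _ fun y _ => ?_
  rcases eq_or_ne y 0 with rfl | hy
  · simp
  · exact (hM.measurable _ (f.measurableSet_fiber y)
      (SimpleFunc.finMeasSupp_iff.1 hf y hy)).const_mul y

/-- The joint characteristic function of integrals of simple functions. -/
lemma IsStableRandomMeasure.charFun_simpleIntegral (hM : IsStableRandomMeasure P α 1 M)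
    (hα : 0 < α) {m : ℕ} {s : Fin m → SimpleFunc ℝ ℝ} (hs : ∀ l, (s l).FinMeasSupp volume)
    (θ : Fin m → ℝ) :
    charFun (P.map fun ω => ∑ l, θ l * simpleIntegral M (s l) ω) 1 =
      Complex.exp (∫ u, stableExponent α (∑ l, θ l * s l u)) := by
  have hψ : stableExponent α 0 = 0 := by simp [stableExponent, hα.ne']
  have hp := finMeasSupp_simplePi hs
  have h1 : (fun ω => ∑ l, θ l * simpleIntegral M (s l) ω) =ᵐ[P]
      fun ω => ∑ v ∈ (simplePi s).range, (∑ l, θ l * v l) * M ((simplePi s) ⁻¹' {v}) ω := by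
    have : ∀ᵐ ω ∂P, ∀ l, simpleIntegral M ((simplePi s).map fun v => v l) ω =
        ∑ v ∈ (simplePi s).range, v l * M ((simplePi s) ⁻¹' {v}) ω :=
      ae_all_iff.2 fun l => hM.simpleIntegral_map hα _ hp (fun v => v l) rfl
    filter_upwards [this] with ω hω
    have h2 : ∀ l, (simplePi s).map (fun v => v l) = s l := fun l => by ext u; rfl
    simp_rw [h2] at hω
    simp_rw [hω, Finset.mul_sum, Finset.sum_mul]
    rw [Finset.sum_comm]
    simp_rw [mul_assoc]
  rw [Measure.map_congr h1, hM.charFun_sum hα _ hp (fun v => ∑ l, θ l * v l) (by simp)]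
  congr 1
  have hi : Integrable (simplePi s) volume := SimpleFunc.integrable_iff_finMeasSupp.2 hp
  have h3 := SimpleFunc.map_integral (simplePi s) (fun v => stableExponent α (∑ l, θ l * v l)) hi
    (by simp [hψ])
  rw [SimpleFunc.integral_eq_integral] at h3
  · rw [show (∫ u, stableExponent α (∑ l, θ l * s l u)) =
      ∫ u, (simplePi s).map (fun v => stableExponent α (∑ l, θ l * v l)) u from rfl, h3]
    simp
  · exact SimpleFunc.integrable_iff_finMeasSupp.2 (hp.map (by simp [hψ]))

end RandomMeasure

/-! ### Continuity of stable exponents along `L^α` -/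

section Lp

variable {α : ℝ}

/-- Bounding every term by the largest one avoids convexity, so that `α < 1` and `α > 1` are treated
alike. -/
lemma abs_sum_rpow_le (hα : 0 < α) {ι : Type*} (s : Finset ι) (x : ι → ℝ) :
    |∑ i ∈ s, x i| ^ α ≤ (s.card : ℝ) ^ α * ∑ i ∈ s, |x i| ^ α := by
  rcases s.eq_empty_or_nonempty with rfl | hs
  · simp [hα.ne']
  obtain ⟨j, hj, hmax⟩ := s.exists_max_image (fun i => |x i|) hs
  have h1 : |∑ i ∈ s, x i| ≤ s.card * |x j| := by
    refine (Finset.abs_sum_le_sum_abs _ _).trans ?_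
    rw [← nsmul_eq_mul]
    exact Finset.sum_le_card_nsmul _ _ _ hmax
  calc _ ≤ (s.card * |x j|) ^ α := Real.rpow_le_rpow (abs_nonneg _) h1 hα.le
    _ = (s.card : ℝ) ^ α * |x j| ^ α := Real.mul_rpow (by positivity) (abs_nonneg _)
    _ ≤ _ := by
        gcongr
        exact Finset.single_le_sum (f := fun i => |x i| ^ α) (fun i _ => by positivity) hj

lemma abs_add_rpow_le (hα : 0 < α) (x y : ℝ) :
    |x + y| ^ α ≤ 2 ^ α * (|x| ^ α + |y| ^ α) := by
  simpa using abs_sum_rpow_le hα Finset.univ ![x, y]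

/-- If `|x - y| < δ |y|`, homogeneity reduces the estimate to continuity at `±1`, giving `ε |y| ^
α`. Otherwise both `|x|` and `|y|` are at most a multiple of `|x - y|`, and the growth bound
suffices. -/
lemma exists_norm_stableExponent_sub_le (hα : 0 < α) {ε : ℝ} (hε : 0 < ε) :
    ∃ C, 0 ≤ C ∧ ∀ x y, ‖stableExponent α x - stableExponent α y‖ ≤
      ε * |y| ^ α + C * |x - y| ^ α := by
  obtain ⟨K, hK0, hK⟩ := exists_norm_stableExponent_le α
  have hc : ∀ σ : ℝ, ∃ δ > 0, ∀ x, |x - σ| < δ →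
      ‖stableExponent α x - stableExponent α σ‖ < ε := by
    intro σ
    have := Metric.continuous_iff.1 (continuous_stableExponent hα) σ ε hε
    simpa [dist_eq_norm] using this
  obtain ⟨δ₁, h1, hδ₁⟩ := hc 1
  obtain ⟨δ₂, h2, hδ₂⟩ := hc (-1)
  set δ := min δ₁ δ₂ with hδ
  have hδ0 : 0 < δ := lt_min h1 h2
  refine ⟨2 * K * (1 + 1 / δ) ^ α, by positivity, fun x y => ?_⟩
  rcases lt_or_ge |x - y| (δ * |y|) with h | h
  · have hy0 : 0 < |y| := by
      by_contra h0
      have : |y| = 0 := le_antisymm (not_lt.1 h0) (abs_nonneg y)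
      rw [this, mul_zero] at h
      exact absurd h (not_lt.2 (abs_nonneg _))
    have hx : stableExponent α x = (|y| ^ α : ℝ) * stableExponent α (x / |y|) := by
      rw [← stableExponent_mul hy0, mul_div_cancel₀ _ hy0.ne']
    have hy : stableExponent α y = (|y| ^ α : ℝ) * stableExponent α (y / |y|) := by
      rw [← stableExponent_mul hy0, mul_div_cancel₀ _ hy0.ne']
    have hd : abs (x / |y| - y / |y|) < δ := by
      rw [← sub_div, abs_div, abs_abs, div_lt_iff₀ hy0]
      exact h
    have : ‖stableExponent α (x / |y|) - stableExponent α (y / |y|)‖ < ε := by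
      rcases lt_or_gt_of_ne (abs_pos.1 hy0) with hs | hs
      · have hs1 : y / |y| = -1 := by rw [abs_of_neg hs, div_neg, div_self hs.ne]
        rw [hs1] at hd ⊢
        exact hδ₂ _ (hd.trans_le (min_le_right _ _))
      · have hs1 : y / |y| = 1 := by rw [abs_of_pos hs, div_self hs.ne']
        rw [hs1] at hd ⊢
        exact hδ₁ _ (hd.trans_le (min_le_left _ _))
    rw [hx, hy, ← mul_sub, norm_mul, Complex.norm_real, Real.norm_of_nonneg (by positivity),
      mul_comm]
    have h3 : ‖stableExponent α (x / |y|) - stableExponent α (y / |y|)‖ * |y| ^ α ≤ ε * |y| ^ α := by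
      gcongr
    refine h3.trans (le_add_of_nonneg_right (by positivity))
  · have hy : |y| ≤ (1 + 1 / δ) * |x - y| := by
      have : |y| ≤ 1 / δ * |x - y| := by
        rw [one_div, ← div_eq_inv_mul, le_div_iff₀ hδ0, mul_comm]
        exact h
      linarith [abs_nonneg (x - y)]
    have hx : |x| ≤ (1 + 1 / δ) * |x - y| := by
      have h4 : |y| ≤ 1 / δ * |x - y| := by
        rw [one_div, ← div_eq_inv_mul, le_div_iff₀ hδ0, mul_comm]
        exact h
      have : |x| ≤ |x - y| + |y| := by
        have := abs_add_le (x - y) y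
        simpa using this
      linarith
    have hxα := Real.rpow_le_rpow (abs_nonneg x) hx hα.le
    have hyα := Real.rpow_le_rpow (abs_nonneg y) hy hα.le
    rw [Real.mul_rpow (by positivity) (abs_nonneg _)] at hxα hyα
    have h3 : 0 ≤ ε * |y| ^ α := by positivity
    calc _ ≤ ‖stableExponent α x‖ + ‖stableExponent α y‖ := norm_sub_le _ _
      _ ≤ K * |x| ^ α + K * |y| ^ α := add_le_add (hK x) (hK y)
      _ ≤ K * ((1 + 1 / δ) ^ α * |x - y| ^ α) + K * ((1 + 1 / δ) ^ α * |x - y| ^ α) := by gcongr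
      _ = 2 * K * (1 + 1 / δ) ^ α * |x - y| ^ α := by ring
      _ ≤ _ := le_add_of_nonneg_left h3

lemma integrable_abs_rpow (hα : 0 < α) {f : ℝ → ℝ} (hf : MemLp f (ENNReal.ofReal α) volume) :
    Integrable (fun u => |f u| ^ α) := by
  have := hf.integrable_norm_rpow (by simpa using hα) ENNReal.ofReal_ne_top
  simpa [ENNReal.toReal_ofReal hα.le] using this

lemma eLpNorm_eq_ofReal (hα : 0 < α) {f : ℝ → ℝ} (hf : MemLp f (ENNReal.ofReal α) volume) :
    eLpNorm f (ENNReal.ofReal α) volume = ENNReal.ofReal ((∫ u, |f u| ^ α) ^ α⁻¹) := by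
  have := hf.eLpNorm_eq_integral_rpow_norm (by simpa using hα) ENNReal.ofReal_ne_top
  simpa [ENNReal.toReal_ofReal hα.le] using this

lemma tendsto_eLpNorm_zero_iff (hα : 0 < α) {f : ℕ → ℝ → ℝ}
    (hf : ∀ n, MemLp (f n) (ENNReal.ofReal α) volume) :
    Tendsto (fun n => eLpNorm (f n) (ENNReal.ofReal α) volume) atTop (𝓝 0) ↔
      Tendsto (fun n => ∫ u, |f n u| ^ α) atTop (𝓝 0) := by
  have h0 : ∀ n, 0 ≤ ∫ u, |f n u| ^ α := fun n => integral_nonneg fun u => by positivity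
  simp_rw [fun n => eLpNorm_eq_ofReal hα (hf n)]
  constructor
  · intro h
    have h1 := (ENNReal.tendsto_toReal ENNReal.zero_ne_top).comp h
    have h2 : Tendsto (fun n => (∫ u, |f n u| ^ α) ^ α⁻¹) atTop (𝓝 0) := by
      refine h1.congr fun n => ?_
      simp only [Function.comp]
      rw [ENNReal.toReal_ofReal (Real.rpow_nonneg (h0 n) _)]
    have h3 := h2.rpow_const (p := α) (Or.inr hα.le)
    rw [Real.zero_rpow hα.ne'] at h3
    refine h3.congr fun n => ?_
    rw [← Real.rpow_mul (h0 n), inv_mul_cancel₀ hα.ne', Real.rpow_one]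
  · intro h
    have h3 := h.rpow_const (p := α⁻¹) (Or.inr (by positivity))
    rw [Real.zero_rpow (by positivity)] at h3
    simpa using ENNReal.tendsto_ofReal h3

lemma integrable_stableExponent (hα : 0 < α) {f : ℝ → ℝ}
    (hf : MemLp f (ENNReal.ofReal α) volume) : Integrable fun u => stableExponent α (f u) := by
  obtain ⟨K, -, hK⟩ := exists_norm_stableExponent_le α
  exact ((integrable_abs_rpow hα hf).const_mul K).mono'
    ((continuous_stableExponent hα).comp_aestronglyMeasurable hf.1) (ae_of_all _ fun u => hK _)

lemma norm_integral_stableExponent_le : ∃ K, 0 ≤ K ∧ ∀ f : ℝ → ℝ,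
    Integrable (fun u => |f u| ^ α) →
    ‖∫ u, stableExponent α (f u)‖ ≤ K * ∫ u, |f u| ^ α := by
  obtain ⟨K, hK0, hK⟩ := exists_norm_stableExponent_le α
  refine ⟨K, hK0, fun f hf => ?_⟩
  rw [← integral_const_mul]
  exact norm_integral_le_of_norm_le (hf.const_mul K) (ae_of_all _ fun u => hK _)

/-- The term with `ε` in the modulus of continuity is paid for by the finite integral of `|g| ^ α`,
the other one by the assumed convergence. -/
lemma tendsto_integral_stableExponent (hα : 0 < α) {f : ℕ → ℝ → ℝ} {g : ℝ → ℝ}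
    (hf : ∀ n, MemLp (f n) (ENNReal.ofReal α) volume) (hg : MemLp g (ENNReal.ofReal α) volume)
    (h : Tendsto (fun n => ∫ u, |f n u - g u| ^ α) atTop (𝓝 0)) :
    Tendsto (fun n => ∫ u, stableExponent α (f n u)) atTop
      (𝓝 (∫ u, stableExponent α (g u))) := by
  rw [tendsto_iff_norm_sub_tendsto_zero, Metric.tendsto_atTop]
  intro ε hε
  set G := ∫ u, |g u| ^ α with hG
  have hG0 : 0 ≤ G := integral_nonneg fun u => by positivity
  obtain ⟨C, hC0, hC⟩ := exists_norm_stableExponent_sub_le hα (ε := ε / (2 * (G + 1)))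
    (by positivity)
  have h2 := h.const_mul C
  rw [mul_zero] at h2
  obtain ⟨N, hN⟩ := Metric.tendsto_atTop.1 h2 (ε / 2) (by positivity)
  refine ⟨N, fun n hn => ?_⟩
  have h3 := hN n hn
  rw [Real.dist_eq, sub_zero] at h3
  rw [Real.dist_eq, sub_zero, abs_norm,
    ← integral_sub (integrable_stableExponent hα (hf n)) (integrable_stableExponent hα hg)]
  have hi1 := (integrable_abs_rpow hα hg).const_mul (ε / (2 * (G + 1)))
  have hi2 := (integrable_abs_rpow hα ((hf n).sub hg)).const_mul C
  have := norm_integral_le_of_norm_le (hi1.add hi2) (ae_of_all _ fun u => hC (f n u) (g u))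
  simp only [Pi.add_apply] at this
  rw [integral_add hi1 hi2, integral_const_mul, integral_const_mul] at this
  simp only [Pi.sub_apply] at this
  have h5 : ε / (2 * (G + 1)) * G ≤ ε / 2 := by
    rw [div_mul_eq_mul_div, div_le_div_iff₀ (by positivity) two_pos]
    nlinarith
  have := le_abs_self (C * ∫ u, |f n u - g u| ^ α)
  linarith

end Lp

/-! ### Existence and joint characteristic functions of stable integrals -/

section StableIntegral

variable {Ω : Type*} [MeasurableSpace Ω] {P : Measure Ω} [IsProbabilityMeasure P] {α : ℝ}
  {M : Set ℝ → Ω → ℝ}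

lemma memLp_simpleFunc {f : SimpleFunc ℝ ℝ} (hf : f.FinMeasSupp volume) (p : ENNReal) :
    MemLp f p volume :=
  SimpleFunc.memLp_of_finite_measure_preimage p fun y hy => SimpleFunc.finMeasSupp_iff.1 hf y hy

omit [IsProbabilityMeasure P] in
lemma exists_strictMono_forall_tendsto {m : ℕ} {Z : Fin m → ℕ → Ω → ℝ} {Y : Fin m → Ω → ℝ}
    (h : ∀ l, TendstoInMeasure P (Z l) atTop (Y l)) :
    ∃ ns : ℕ → ℕ, StrictMono ns ∧ ∀ l, ∀ᵐ ω ∂P, Tendsto (fun n => Z l (ns n) ω) atTop (𝓝 (Y l ω)) := by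
  suffices ∀ T : Finset (Fin m), ∃ ns : ℕ → ℕ, StrictMono ns ∧
      ∀ l ∈ T, ∀ᵐ ω ∂P, Tendsto (fun n => Z l (ns n) ω) atTop (𝓝 (Y l ω)) by
    obtain ⟨ns, h1, h2⟩ := this Finset.univ
    exact ⟨ns, h1, fun l => h2 l (Finset.mem_univ l)⟩
  intro T
  induction T using Finset.induction_on with
  | empty => exact ⟨id, strictMono_id, by simp⟩
  | insert l T hl ih =>
    obtain ⟨ns, h1, h2⟩ := ih
    obtain ⟨ns', h3, h4⟩ := ((h l).comp h1.tendsto_atTop).exists_seq_tendsto_ae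
    refine ⟨ns ∘ ns', h1.comp h3, fun j hj => ?_⟩
    rcases Finset.mem_insert.1 hj with rfl | hj
    · exact h4
    · filter_upwards [h2 j hj] with ω hω
      exact hω.comp h3.tendsto_atTop

lemma tendsto_charFun_map_of_ae {Z : ℕ → Ω → ℝ} {Y : Ω → ℝ} (hZ : ∀ n, AEMeasurable (Z n) P)
    (hY : AEMeasurable Y P) (h : ∀ᵐ ω ∂P, Tendsto (fun n => Z n ω) atTop (𝓝 (Y ω))) (s : ℝ) :
    Tendsto (fun n => charFun (P.map (Z n)) s) atTop (𝓝 (charFun (P.map Y) s)) := by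
  simp_rw [charFun_apply_real]
  have hm : ∀ ν : Measure ℝ, AEStronglyMeasurable (fun x : ℝ => Complex.exp (s * x * Complex.I)) ν :=
    fun ν => Measurable.aestronglyMeasurable (by fun_prop)
  rw [integral_map hY (hm _)]
  simp_rw [fun n => integral_map (hZ n) (hm _)]
  refine tendsto_integral_of_dominated_convergence (fun _ => 1) ?_ (integrable_const _) ?_ ?_
  · intro n
    exact (hm (P.map (Z n))).comp_aemeasurable (hZ n)
  · refine fun n => ae_of_all _ fun ω => ?_
    rw [Complex.norm_exp]
    simp
  · filter_upwards [h] with ω hω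
    have : Continuous fun x : ℝ => Complex.exp (s * x * Complex.I) := by fun_prop
    exact (this.tendsto _).comp hω

/-- The joint characteristic function of stable integrals. -/
lemma charFun_isStableIntegral (hM : IsStableRandomMeasure P α 1 M) (hα : 0 < α) {m : ℕ}
    {f : Fin m → ℝ → ℝ} {Y : Fin m → Ω → ℝ} (hY : ∀ l, IsStableIntegral P α M (f l) (Y l))
    (θ : Fin m → ℝ) :
    charFun (P.map fun ω => ∑ l, θ l * Y l ω) 1 =
      Complex.exp (∫ u, stableExponent α (∑ l, θ l * f l u)) := by
  choose hf hYm s hs hlim hconv using hY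
  -- Along one common subsequence all approximating integrals converge almost surely, so bounded
  -- convergence identifies the joint characteristic function.
  obtain ⟨ns, hns, hae⟩ := exists_strictMono_forall_tendsto hconv
  have h1 : Tendsto (fun n => charFun (P.map fun ω => ∑ l, θ l * simpleIntegral M (s l (ns n)) ω) 1)
      atTop (𝓝 (charFun (P.map fun ω => ∑ l, θ l * Y l ω) 1)) := by
    refine tendsto_charFun_map_of_ae (fun n => ?_) ?_ ?_ 1
    · exact (Finset.measurable_fun_sum _ fun l _ =>
        (measurable_simpleIntegral hM (hs l (ns n))).const_mul _).aemeasurable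
    · exact (Finset.measurable_fun_sum _ fun l _ => (hYm l).const_mul _).aemeasurable
    · filter_upwards [ae_all_iff.2 hae] with ω hω
      exact tendsto_finsetSum _ fun l _ => (hω l).const_mul _
  refine tendsto_nhds_unique h1 ?_
  simp_rw [fun n => hM.charFun_simpleIntegral hα (fun l => hs l (ns n)) θ]
  refine (Complex.continuous_exp.tendsto _).comp ?_
  have hml : ∀ l n, MemLp (fun u => s l n u) (ENNReal.ofReal α) volume :=
    fun l n => memLp_simpleFunc (hs l n) _
  refine tendsto_integral_stableExponent hα
    (fun n => memLp_finsetSum _ fun l _ => (hml l (ns n)).const_mul (θ l))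
    (memLp_finsetSum _ fun l _ => (hf l).const_mul (θ l)) ?_
  have h2 : ∀ l, Tendsto (fun n => ∫ u, |s l (ns n) u - f l u| ^ α) atTop (𝓝 0) := fun l =>
    ((tendsto_eLpNorm_zero_iff hα fun n => (hml l n).sub (hf l)).1 (hlim l)).comp
      hns.tendsto_atTop
  have h3 : Tendsto (fun n => (m : ℝ) ^ α * ∑ l, |θ l| ^ α * ∫ u, |s l (ns n) u - f l u| ^ α) atTop
      (𝓝 0) := by
    simpa using (tendsto_finsetSum Finset.univ fun l _ => (h2 l).const_mul (|θ l| ^ α)).const_mul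
      ((m : ℝ) ^ α)
  refine squeeze_zero (fun n => integral_nonneg fun u => by positivity) (fun n => ?_) h3
  have hi : ∀ l, Integrable fun u => |s l (ns n) u - f l u| ^ α := fun l =>
    integrable_abs_rpow hα ((hml l (ns n)).sub (hf l))
  simp_rw [← integral_const_mul]
  rw [← integral_finsetSum _ fun l _ => (hi l).const_mul _, ← integral_const_mul]
  refine integral_mono_of_nonneg (ae_of_all _ fun u => by positivity)
    ((integrable_finsetSum _ fun l _ => (hi l).const_mul _).const_mul _) (ae_of_all _ fun u => ?_)
  simp only
  rw [← Finset.sum_sub_distrib]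
  refine (abs_sum_rpow_le hα _ _).trans (le_of_eq ?_)
  rw [Finset.card_univ, Fintype.card_fin]
  congr 1
  refine Finset.sum_congr rfl fun l _ => ?_
  rw [← mul_sub, abs_mul, Real.mul_rpow (abs_nonneg _) (abs_nonneg _)]

end StableIntegral

/-! ### Construction of stable integrals from simple functions. -/

section Existence

variable {Ω : Type*} [MeasurableSpace Ω] {P : Measure Ω} [IsProbabilityMeasure P] {α : ℝ}
  {M : Set ℝ → Ω → ℝ}

lemma norm_one_sub_le_of_eq_exp {ν : Measure ℝ} [IsProbabilityMeasure ν] {t : ℝ} {z : ℂ}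
    (h : charFun ν t = Complex.exp z) : ‖1 - charFun ν t‖ ≤ 2 * ‖z‖ := by
  rcases le_total ‖z‖ 1 with hz | hz
  · rw [h, norm_sub_rev]
    exact Complex.norm_exp_sub_one_le hz
  · refine (norm_sub_le _ _).trans ?_
    have := norm_charFun_le_one (μ := ν) t
    rw [norm_one]
    linarith

/-- The truncation inequality bounds the tail by an average of `1 - charFun` over `|t| ≤ 2/r`, where
it is `O(|t| ^ α)`. This weak-type estimate replaces an isometry, which is unavailable because
nondegenerate `α`-stable variables lack a moment of order `α`. -/
lemma exists_measureReal_abs_gt_le (hα : 0 < α) : ∃ K, 0 ≤ K ∧ ∀ (Z : Ω → ℝ) (g : ℝ → ℝ),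
    Measurable Z → Integrable (fun u => |g u| ^ α) →
    (∀ t, charFun (P.map Z) t = Complex.exp (∫ u, stableExponent α (t * g u))) →
    ∀ r, 0 < r → P.real {ω | r < |Z ω|} ≤ K * r⁻¹ ^ α * ∫ u, |g u| ^ α := by
  obtain ⟨K, hK0, hK⟩ := norm_integral_stableExponent_le (α := α)
  refine ⟨4 * K * 2 ^ α, by positivity, fun Z g hZ hg h r hr => ?_⟩
  have := Measure.isProbabilityMeasure_map (μ := P) hZ.aemeasurable
  have h1 := measureReal_abs_gt_le_integral_charFun (μ := P.map Z) hr
  rw [map_measureReal_apply hZ (measurableSet_lt measurable_const (by fun_prop))] at h1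
  refine h1.trans ?_
  set G := ∫ u, |g u| ^ α with hG
  have hG0 : 0 ≤ G := integral_nonneg fun u => by positivity
  have h2 : ∀ t ∈ Set.uIoc (-2 * r⁻¹) (2 * r⁻¹), ‖1 - charFun (P.map Z) t‖ ≤
      2 * (K * ((2 * r⁻¹) ^ α * G)) := by
    intro t ht
    have hr' : 0 < r⁻¹ := inv_pos.2 hr
    rw [Set.uIoc_of_le (by linarith)] at ht
    refine (norm_one_sub_le_of_eq_exp (h t)).trans ?_
    gcongr
    have habs : ∀ u, |t * g u| ^ α = |t| ^ α * |g u| ^ α := fun u => by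
      rw [abs_mul, Real.mul_rpow (abs_nonneg _) (abs_nonneg _)]
    refine (hK (fun u => t * g u) (by simp_rw [habs]; exact hg.const_mul _)).trans ?_
    simp_rw [habs]
    rw [integral_const_mul]
    gcongr
    rw [abs_le]
    constructor <;> linarith [ht.1, ht.2]
  have h3 := intervalIntegral.norm_integral_le_of_norm_le_const h2
  calc _ ≤ 2⁻¹ * r * (2 * (K * ((2 * r⁻¹) ^ α * G)) * |2 * r⁻¹ - -2 * r⁻¹|) := by gcongr
    _ = _ := by
      rw [show 2 * r⁻¹ - -2 * r⁻¹ = 4 * r⁻¹ by ring, abs_of_pos (by positivity),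
        Real.mul_rpow two_pos.le (by positivity)]
      field_simp

lemma charFun_simpleIntegral_sub (hM : IsStableRandomMeasure P α 1 M) (hα : 0 < α)
    {f g : SimpleFunc ℝ ℝ} (hf : f.FinMeasSupp volume) (hg : g.FinMeasSupp volume) (t : ℝ) :
    charFun (P.map fun ω => simpleIntegral M f ω - simpleIntegral M g ω) t =
      Complex.exp (∫ u, stableExponent α (t * (f u - g u))) := by
  have h := hM.charFun_simpleIntegral hα (s := ![f, g])
    (fun l => by fin_cases l <;> assumption) ![t, -t]
  simp only [Fin.sum_univ_two, Matrix.cons_val_zero, Matrix.cons_val_one] at h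
  have hm : Measurable fun ω => simpleIntegral M f ω - simpleIntegral M g ω :=
    (measurable_simpleIntegral hM hf).sub (measurable_simpleIntegral hM hg)
  have h2 : (fun ω => t * simpleIntegral M f ω + -t * simpleIntegral M g ω) =
      (fun x => t * x) ∘ fun ω => simpleIntegral M f ω - simpleIntegral M g ω := by
    funext ω
    simp only [Function.comp]
    ring
  have h3 : ∀ u, t * f u + -t * g u = t * (f u - g u) := fun u => by ring
  simp_rw [h3] at h
  rw [h2, ← Measure.map_map (by fun_prop) hm, charFun_map_mul, mul_one] at h
  exact h

/-- Every function in `L^α` has a stable integral. -/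
lemma exists_isStableIntegral (hM : IsStableRandomMeasure P α 1 M) (hα : 0 < α) (hα2 : α < 2)
    {f : ℝ → ℝ} (hf : MemLp f (ENNReal.ofReal α) volume) :
    ∃ Y, IsStableIntegral P α M f Y := by
  have hp0 : ENNReal.ofReal α ≠ 0 := by simpa using hα
  -- The rate `8 ^ (-n)` beats the factor `2 ^ (nα) ≤ 4 ^ n` from the tail bound at height `2 ^
  -- (-n)`. The increments then exceed that height with summable probabilities, and Borel–Cantelli
  -- gives almost sure convergence.
  have hex : ∀ n : ℕ, ∃ s : SimpleFunc ℝ ℝ, s.FinMeasSupp volume ∧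
      ∫ u, |s u - f u| ^ α ≤ (1 / 8) ^ n := by
    intro n
    set δ : ℝ := ((1 / 8) ^ n) ^ α⁻¹ with hδ
    have hδ0 : 0 < δ := by positivity
    obtain ⟨s, hs1, hs2⟩ := hf.exists_simpleFunc_eLpNorm_sub_lt ENNReal.ofReal_ne_top
      (ε := ENNReal.ofReal δ) (by simpa using hδ0)
    refine ⟨s, (SimpleFunc.memLp_iff_finMeasSupp hp0 ENNReal.ofReal_ne_top).1 hs2, ?_⟩
    rw [eLpNorm_sub_comm, eLpNorm_eq_ofReal hα (hs2.sub hf), ENNReal.ofReal_lt_ofReal_iff hδ0,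
      hδ] at hs1
    exact (Real.rpow_lt_rpow_iff (integral_nonneg fun u => by positivity) (by positivity)
      (by positivity)).1 hs1 |>.le
  choose s hs hse using hex
  have hml : ∀ n, MemLp (s n) (ENNReal.ofReal α) volume := fun n => memLp_simpleFunc (hs n) _
  have hi : ∀ n, Integrable fun u => |s n u - f u| ^ α :=
    fun n => integrable_abs_rpow hα ((hml n).sub hf)
  have hZm : ∀ n, Measurable (simpleIntegral M (s n)) := fun n => measurable_simpleIntegral hM (hs n)
  obtain ⟨K, hK0, hK⟩ := exists_measureReal_abs_gt_le (P := P) hα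
  have hdiff : ∀ n, ∫ u, |s (n + 1) u - s n u| ^ α ≤ 4 * (2 * (1 / 8) ^ n) := by
    intro n
    have h2α : (2 : ℝ) ^ α ≤ 4 := by
      calc (2 : ℝ) ^ α ≤ 2 ^ (2 : ℝ) := Real.rpow_le_rpow_of_exponent_le one_le_two hα2.le
        _ = 4 := by norm_num
    calc _ ≤ ∫ u, 2 ^ α * (|s (n + 1) u - f u| ^ α + |s n u - f u| ^ α) := by
          refine integral_mono (integrable_abs_rpow hα ((hml (n + 1)).sub (hml n)))
            (((hi (n + 1)).add (hi n)).const_mul _) fun u => ?_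
          have := abs_add_rpow_le hα (s (n + 1) u - f u) (f u - s n u)
          rw [sub_add_sub_cancel, abs_sub_comm (f u)] at this
          exact this
      _ = 2 ^ α * ((∫ u, |s (n + 1) u - f u| ^ α) + ∫ u, |s n u - f u| ^ α) := by
          rw [integral_const_mul, integral_add (hi (n + 1)) (hi n)]
      _ ≤ 4 * ((1 / 8) ^ (n + 1) + (1 / 8) ^ n) :=
          mul_le_mul h2α (add_le_add (hse (n + 1)) (hse n))
            (add_nonneg (integral_nonneg fun u => by positivity)
              (integral_nonneg fun u => by positivity)) (by norm_num)
      _ ≤ 4 * (2 * (1 / 8) ^ n) := by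
          rw [pow_succ]
          have : (0 : ℝ) < (1 / 8) ^ n := by positivity
          linarith
  have htail : ∀ n : ℕ, P.real {ω | (1 / 2) ^ n < |simpleIntegral M (s (n + 1)) ω -
      simpleIntegral M (s n) ω|} ≤ 8 * K * (1 / 2) ^ n := by
    intro n
    have h1 := hK _ (fun u => s (n + 1) u - s n u) ((hZm (n + 1)).sub (hZm n))
      (integrable_abs_rpow hα ((hml (n + 1)).sub (hml n)))
      (charFun_simpleIntegral_sub hM hα (hs (n + 1)) (hs n)) ((1 / 2) ^ n) (by positivity)
    refine h1.trans ?_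
    have h2 : (((1 / 2 : ℝ) ^ n)⁻¹) ^ α ≤ 4 ^ n := by
      calc (((1 / 2 : ℝ) ^ n)⁻¹) ^ α = (2 ^ n) ^ α := by
            rw [one_div, inv_pow, inv_inv]
        _ ≤ (2 ^ n) ^ (2 : ℝ) :=
            Real.rpow_le_rpow_of_exponent_le (one_le_pow₀ one_le_two) hα2.le
        _ = 4 ^ n := by
            rw [Real.rpow_two, ← pow_mul, mul_comm, pow_mul]
            norm_num
    calc _ ≤ K * 4 ^ n * (4 * (2 * (1 / 8) ^ n)) := by
          gcongr
          exact hdiff n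
      _ = 8 * K * (4 * (1 / 8)) ^ n := by rw [mul_pow]; ring
      _ = _ := by norm_num
  have hsum : ∑' n : ℕ, P {ω | (1 / 2) ^ n < |simpleIntegral M (s (n + 1)) ω -
      simpleIntegral M (s n) ω|} ≠ ⊤ := by
    have hS : Summable fun n : ℕ => 8 * K * (1 / 2 : ℝ) ^ n :=
      (summable_geometric_of_lt_one (by norm_num) (by norm_num)).mul_left _
    refine ne_top_of_le_ne_top (hS.tsum_ofReal_ne_top) (ENNReal.tsum_le_tsum fun n => ?_)
    rw [← ofReal_measureReal]
    exact ENNReal.ofReal_le_ofReal (htail n)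
  have hconv : ∀ᵐ ω ∂P, ∃ y, Tendsto (fun n => simpleIntegral M (s n) ω) atTop (𝓝 y) := by
    filter_upwards [ae_eventually_notMem hsum] with ω hω
    refine cauchySeq_tendsto_of_complete (cauchySeq_of_summable_dist ?_)
    refine Summable.of_norm_bounded_eventually_nat (g := fun n => (1 / 2 : ℝ) ^ n)
      (summable_geometric_of_lt_one (by norm_num) (by norm_num)) ?_
    filter_upwards [hω] with n hn
    rw [Real.norm_of_nonneg dist_nonneg, dist_comm, Real.dist_eq]
    exact not_lt.1 hn
  obtain ⟨Y, hYm, hY⟩ := measurable_limit_of_tendsto_metrizable_ae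
    (fun n => (hZm n).aemeasurable) hconv
  refine ⟨Y, hf, hYm, s, hs, ?_, ?_⟩
  · refine (tendsto_eLpNorm_zero_iff hα fun n => (hml n).sub hf).2 ?_
    exact squeeze_zero (fun n => integral_nonneg fun u => by positivity) hse
      (tendsto_pow_atTop_nhds_zero_of_lt_one (by norm_num) (by norm_num))
  · exact tendstoInMeasure_of_tendsto_ae (fun n => (hZm n).aestronglyMeasurable) hY

end Existence

/-! ### Dominated convergence in `L^α` -/

/-- The functions `h n` converge almost everywhere to `h'`, are dominated in `L^α` by `g` on `E`,
and tend to zero in `L^α` off `E`. -/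
structure DominatedConv (α : ℝ) (E : Set ℝ) (g : ℝ → ℝ) (h : ℕ → ℝ → ℝ) (h' : ℝ → ℝ) : Prop where
  measurable : ∀ n, Measurable (h n)
  integrable : ∀ᶠ n in atTop, Integrable fun u => |h n u| ^ α
  tendsto : ∀ᵐ u, Tendsto (fun n => h n u) atTop (𝓝 (h' u))
  le : ∀ᶠ n in atTop, ∀ᵐ u, u ∈ E → |h n u| ≤ g u
  integrableOn : IntegrableOn (fun u => |g u| ^ α) E
  tendsto_compl : Tendsto (fun n => ∫ u in Eᶜ, |h n u| ^ α) atTop (𝓝 0)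
  eq_zero : ∀ u ∉ E, h' u = 0

namespace DominatedConv

variable {α : ℝ} {E : Set ℝ}

/-- The almost everywhere limit inherits the dominating function on `E` and vanishes off `E`. For
the kernels this gives membership in `L^α` with no separate computation. -/
lemma memLp (hα : 0 < α) (hE : MeasurableSet E) {g : ℝ → ℝ} {h : ℕ → ℝ → ℝ} {h' : ℝ → ℝ}
    (H : DominatedConv α E g h h') : MemLp h' (ENNReal.ofReal α) volume := by
  have hm : AEStronglyMeasurable h' volume :=
    aestronglyMeasurable_of_tendsto_ae atTop (fun n => (H.measurable n).aestronglyMeasurable)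
      H.tendsto
  rw [← integrable_norm_rpow_iff hm (by simpa using hα) ENNReal.ofReal_ne_top,
    ENNReal.toReal_ofReal hα.le]
  obtain ⟨N, hN⟩ := eventually_atTop.1 H.le
  have h1 : ∀ᵐ u, ∀ n, u ∈ E → |h (n + N) u| ≤ g u :=
    ae_all_iff.2 fun n => hN (n + N) (Nat.le_add_left _ _)
  refine Integrable.mono' ((integrable_indicator_iff hE).2 H.integrableOn)
    (hm.norm.aemeasurable.pow_const α).aestronglyMeasurable ?_
  filter_upwards [h1, H.tendsto] with u hu1 hu2
  rw [Real.norm_of_nonneg (by positivity)]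
  by_cases hu : u ∈ E
  · rw [Set.indicator_of_mem hu]
    have h2 : |h' u| ≤ g u :=
      le_of_tendsto' ((tendsto_add_atTop_iff_nat N).2 hu2).abs fun n => hu1 n hu
    exact Real.rpow_le_rpow (abs_nonneg _) (h2.trans (le_abs_self _)) hα.le
  · rw [Set.indicator_of_notMem hu, H.eq_zero u hu, norm_zero, Real.zero_rpow hα.ne']

lemma sum (hα : 0 < α) {m : ℕ} {g : Fin m → ℝ → ℝ} {h : Fin m → ℕ → ℝ → ℝ}
    {h' : Fin m → ℝ → ℝ} (H : ∀ l, DominatedConv α E (g l) (h l) (h' l)) (θ : Fin m → ℝ)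
    (hg : ∀ l, Measurable (g l)) :
    DominatedConv α E (fun u => ∑ l, |θ l| * g l u) (fun n u => ∑ l, θ l * h l n u)
      (fun u => ∑ l, θ l * h' l u) := by
  have hsum : ∀ x : Fin m → ℝ, |∑ l, θ l * x l| ^ α ≤ (m : ℝ) ^ α * ∑ l, |θ l| ^ α * |x l| ^ α := by
    intro x
    refine (abs_sum_rpow_le hα _ _).trans (le_of_eq ?_)
    simp_rw [abs_mul, Real.mul_rpow (abs_nonneg _) (abs_nonneg _)]
    simp
  have hmeas : ∀ n, Measurable fun u => ∑ l, θ l * h l n u := fun n =>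
    Finset.measurable_fun_sum _ fun l _ => ((H l).measurable n).const_mul _
  have hI : ∀ n, (∀ l, Integrable fun u => |h l n u| ^ α) →
      Integrable fun u => (m : ℝ) ^ α * ∑ l, |θ l| ^ α * |h l n u| ^ α := fun n hn =>
    (integrable_finsetSum _ fun l _ => (hn l).const_mul _).const_mul _
  have hall : ∀ᶠ n in atTop, ∀ l, Integrable fun u => |h l n u| ^ α :=
    eventually_all.2 fun l => (H l).integrable
  refine ⟨hmeas, ?_, ?_, ?_, ?_, ?_, ?_⟩
  · filter_upwards [hall] with n hn
    refine (hI n hn).mono' ((hmeas n).norm.pow_const α).aestronglyMeasurable (ae_of_all _ fun u => ?_)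
    rw [Real.norm_of_nonneg (by positivity)]
    exact hsum _
  · filter_upwards [ae_all_iff.2 fun l => (H l).tendsto] with u hu
    exact tendsto_finsetSum _ fun l _ => (hu l).const_mul _
  · filter_upwards [eventually_all.2 fun l => (H l).le] with n hn
    filter_upwards [ae_all_iff.2 hn] with u hu huE
    refine (Finset.abs_sum_le_sum_abs _ _).trans (Finset.sum_le_sum fun l _ => ?_)
    rw [abs_mul]
    exact mul_le_mul_of_nonneg_left (hu l huE) (abs_nonneg _)
  · have : IntegrableOn (fun u => (m : ℝ) ^ α * ∑ l, |θ l| ^ α * |g l u| ^ α) E :=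
      Integrable.const_mul (integrable_finsetSum _ fun l _ =>
        Integrable.const_mul (H l).integrableOn _) _
    refine this.mono' ?_ (ae_of_all _ fun u => ?_)
    · exact ((Finset.measurable_fun_sum _ fun l _ =>
        (hg l).const_mul _).norm.pow_const α).aestronglyMeasurable
    · rw [Real.norm_of_nonneg (by positivity)]
      refine (abs_sum_rpow_le hα _ _).trans (le_of_eq ?_)
      simp_rw [abs_mul, abs_abs, Real.mul_rpow (abs_nonneg _) (abs_nonneg _)]
      simp
  · have h0 : Tendsto (fun n => (m : ℝ) ^ α * ∑ l, |θ l| ^ α * ∫ u in Eᶜ, |h l n u| ^ α) atTop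
        (𝓝 0) := by
      simpa using (tendsto_finsetSum Finset.univ fun l _ =>
        ((H l).tendsto_compl).const_mul (|θ l| ^ α)).const_mul ((m : ℝ) ^ α)
    refine squeeze_zero' (Eventually.of_forall fun n => integral_nonneg fun u => by positivity)
      ?_ h0
    filter_upwards [hall] with n hn
    simp_rw [← integral_const_mul]
    rw [← integral_finsetSum _ fun l _ => (hn l).restrict.const_mul _, ← integral_const_mul]
    exact integral_mono_of_nonneg (ae_of_all _ fun u => by positivity) (hI n hn).restrict
      (ae_of_all _ fun u => hsum _)
  · intro u hu
    exact Finset.sum_eq_zero fun l _ => by rw [(H l).eq_zero u hu, mul_zero]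

/-- On `E` this is dominated convergence with bound `K |g| ^ α`. Off `E` there need be no pointwise
domination, but the growth bound on `Ψ n` reduces that part to the `L^α` mass of `h n`, which
vanishes; the limit contributes nothing there because `ψ 0 = 0`. -/
lemma tendsto_integral (hα : 0 < α) (hE : MeasurableSet E) {g : ℝ → ℝ} {h : ℕ → ℝ → ℝ}
    {h' : ℝ → ℝ} (H : DominatedConv α E g h h') {Ψ : ℕ → ℝ → ℂ} {ψ : ℝ → ℂ} {K : ℝ}
    (hm : ∀ n, Measurable (Ψ n))
    (hΨ : ∀ (v : ℕ → ℝ) (w : ℝ), Tendsto v atTop (𝓝 w) → Tendsto (fun n => Ψ n (v n)) atTop (𝓝 (ψ w)))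
    (hK0 : 0 ≤ K) (hK : ∀ᶠ n in atTop, ∀ x, ‖Ψ n x‖ ≤ K * |x| ^ α) :
    Tendsto (fun n => ∫ u, Ψ n (h n u)) atTop (𝓝 (∫ u, ψ (h' u))) := by
  have hψ0 : ψ 0 = 0 := by
    refine tendsto_nhds_unique (hΨ (fun _ => 0) 0 tendsto_const_nhds) (tendsto_const_nhds.congr' ?_)
    filter_upwards [hK] with n hn
    have := hn 0
    rw [abs_zero, Real.zero_rpow hα.ne', mul_zero] at this
    exact (norm_le_zero_iff.1 this).symm
  have hmeas : ∀ n, AEStronglyMeasurable (fun u => Ψ n (h n u)) volume := fun n =>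
    ((hm n).comp (H.measurable n)).aestronglyMeasurable
  have h1 : Tendsto (fun n => ∫ u in E, Ψ n (h n u)) atTop (𝓝 (∫ u in E, ψ (h' u))) := by
    refine tendsto_integral_filter_of_dominated_convergence (fun u => K * |g u| ^ α)
      (Eventually.of_forall fun n => (hmeas n).restrict) ?_ (H.integrableOn.const_mul K) ?_
    · filter_upwards [hK, H.le] with n hn hle
      filter_upwards [ae_restrict_of_ae hle, ae_restrict_mem hE] with u hu huE
      exact (hn _).trans (mul_le_mul_of_nonneg_left (Real.rpow_le_rpow (abs_nonneg _)
        ((hu huE).trans (le_abs_self _)) hα.le) hK0)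
    · filter_upwards [ae_restrict_of_ae H.tendsto] with u hu
      exact hΨ _ _ hu
  have h2 : Tendsto (fun n => ∫ u in Eᶜ, Ψ n (h n u)) atTop (𝓝 0) := by
    refine squeeze_zero_norm' (a := fun n => K * ∫ u in Eᶜ, |h n u| ^ α) ?_
      (by simpa using H.tendsto_compl.const_mul K)
    filter_upwards [hK, H.integrable] with n hn hi
    rw [← integral_const_mul]
    exact norm_integral_le_of_norm_le (hi.restrict.const_mul K) (ae_of_all _ fun u => hn _)
  have h3 : ∫ u, ψ (h' u) = ∫ u in E, ψ (h' u) := by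
    refine (setIntegral_eq_integral_of_forall_compl_eq_zero fun u hu => ?_).symm
    rw [H.eq_zero u hu, hψ0]
  rw [h3]
  have h4 := h1.add h2
  rw [add_zero] at h4
  refine h4.congr' ?_
  filter_upwards [hK, H.integrable] with n hn hi
  exact integral_add_compl hE ((hi.const_mul K).mono' (hmeas n) (ae_of_all _ fun u => hn _))

end DominatedConv

/-! ### Step functions -/

/-- The integral of a step function on the grid of mesh `1 / n`. -/
lemma integral_comp_floor {E : Type*} [NormedAddCommGroup E] [NormedSpace ℝ E] [CompleteSpace E]
    {n : ℕ} (hn : 0 < n) (f : ℤ → E) (s : Finset ℤ) (hf : ∀ i ∉ s, f i = 0) :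
    Integrable (fun u : ℝ => f ⌊n * u⌋) ∧
    ∫ u : ℝ, f ⌊n * u⌋ = (n : ℝ)⁻¹ • ∑ i ∈ s, f i := by
  have hn0 : (0 : ℝ) < n := by exact_mod_cast hn
  have hset : ∀ (i : ℤ) (u : ℝ), u ∈ Set.Ico ((i : ℝ) / n) ((i + 1) / n) ↔ ⌊n * u⌋ = i := by
    intro i u
    rw [Set.mem_Ico, Int.floor_eq_iff, div_le_iff₀ hn0, lt_div_iff₀ hn0, mul_comm]
  have h1 : (fun u : ℝ => f ⌊n * u⌋) = fun u => ∑ i ∈ s,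
      (Set.Ico ((i : ℝ) / n) ((i + 1) / n)).indicator (fun _ => f i) u := by
    funext u
    rw [Finset.sum_eq_single ⌊n * u⌋]
    · rw [Set.indicator_of_mem ((hset _ _).2 rfl)]
    · intro i _ hi
      rw [Set.indicator_of_notMem]
      rw [hset]
      exact fun h => hi h.symm
    · intro h
      rw [hf _ h]
      simp
  have hi : ∀ i ∈ s, Integrable
      ((Set.Ico ((i : ℝ) / n) ((i + 1) / n)).indicator (fun _ => f i)) := by
    intro i _
    rw [integrable_indicator_iff measurableSet_Ico]
    exact integrableOn_const (by simp)
  rw [h1]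
  refine ⟨integrable_finsetSum _ hi, ?_⟩
  rw [integral_finsetSum _ hi, Finset.smul_sum]
  refine Finset.sum_congr rfl fun i _ => ?_
  rw [integral_indicator measurableSet_Ico, setIntegral_const, measureReal_def, Real.volume_Ico,
    ENNReal.toReal_ofReal (by rw [← sub_div]; simp)]
  congr 1
  field_simp
  ring

/-! ### Convergence of characteristic functions of weighted sums -/

lemma norm_prod_sub_prod_le {ι : Type*} (s : Finset ι) {x y : ι → ℂ} (hx : ∀ i ∈ s, ‖x i‖ ≤ 1)
    (hy : ∀ i ∈ s, ‖y i‖ ≤ 1) : ‖∏ i ∈ s, x i - ∏ i ∈ s, y i‖ ≤ ∑ i ∈ s, ‖x i - y i‖ := by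
  classical
  induction s using Finset.induction_on with
  | empty => simp
  | insert i s hi ih =>
    have ih' := ih (fun j hj => hx j (Finset.mem_insert_of_mem hj))
      (fun j hj => hy j (Finset.mem_insert_of_mem hj))
    rw [Finset.prod_insert hi, Finset.prod_insert hi, Finset.sum_insert hi,
      show x i * ∏ j ∈ s, x j - y i * ∏ j ∈ s, y j = (x i - y i) * ∏ j ∈ s, x j +
        y i * (∏ j ∈ s, x j - ∏ j ∈ s, y j) by ring]
    refine (norm_add_le _ _).trans (add_le_add ?_ ?_)
    · rw [norm_mul]
      refine mul_le_of_le_one_right (norm_nonneg _) ?_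
      rw [norm_prod]
      exact Finset.prod_le_one (fun _ _ => norm_nonneg _)
        fun j hj => hx j (Finset.mem_insert_of_mem hj)
    · rw [norm_mul]
      exact (mul_le_of_le_one_left (norm_nonneg _) (hy i (Finset.mem_insert_self i s))).trans ih'

lemma norm_exp_sub_one_le_one {z : ℂ} (hz : ‖z‖ ≤ 1) : ‖Complex.exp (z - 1)‖ ≤ 1 := by
  rw [Complex.norm_exp, Real.exp_le_one_iff, Complex.sub_re, Complex.one_re]
  linarith [Complex.re_le_norm z]

/-- Replaces a characteristic function by its compound Poisson companion with quadratic error. The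
constant 2 also covers `‖z - 1‖ ≥ 1`, where both terms have norm at most 1. -/
lemma norm_sub_exp_sub_one_le {z : ℂ} (hz : ‖z‖ ≤ 1) :
    ‖z - Complex.exp (z - 1)‖ ≤ 2 * ‖z - 1‖ ^ 2 := by
  rcases le_total ‖z - 1‖ 1 with h | h
  · have := Complex.norm_exp_sub_one_sub_id_le h
    rw [show Complex.exp (z - 1) - 1 - (z - 1) = -(z - Complex.exp (z - 1)) by ring,
      norm_neg] at this
    nlinarith [sq_nonneg ‖z - 1‖]
  · refine (norm_sub_le _ _).trans ?_
    have := norm_exp_sub_one_le_one hz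
    nlinarith

section WeightedSum

variable {α γ : ℝ} {Ω : ℕ → Type*} [∀ n, MeasurableSpace (Ω n)] {P : ∀ n, Measure (Ω n)}
  [∀ n, IsProbabilityMeasure (P n)] {ξ : ∀ n, ℤ → Ω n → ℝ}

omit [∀ n, IsProbabilityMeasure (P n)] in
lemma charFun_weightedSum {n : ℕ} (hmeas : ∀ k, Measurable (ξ n k))
    (hindep : iIndepFun (ξ n) (P n)) {ν : Measure ℝ} (hlaw : ∀ k, (P n).map (ξ n k) = ν)
    (s : Finset ℤ) (w : ℤ → ℝ) :
    charFun ((P n).map fun ω => ∑ i ∈ s, w i * ξ n i ω) 1 = ∏ i ∈ s, charFun ν (w i) := by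
  have hind := hindep.comp (fun i x => w i * x) (fun i => by fun_prop)
  have h1 : (fun ω => ∑ i ∈ s, w i * ξ n i ω) =
      fun ω => ∑ i ∈ s, ((fun x => w i * x) ∘ ξ n i) ω := rfl
  rw [h1, (hind.restrict s).charFun_map_fun_finsetSum_eq_prod (fun i _ => (Measurable.comp
    (by fun_prop) (hmeas i)).aemeasurable), Finset.prod_apply]
  refine Finset.prod_congr rfl fun i _ => ?_
  rw [← Measure.map_map (by fun_prop) (hmeas i), charFun_map_mul, mul_one, hlaw]

/-- The method of accompanying laws. The exponent of the companion law is exactly the integral of `Ψ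
n` along the step function, so convergence of triangular arrays becomes dominated convergence on the
line. -/
lemma tendsto_charFun_weightedSum (h0 : 0 < α) (h2 : α < 2) (h1 : α ≠ 1) (hγ : 1 / α < γ)
    (hmeas : ∀ n k, Measurable (ξ n k)) (hindep : ∀ n, iIndepFun (ξ n) (P n))
    (hlaw : ∀ n k, (P n).map (ξ n k) = innovationLaw α ((n : ℝ) ^ γ))
    {E : Set ℝ} (hE : MeasurableSet E) {g h' : ℝ → ℝ} {f : ℕ → ℤ → ℝ} (s : ℕ → Finset ℤ)
    (hs : ∀ n, ∀ i ∉ s n, f n i = 0)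
    (H : DominatedConv α E g (fun n u => f n ⌊n * u⌋) h') :
    Tendsto (fun n : ℕ => charFun ((P n).map fun ω => ∑ i ∈ s n,
      (f n i * ((Real.Gamma (1 - α) * Real.cos (Real.pi * α / 2)) ^ (-1 / α) *
        (n : ℝ) ^ (-1 / α))) * ξ n i ω) 1) atTop
      (𝓝 (Complex.exp (∫ u, stableExponent α (h' u)))) := by
  set κ := (Real.Gamma (1 - α) * Real.cos (Real.pi * α / 2)) ^ (-1 / α) with hκ
  have hκ0 : 0 < κ := Real.rpow_pos_of_pos (Gamma_mul_cos_pos h0 h2 h1) _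
  have hγ0 : 0 < γ := lt_trans (by positivity) hγ
  set φ : ℕ → ℝ → ℂ := fun n x => charFun (innovationLaw α ((n : ℝ) ^ γ))
    (x * (κ * (n : ℝ) ^ (-1 / α))) with hφ
  have hprob : ∀ n : ℕ, IsProbabilityMeasure (innovationLaw α ((n : ℝ) ^ γ)) := fun n => by
    rw [← hlaw n 0]
    exact Measure.isProbabilityMeasure_map (hmeas n 0).aemeasurable
  have hφ1 : ∀ n x, ‖φ n x‖ ≤ 1 := fun n x => by
    have := hprob n
    exact norm_charFun_le_one _
  have hφ0 : ∀ n, φ n 0 = 1 := fun n => by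
    have := hprob n
    simp [hφ]
  have hφm : ∀ n, Measurable (φ n) := fun n => by
    have := hprob n
    have hc : Measurable (charFun (innovationLaw α ((n : ℝ) ^ γ))) :=
      continuous_charFun.measurable
    exact hc.comp (by fun_prop)
  set Ψ : ℕ → ℝ → ℂ := fun n x => (n : ℂ) * (φ n x - 1) with hΨ
  have hΨm : ∀ n, Measurable (Ψ n) := fun n => ((hφm n).sub_const 1).const_mul _
  have hΨlim : ∀ (v : ℕ → ℝ) (w : ℝ), Tendsto v atTop (𝓝 w) →
      Tendsto (fun n => Ψ n (v n)) atTop (𝓝 (stableExponent α w)) := fun v w hv =>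
    tendsto_charFun_innovationLaw h0 h2 h1 hγ hv
  obtain ⟨K, hK0, hK⟩ := exists_norm_charFun_innovationLaw_sub_one_le h0 h2 h1
  have hΨb : ∀ᶠ n in atTop, ∀ x, ‖Ψ n x‖ ≤ (K * κ ^ α) * |x| ^ α := by
    filter_upwards [eventually_gt_atTop 0] with n hn x
    have hn0 : (0 : ℝ) < n := by exact_mod_cast hn
    have hnn : ((n : ℝ) ^ (-1 / α)) ^ α = (n : ℝ)⁻¹ := by
      rw [← Real.rpow_mul hn0.le, div_mul_cancel₀ _ h0.ne', Real.rpow_neg_one]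
    rw [hΨ, norm_mul, Complex.norm_natCast]
    calc (n : ℝ) * ‖φ n x - 1‖ ≤ n * (K * |x * (κ * (n : ℝ) ^ (-1 / α))| ^ α) := by
          gcongr
          exact hK _ _ (Real.one_le_rpow (by exact_mod_cast hn) hγ0.le)
      _ = _ := by
          rw [abs_mul, abs_of_pos (show 0 < κ * (n : ℝ) ^ (-1 / α) by positivity),
            Real.mul_rpow (abs_nonneg _) (by positivity), Real.mul_rpow hκ0.le (by positivity),
            hnn]
          field_simp
  have hA := H.tendsto_integral h0 hE hΨm hΨlim (by positivity) hΨb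
  -- Its integral along the step function is `∑ ‖φ - 1‖ ^ 2`, the error of passing to companion
  -- laws. It tends to zero pointwise because of the factor `1 / n`, and `‖Ψ‖ ≤ 2n` keeps it below a
  -- multiple of `|x| ^ α`.
  set Ψ2 : ℕ → ℝ → ℂ := fun n x => ((‖Ψ n x‖ ^ 2 / n : ℝ) : ℂ) with hΨ2
  have hB := H.tendsto_integral (Ψ := Ψ2) (ψ := fun _ => 0) (K := 2 * (K * κ ^ α)) h0 hE
    (fun n => Complex.measurable_ofReal.comp (((hΨm n).norm.pow_const 2).div_const _)) (by
      intro v w hv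
      have h3 : Tendsto (fun n : ℕ => ‖Ψ n (v n)‖ ^ 2 / (n : ℝ)) atTop (𝓝 0) :=
        ((hΨlim v w hv).norm.pow 2).div_atTop tendsto_natCast_atTop_atTop
      have h3' := (Complex.continuous_ofReal.tendsto 0).comp h3
      rw [Complex.ofReal_zero] at h3'
      exact h3') (by positivity) (by
      filter_upwards [hΨb, eventually_gt_atTop 0] with n hn hpos x
      have hn0 : (0 : ℝ) < n := by exact_mod_cast hpos
      rw [hΨ2, Complex.norm_real, Real.norm_of_nonneg (by positivity), div_le_iff₀ hn0]
      have h4 : ‖Ψ n x‖ ≤ 2 * n := by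
        rw [hΨ, norm_mul, Complex.norm_natCast, mul_comm]
        have : ‖φ n x - 1‖ ≤ 2 := (norm_sub_le _ _).trans (by
          rw [norm_one]
          linarith [hφ1 n x])
        gcongr
      have h5 := hn x
      calc ‖Ψ n x‖ ^ 2 = ‖Ψ n x‖ * ‖Ψ n x‖ := sq _
        _ ≤ (2 * n) * (K * κ ^ α * |x| ^ α) := by gcongr
        _ = _ := by ring)
  rw [integral_zero] at hB
  have hA' : Tendsto (fun n => Complex.exp (∑ i ∈ s n, (φ n (f n i) - 1))) atTop
      (𝓝 (Complex.exp (∫ u, stableExponent α (h' u)))) := by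
    refine (Complex.continuous_exp.tendsto _).comp (hA.congr' ?_)
    filter_upwards [eventually_gt_atTop 0] with n hn
    have hn0 : (n : ℂ) ≠ 0 := by exact_mod_cast hn.ne'
    rw [(integral_comp_floor hn (fun i => Ψ n (f n i)) (s n) fun i hi => by
      simp [hΨ, hs n i hi, hφ0]).2, Finset.smul_sum]
    refine Finset.sum_congr rfl fun i _ => ?_
    simp only [hΨ, Complex.real_smul]
    push_cast
    rw [← mul_assoc, inv_mul_cancel₀ hn0, one_mul]
  have hdiff : Tendsto (fun n => ∏ i ∈ s n, φ n (f n i) -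
      Complex.exp (∑ i ∈ s n, (φ n (f n i) - 1))) atTop (𝓝 0) := by
    have hB' := hB.norm.const_mul 2
    rw [norm_zero, mul_zero] at hB'
    refine squeeze_zero_norm' ?_ hB'
    filter_upwards [eventually_gt_atTop 0] with n hn
    have hn0 : (0 : ℝ) < n := by exact_mod_cast hn
    have h6 := (integral_comp_floor hn (fun i => Ψ2 n (f n i)) (s n) fun i hi => by
      simp [hΨ2, hΨ, hs n i hi, hφ0]).2
    have h7 : ∫ u : ℝ, Ψ2 n (f n ⌊n * u⌋) = ((∑ i ∈ s n, ‖φ n (f n i) - 1‖ ^ 2 : ℝ) : ℂ) := by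
      rw [h6, Finset.smul_sum]
      push_cast
      refine Finset.sum_congr rfl fun i _ => ?_
      simp only [hΨ2, hΨ, norm_mul, Complex.norm_natCast, Complex.real_smul]
      rw [← Complex.ofReal_mul, ← Complex.ofReal_pow, Complex.ofReal_inj]
      field_simp
    rw [h7, Complex.norm_real, Real.norm_of_nonneg (by positivity), Complex.exp_sum,
      Finset.mul_sum]
    refine (norm_prod_sub_prod_le _ (fun i _ => hφ1 _ _)
      fun i _ => norm_exp_sub_one_le_one (hφ1 _ _)).trans (Finset.sum_le_sum fun i _ => ?_)
    exact norm_sub_exp_sub_one_le (hφ1 _ _)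
  have := hdiff.add hA'
  rw [zero_add] at this
  refine this.congr fun n => ?_
  rw [charFun_weightedSum (hmeas n) (hindep n) (hlaw n) (s n)
    fun i => f n i * (κ * (n : ℝ) ^ (-1 / α))]
  ring

end WeightedSum

/-! ### Sums of filter coefficients -/

lemma taperedFilter_eq (a : ℕ → ℝ) {l : ℝ} (hl : 0 ≤ l) (j : ℕ) :
    taperedFilter a l j = if j < ⌊l⌋₊ + 1 then a j else 0 := by
  rw [taperedFilter]
  congr 1
  rw [Nat.lt_succ_iff, Nat.le_floor_iff hl]

/-- The sum of the tapered filter coefficients with indices in `[0, m]`. -/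
def filterSum (a : ℕ → ℝ) (l : ℝ) (m : ℤ) : ℝ :=
  ∑ j ∈ Finset.range (m + 1).toNat, taperedFilter a l j

lemma filterSum_of_neg (a : ℕ → ℝ) (l : ℝ) {m : ℤ} (hm : m < 0) : filterSum a l m = 0 := by
  rw [filterSum, Int.toNat_of_nonpos (by omega), Finset.sum_range_zero]

lemma filterSum_eq (a : ℕ → ℝ) {l : ℝ} (hl : 0 ≤ l) (m : ℤ) :
    filterSum a l m = ∑ j ∈ Finset.range (min (m + 1).toNat (⌊l⌋₊ + 1)), a j := by
  rw [filterSum]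
  simp_rw [taperedFilter_eq a hl]
  rw [← Finset.sum_filter]
  refine Finset.sum_congr ?_ fun _ _ => rfl
  ext j
  simp

/-- The coefficient of the innovation `ξ i` in the sum of `X_k` over `0 ≤ k ≤ N`. -/
def sumWeight (a : ℕ → ℝ) (l : ℝ) (N i : ℤ) : ℝ := filterSum a l (N - i) - filterSum a l (-1 - i)

lemma filterSum_add_one (a : ℕ → ℝ) (l : ℝ) (m : ℤ) :
    filterSum a l m - filterSum a l (m - 1) =
      if 0 ≤ m then taperedFilter a l m.toNat else 0 := by
  split_ifs with h
  · obtain ⟨k, rfl⟩ := Int.eq_ofNat_of_zero_le h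
    rw [filterSum, filterSum, sub_add_cancel, Int.toNat_natCast]
    rw [show ((k : ℤ) + 1).toNat = k + 1 by omega, Finset.sum_range_succ]
    ring
  · rw [filterSum_of_neg _ _ (by omega), filterSum_of_neg _ _ (by omega), sub_zero]

lemma sumWeight_eq_sum (a : ℕ → ℝ) (l : ℝ) (N : ℕ) (i : ℤ) :
    sumWeight a l N i = ∑ k ∈ Finset.range (N + 1),
      if 0 ≤ (k : ℤ) - i then taperedFilter a l ((k : ℤ) - i).toNat else 0 := by
  simp_rw [← filterSum_add_one]
  have := Finset.sum_range_sub (fun k : ℕ => filterSum a l ((k : ℤ) - 1 - i)) (N + 1)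
  rw [sumWeight]
  convert this.symm using 2
  · congr 1; push_cast; ring
  · congr 1
  · congr 1
    · congr 1; push_cast; ring
    · congr 1; ring

lemma linearProcess_eq_sum {Ω : Type*} (a : ℕ → ℝ) {l : ℝ} (hl : 0 ≤ l) (ξ : ℤ → Ω → ℝ)
    {k N : ℕ} (hk : k ≤ N) (ω : Ω) :
    linearProcess a l ξ k ω = ∑ i ∈ Finset.Icc (-(⌊l⌋₊ : ℤ)) N,
      (if 0 ≤ (k : ℤ) - i then taperedFilter a l ((k : ℤ) - i).toNat else 0) * ξ i ω := by
  rw [linearProcess, tsum_eq_sum (s := Finset.range (⌊l⌋₊ + 1))]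
  · refine Finset.sum_of_injOn (fun j : ℕ => (k : ℤ) - j) (fun i _ j _ h => by simpa using h)
      (fun j hj => ?_) (fun i _ hi => ?_) (fun j _ => ?_)
    · simp only [Finset.coe_range, Set.mem_Iio] at hj
      simp only [Finset.coe_Icc, Set.mem_Icc]
      omega
    · split_ifs with h
      · rw [taperedFilter_eq a hl, if_neg, zero_mul]
        intro h2
        refine hi ⟨((k : ℤ) - i).toNat, ?_, ?_⟩
        · simpa using h2
        · simp only
          omega
      · rw [zero_mul]
    · rw [if_pos (by omega)]
      congr 2
      omega
  · intro j hj
    rw [taperedFilter_eq a hl, if_neg (by simpa using hj), zero_mul]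

/-- The upper end `N'` is left free so that several time points can share one range of innovations.
-/
lemma sum_linearProcess {Ω : Type*} (a : ℕ → ℝ) {l : ℝ} (hl : 0 ≤ l) (ξ : ℤ → Ω → ℝ)
    {N N' : ℕ} (hN : N ≤ N') (ω : Ω) :
    ∑ k ∈ Finset.range (N + 1), linearProcess a l ξ k ω =
      ∑ i ∈ Finset.Icc (-(⌊l⌋₊ : ℤ)) N', sumWeight a l N i * ξ i ω := by
  simp_rw [sumWeight_eq_sum, Finset.sum_mul]
  rw [Finset.sum_comm]
  refine Finset.sum_congr rfl fun k hk => ?_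
  exact linearProcess_eq_sum a hl ξ (by rw [Finset.mem_range] at hk; omega) ω

/-- Both filter sums have exhausted the truncated filter and cancel: innovations older than the
filter length do not enter. -/
lemma sumWeight_of_le (a : ℕ → ℝ) {l : ℝ} (hl : 0 ≤ l) {N i : ℤ} (hN : 0 ≤ N)
    (hi : (⌊l⌋₊ : ℤ) ≤ -1 - i) : sumWeight a l N i = 0 := by
  rw [sumWeight, filterSum_eq a hl, filterSum_eq a hl, min_eq_right, min_eq_right, sub_self] <;>
  omega

lemma sumWeight_of_gt (a : ℕ → ℝ) (l : ℝ) {N i : ℤ} (hN : 0 ≤ N) (hi : N < i) :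
    sumWeight a l N i = 0 := by
  rw [sumWeight, filterSum_of_neg _ _ (by omega), filterSum_of_neg _ _ (by omega), sub_self]

lemma sumWeight_eq_zero_of_notMem (a : ℕ → ℝ) {l : ℝ} (hl : 0 ≤ l) {N N' : ℕ} (hN : N ≤ N') {i : ℤ}
    (hi : i ∉ Finset.Icc (-(⌊l⌋₊ : ℤ)) N') : sumWeight a l N i = 0 := by
  rw [Finset.mem_Icc, not_and_or] at hi
  rcases hi with hi | hi
  · exact sumWeight_of_le a hl (by omega) (by omega)
  · exact sumWeight_of_gt a l (by omega) (by omega)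

/-! ### Asymptotics of sums of regularly varying coefficients -/

section Asymptotic

variable {a : ℕ → ℝ} {β : ℝ}

lemma tendsto_rpow_sub_rpow (β : ℝ) :
    Tendsto (fun n : ℕ => ((n + 1 : ℝ) ^ (1 - β) - (n : ℝ) ^ (1 - β)) / (n : ℝ) ^ (-β)) atTop
      (𝓝 (1 - β)) := by
  have hd : HasDerivAt (fun x : ℝ => x ^ (1 - β)) (1 - β) 1 := by
    simpa using Real.hasDerivAt_rpow_const (x := 1) (p := 1 - β) (Or.inl one_ne_zero)
  have h1 := hd.tendsto_slope_zero
  have h2 : Tendsto (fun n : ℕ => ((n : ℝ)⁻¹)) atTop (𝓝[≠] 0) :=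
    tendsto_nhdsWithin_iff.2 ⟨tendsto_inv_atTop_nhds_zero_nat,
      (eventually_gt_atTop 0).mono fun n hn => by
        simpa using hn.ne'⟩
  refine (h1.comp h2).congr' ?_
  filter_upwards [eventually_gt_atTop 0] with n hn
  have hn0 : (0 : ℝ) < n := by exact_mod_cast hn
  simp only [Function.comp, inv_inv, smul_eq_mul, Real.one_rpow]
  rw [eq_div_iff (by positivity), show (n + 1 : ℝ) = n * (1 + (n : ℝ)⁻¹) by field_simp,
    Real.mul_rpow hn0.le (by positivity)]
  have h3 : (n : ℝ) ^ (1 - β) = n * (n : ℝ) ^ (-β) := by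
    rw [sub_eq_add_neg, Real.rpow_add hn0, Real.rpow_one]
  rw [h3]
  ring

/-- Comparing with increments of `n ^ (1 - β)` instead of `n ^ (-β)` makes sums and tails telescope
exactly. -/
lemma isLittleO_sub_rpow (hβ : β ≠ 1) (ha : a ~[atTop] fun n : ℕ => (n : ℝ) ^ (-β)) :
    (fun n => a n - (1 - β)⁻¹ * ((n + 1 : ℝ) ^ (1 - β) - (n : ℝ) ^ (1 - β))) =o[atTop]
      fun n : ℕ => (n + 1 : ℝ) ^ (1 - β) - (n : ℝ) ^ (1 - β) := by
  have hβ' : 1 - β ≠ 0 := sub_ne_zero.2 hβ.symm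
  have hne : ∀ᶠ n : ℕ in atTop, (n : ℝ) ^ (-β) ≠ 0 := by
    filter_upwards [eventually_gt_atTop 0] with n hn
    have hn0 : (0 : ℝ) < n := by exact_mod_cast hn
    positivity
  have h1 : (fun n : ℕ => (n + 1 : ℝ) ^ (1 - β) - (n : ℝ) ^ (1 - β)) ~[atTop]
      fun n : ℕ => (1 - β) * (n : ℝ) ^ (-β) := by
    rw [isEquivalent_iff_tendsto_one (hne.mono fun n hn => mul_ne_zero hβ' hn)]
    have := (tendsto_rpow_sub_rpow β).div_const (1 - β)
    rw [div_self hβ'] at this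
    refine this.congr fun n => ?_
    simp only [Pi.div_apply]
    rw [div_div, mul_comm (1 - β)]
  have h2 : (fun n : ℕ => (n : ℝ) ^ (-β)) ~[atTop]
      fun n : ℕ => (1 - β)⁻¹ * ((n + 1 : ℝ) ^ (1 - β) - (n : ℝ) ^ (1 - β)) := by
    have := (IsEquivalent.refl (u := fun _ : ℕ => (1 - β)⁻¹) (l := atTop)).mul h1.symm
    refine (this.congr_left ?_)
    refine Eventually.of_forall fun n => ?_
    simp only [Pi.mul_apply]
    rw [← mul_assoc, inv_mul_cancel₀ hβ', one_mul]
  have h3 := (ha.trans h2).isLittleO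
  exact h3.trans_isBigO (isBigO_const_mul_self _ _ _)

lemma tendsto_sum_div_of_lt_one (hβ : β < 1) (ha : a ~[atTop] fun n : ℕ => (n : ℝ) ^ (-β)) :
    Tendsto (fun m : ℕ => (∑ j ∈ Finset.range m, a j) / (m : ℝ) ^ (1 - β)) atTop
      (𝓝 (1 - β)⁻¹) := by
  have hβ' : 0 < 1 - β := by linarith
  have hs : ∀ m : ℕ, ∑ n ∈ Finset.range m, ((n + 1 : ℝ) ^ (1 - β) - (n : ℝ) ^ (1 - β)) =
      (m : ℝ) ^ (1 - β) := by
    intro m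
    have := Finset.sum_range_sub (fun n : ℕ => (n : ℝ) ^ (1 - β)) m
    simpa [Real.zero_rpow hβ'.ne'] using this
  have h1 := (isLittleO_sub_rpow hβ.ne ha).sum_range (fun n => sub_nonneg.2
    (Real.rpow_le_rpow (by positivity) (by linarith) hβ'.le)) (by
      simp_rw [hs]
      exact (tendsto_rpow_atTop hβ').comp tendsto_natCast_atTop_atTop)
  have h1' : (fun m : ℕ => ∑ j ∈ Finset.range m, a j - (1 - β)⁻¹ * (m : ℝ) ^ (1 - β)) =o[atTop]
      fun m : ℕ => (m : ℝ) ^ (1 - β) :=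
    h1.congr (fun m => by rw [Finset.sum_sub_distrib, ← Finset.mul_sum, hs]) hs
  have h2 := h1'.tendsto_div_nhds_zero.add_const (1 - β)⁻¹
  rw [zero_add] at h2
  refine h2.congr' ?_
  filter_upwards [eventually_gt_atTop 0] with m hm
  have hm0 : (0 : ℝ) < m := by exact_mod_cast hm
  have : (m : ℝ) ^ (1 - β) ≠ 0 := by positivity
  field_simp
  ring

lemma summable_of_isEquivalent (hβ : 1 < β) (ha : a ~[atTop] fun n : ℕ => (n : ℝ) ^ (-β)) :
    Summable a :=
  summable_of_isBigO_nat (Real.summable_nat_rpow.2 (by linarith)) ha.isBigO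

/-- Since the total is zero, a partial sum is minus the corresponding tail, of order `m ^ (1 - β) /
(β - 1)`. The two signs combine to the same constant as for `β < 1`, so both cases can be treated
together afterwards. -/
lemma tendsto_sum_div_of_one_lt (hβ : 1 < β) (ha : a ~[atTop] fun n : ℕ => (n : ℝ) ^ (-β))
    (h0 : ∑' i, a i = 0) :
    Tendsto (fun m : ℕ => (∑ j ∈ Finset.range m, a j) / (m : ℝ) ^ (1 - β)) atTop
      (𝓝 (1 - β)⁻¹) := by
  have hsum := summable_of_isEquivalent hβ ha
  rw [Metric.tendsto_atTop]
  intro ε hε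
  obtain ⟨N, hN⟩ := eventually_atTop.1
    ((isLittleO_sub_rpow hβ.ne' ha).bound (show 0 < ε / 2 by positivity))
  refine ⟨max N 1, fun m hm => ?_⟩
  have hmN : N ≤ m := (le_max_left _ _).trans hm
  have hm0 : (0 : ℝ) < m := by exact_mod_cast (lt_of_lt_of_le one_pos ((le_max_right _ _).trans hm))
  -- The decrements are taken with the sign that makes them nonnegative; starting at `m`, they sum
  -- to `m ^ (1 - β)`.
  set d : ℕ → ℝ := fun j => ((j + m : ℕ) : ℝ) ^ (1 - β) - ((j + m : ℕ) + 1 : ℝ) ^ (1 - β) with hd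
  have hd0 : ∀ j, 0 ≤ d j := fun j => by
    rw [hd, sub_nonneg]
    refine Real.rpow_le_rpow_of_nonpos ?_ (by linarith) (by linarith)
    push_cast
    positivity
  have hds : HasSum d ((m : ℝ) ^ (1 - β)) := by
    rw [hasSum_iff_tendsto_nat_of_nonneg hd0]
    have h1 : ∀ k, ∑ j ∈ Finset.range k, d j = (m : ℝ) ^ (1 - β) - ((k + m : ℕ) : ℝ) ^ (1 - β) := by
      intro k
      have := Finset.sum_range_sub' (fun j : ℕ => ((j + m : ℕ) : ℝ) ^ (1 - β)) k
      rw [zero_add] at this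
      rw [← this]
      refine Finset.sum_congr rfl fun j _ => ?_
      simp only [hd]
      congr 2
      push_cast
      ring
    simp_rw [h1]
    have h2 : Tendsto (fun k : ℕ => ((k + m : ℕ) : ℝ) ^ (1 - β)) atTop (𝓝 0) := by
      have h3 := (tendsto_rpow_neg_atTop (y := β - 1) (by linarith)).comp
        (tendsto_natCast_atTop_atTop.comp (tendsto_add_atTop_nat m))
      refine h3.congr fun k => ?_
      simp only [Function.comp]
      rw [neg_sub]
    simpa using h2.const_sub ((m : ℝ) ^ (1 - β))
  have htail : ∑ j ∈ Finset.range m, a j = -∑' j, a (j + m) := by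
    have := hsum.sum_add_tsum_nat_add m
    rw [h0] at this
    linarith
  have hb : ∀ j, ‖a (j + m) + (1 - β)⁻¹ * d j‖ ≤ ε / 2 * d j := by
    intro j
    have := hN (j + m) (by omega)
    rw [norm_sub_rev ((((j + m : ℕ) : ℝ) + 1) ^ (1 - β)), Real.norm_of_nonneg (hd0 j)] at this
    convert this using 2
    simp only [hd]
    ring
  have hsa : Summable fun j => a (j + m) := (summable_nat_add_iff m).2 hsum
  have h4 : ‖∑' j, (a (j + m) + (1 - β)⁻¹ * d j)‖ ≤ ε / 2 * (m : ℝ) ^ (1 - β) :=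
    tsum_of_norm_bounded (hds.mul_left (ε / 2)) hb
  rw [hsa.tsum_add (hds.summable.mul_left _), tsum_mul_left, hds.tsum_eq] at h4
  have hp : (0 : ℝ) < (m : ℝ) ^ (1 - β) := by positivity
  rw [htail, Real.dist_eq, neg_div, ← neg_add', abs_neg, div_add' _ _ _ hp.ne', abs_div,
    abs_of_pos hp, div_lt_iff₀ hp]
  rw [Real.norm_eq_abs] at h4
  nlinarith

lemma exists_abs_le_rpow (ha : a ~[atTop] fun n : ℕ => (n : ℝ) ^ (-β)) :
    ∃ K, 0 ≤ K ∧ ∀ j : ℕ, 0 < j → |a j| ≤ K * (j : ℝ) ^ (-β) := by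
  have hne : ∀ᶠ n : ℕ in atTop, (n : ℝ) ^ (-β) ≠ 0 := by
    filter_upwards [eventually_gt_atTop 0] with n hn
    have hn0 : (0 : ℝ) < n := by exact_mod_cast hn
    positivity
  obtain ⟨K, hK⟩ := ((isEquivalent_iff_tendsto_one hne).1 ha).abs.bddAbove_range
  refine ⟨K, (abs_nonneg _).trans (hK ⟨0, rfl⟩), fun j hj => ?_⟩
  have hj0 : (0 : ℝ) < j := by exact_mod_cast hj
  have hp : (0 : ℝ) < (j : ℝ) ^ (-β) := by positivity
  have h1 : |a j / (j : ℝ) ^ (-β)| ≤ K := hK ⟨j, rfl⟩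
  rwa [abs_div, abs_of_pos hp, div_le_iff₀ hp] at h1

lemma exists_abs_sum_le_rpow (h : Tendsto (fun m : ℕ => (∑ j ∈ Finset.range m, a j) /
      (m : ℝ) ^ (1 - β)) atTop (𝓝 (1 - β)⁻¹)) :
    ∃ K, 0 ≤ K ∧ ∀ m : ℕ, 0 < m → |∑ j ∈ Finset.range m, a j| ≤ K * (m : ℝ) ^ (1 - β) := by
  obtain ⟨K, hK⟩ := h.abs.bddAbove_range
  refine ⟨K, (abs_nonneg _).trans (hK ⟨0, rfl⟩), fun j hj => ?_⟩
  have hj0 : (0 : ℝ) < j := by exact_mod_cast hj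
  have hp : (0 : ℝ) < (j : ℝ) ^ (1 - β) := by positivity
  have h1 : |(∑ i ∈ Finset.range j, a i) / (j : ℝ) ^ (1 - β)| ≤ K := hK ⟨j, rfl⟩
  rwa [abs_div, abs_of_pos hp, div_le_iff₀ hp] at h1

end Asymptotic

/-! ### Limits of the filter sums under long-range and negative dependence -/

/-- The length of the filter on the scale that determines the growth of the filter sums. -/
def scale (γ₁ : ℝ) (n : ℕ) : Tapering → ℝ
  | .strong => (n : ℝ) ^ γ₁
  | .weak | .moderate => n

/-- The limit of the rescaled number of terms of the filter sums. -/
def limitScale (c x : ℝ) : Tapering → ℝ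
  | .strong => 1
  | .weak => x
  | .moderate => min x c

variable {γ₁ c : ℝ} {τ : Tapering}

lemma scale_pos {n : ℕ} (hn : 0 < n) : 0 < scale γ₁ n τ := by
  have hn0 : (0 : ℝ) < n := by exact_mod_cast hn
  cases τ <;> simp only [scale] <;> positivity

lemma Tapering.Admissible.pos (hτ : τ.Admissible c γ₁) : 0 < c ∧ 0 < γ₁ := by
  cases τ <;> simp only [Tapering.Admissible] at hτ
  · obtain ⟨h1, -, rfl⟩ := hτ; exact ⟨one_pos, h1⟩
  · obtain ⟨h1, rfl⟩ := hτ; exact ⟨one_pos, by linarith⟩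
  · obtain ⟨rfl, h1⟩ := hτ; exact ⟨h1, one_pos⟩

lemma growth_eq_scale_rpow (β γ₁ : ℝ) (n : ℕ) (τ : Tapering) {δ : Dependence} (hδ : δ ≠ .srd) :
    growth β γ₁ n τ δ = scale γ₁ n τ ^ (1 - β) := by
  cases δ <;> cases τ <;> simp only [growth, scale, ne_eq, not_true_eq_false] at * <;>
    rw [Real.rpow_mul (Nat.cast_nonneg n)]

lemma tendsto_level (hτ : τ.Admissible c γ₁) :
    Tendsto (fun n : ℕ => c * (n : ℝ) ^ γ₁) atTop atTop :=
  ((tendsto_rpow_atTop hτ.pos.2).comp tendsto_natCast_atTop_atTop).const_mul_atTop hτ.pos.1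

lemma tendsto_scale (hτ : τ.Admissible c γ₁) :
    Tendsto (fun n : ℕ => scale γ₁ n τ) atTop atTop := by
  cases τ <;> simp only [scale]
  · exact (tendsto_rpow_atTop hτ.pos.2).comp tendsto_natCast_atTop_atTop
  · exact tendsto_natCast_atTop_atTop
  · exact tendsto_natCast_atTop_atTop

lemma tendsto_floor_add_one_div {l : ℕ → ℝ} (hl : Tendsto l atTop atTop) :
    Tendsto (fun n => ((⌊l n⌋₊ : ℝ) + 1) / l n) atTop (𝓝 1) := by
  have h1 := ((tendsto_nat_floor_div_atTop (R := ℝ)).comp hl).add (tendsto_inv_atTop_zero.comp hl)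
  rw [add_zero] at h1
  refine h1.congr fun n => ?_
  simp only [Function.comp]
  rw [add_div, one_div]

/-- The number of terms is the smaller of the time distance, about `n x`, and the filter length,
about `c n ^ γ₁`. The second is negligible against the first for strong tapering, the reverse holds
for weak tapering, and they are comparable in the moderate case. -/
lemma tendsto_min_div_scale (hτ : τ.Admissible c γ₁) {m : ℕ → ℤ} {x : ℝ} (hx : 0 < x)
    (hm : Tendsto (fun n => (m n : ℝ) / n) atTop (𝓝 x)) :
    Tendsto (fun n : ℕ => ((min (m n + 1).toNat (⌊c * (n : ℝ) ^ γ₁⌋₊ + 1) : ℕ) : ℝ) /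
      scale γ₁ n τ) atTop (𝓝 (limitScale c x τ)) := by
  have hm1 : Tendsto (fun n => ((m n : ℝ) + 1) / n) atTop (𝓝 x) := by
    have := hm.add (tendsto_one_div_atTop_nhds_zero_nat (𝕜 := ℝ))
    rw [add_zero] at this
    exact this.congr fun n => (add_div _ _ _).symm
  have key : ∀ᶠ n : ℕ in atTop, min (((m n : ℝ) + 1) / scale γ₁ n τ)
      (((⌊c * (n : ℝ) ^ γ₁⌋₊ : ℝ) + 1) / scale γ₁ n τ) =
      ((min (m n + 1).toNat (⌊c * (n : ℝ) ^ γ₁⌋₊ + 1) : ℕ) : ℝ) / scale γ₁ n τ := by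
    filter_upwards [hm.eventually_const_lt hx, eventually_gt_atTop 0] with n hn hn0
    have hn1 : (0 : ℝ) < n := by exact_mod_cast hn0
    have h0 : (0 : ℝ) < m n := by
      by_contra hcon
      exact absurd hn (not_lt.2 (div_nonpos_of_nonpos_of_nonneg (not_lt.1 hcon) hn1.le))
    have h0' : 0 < m n := by exact_mod_cast h0
    rw [min_div_div_right (scale_pos hn0).le, Nat.cast_min]
    congr 2
    · have : ((m n + 1).toNat : ℤ) = m n + 1 := Int.toNat_of_nonneg (by omega)
      exact_mod_cast this.symm
    · push_cast; rfl
  refine Tendsto.congr' key ?_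
  cases τ with
  | strong =>
    obtain ⟨h1, h2, rfl⟩ := hτ
    simp only [scale, limitScale, one_mul]
    have hb := tendsto_floor_add_one_div ((tendsto_rpow_atTop h1).comp
      (tendsto_natCast_atTop_atTop (R := ℝ)))
    have ha : Tendsto (fun n : ℕ => ((m n : ℝ) + 1) / (n : ℝ) ^ γ₁) atTop atTop := by
      have h3 := hm1.pos_mul_atTop hx ((tendsto_rpow_atTop (sub_pos.2 h2)).comp
        (tendsto_natCast_atTop_atTop (R := ℝ)))
      refine h3.congr' ?_
      filter_upwards [eventually_gt_atTop 0] with n hn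
      have hn0 : (0 : ℝ) < n := by exact_mod_cast hn
      simp only [Function.comp]
      rw [Real.rpow_sub hn0, Real.rpow_one]
      field_simp
    refine hb.congr' ?_
    filter_upwards [ha.eventually_ge_atTop 2, hb.eventually_lt_const one_lt_two] with n h4 h5
    exact (min_eq_right (h5.le.trans h4)).symm
  | weak =>
    obtain ⟨h1, rfl⟩ := hτ
    simp only [scale, limitScale, one_mul]
    refine hm1.congr' ?_
    filter_upwards [hm1.eventually_lt_const (lt_add_one x), eventually_gt_atTop 0,
      ((tendsto_rpow_atTop (sub_pos.2 h1)).comp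
        (tendsto_natCast_atTop_atTop (R := ℝ))).eventually_ge_atTop (x + 1)] with n h4 hn h5
    have hn0 : (0 : ℝ) < n := by exact_mod_cast hn
    refine (min_eq_left (h4.le.trans (h5.trans ?_))).symm
    simp only [Function.comp]
    rw [Real.rpow_sub hn0, Real.rpow_one]
    gcongr
    exact (Nat.lt_floor_add_one _).le
  | moderate =>
    obtain ⟨rfl, h1⟩ := hτ
    simp only [scale, limitScale, Real.rpow_one]
    refine hm1.min ?_
    have hb := (tendsto_floor_add_one_div ((tendsto_natCast_atTop_atTop (R := ℝ)).const_mul_atTop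
      h1)).const_mul c
    rw [mul_one] at hb
    refine hb.congr fun n => ?_
    rw [mul_div_assoc', mul_div_mul_left _ _ h1.ne']

lemma div_scale_bounds (hτ : τ.Admissible c γ₁) {n : ℕ} (hn : 0 < n) {m : ℤ} (hm : 0 ≤ m) :
    ((min (m + 1).toNat (⌊c * (n : ℝ) ^ γ₁⌋₊ + 1) : ℕ) : ℝ) / scale γ₁ n τ ≤ ((m : ℝ) + 1) / n + 2 ∧
    min (((m : ℝ) + 1) / n) c ≤
      ((min (m + 1).toNat (⌊c * (n : ℝ) ^ γ₁⌋₊ + 1) : ℕ) : ℝ) / scale γ₁ n τ := by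
  have hn0 : (0 : ℝ) < n := by exact_mod_cast hn
  have hn1 : (1 : ℝ) ≤ n := by exact_mod_cast hn
  have hm0 : (0 : ℝ) ≤ m := by exact_mod_cast hm
  have hcast : (((m + 1).toNat : ℕ) : ℝ) = m + 1 := by
    have : ((m + 1).toNat : ℤ) = m + 1 := Int.toNat_of_nonneg (by omega)
    exact_mod_cast this
  rw [Nat.cast_min, hcast, Nat.cast_add_one, ← min_div_div_right (scale_pos hn).le]
  have hl : c * (n : ℝ) ^ γ₁ ≤ (⌊c * (n : ℝ) ^ γ₁⌋₊ : ℝ) + 1 := (Nat.lt_floor_add_one _).le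
  have hm1 : (0 : ℝ) ≤ (m + 1) / n := by positivity
  cases τ with
  | strong =>
    obtain ⟨h1, h2, rfl⟩ := hτ
    simp only [scale, one_mul] at *
    have hp : (0 : ℝ) < (n : ℝ) ^ γ₁ := by positivity
    have hp1 : (1 : ℝ) ≤ (n : ℝ) ^ γ₁ := Real.one_le_rpow hn1 h1.le
    have hp2 : (n : ℝ) ^ γ₁ ≤ n := by
      simpa using Real.rpow_le_rpow_of_exponent_le hn1 h2.le
    constructor
    · refine (min_le_right _ _).trans ?_
      have : ((⌊(n : ℝ) ^ γ₁⌋₊ : ℝ) + 1) / (n : ℝ) ^ γ₁ ≤ 2 := by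
        rw [div_le_iff₀ hp]
        linarith [Nat.floor_le hp.le]
      linarith
    · refine min_le_min ?_ ?_
      · gcongr
      · rwa [le_div_iff₀ hp, one_mul]
  | weak =>
    obtain ⟨h1, rfl⟩ := hτ
    simp only [scale, one_mul] at *
    refine ⟨(min_le_left _ _).trans (by linarith), min_le_min le_rfl ?_⟩
    rw [le_div_iff₀ hn0, one_mul]
    refine le_trans ?_ hl
    simpa using Real.rpow_le_rpow_of_exponent_le hn1 h1.le
  | moderate =>
    obtain ⟨rfl, h1⟩ := hτ
    simp only [scale, Real.rpow_one] at *
    refine ⟨(min_le_left _ _).trans (by linarith), min_le_min le_rfl ?_⟩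
    rwa [le_div_iff₀ hn0]

section Regular

variable {a : ℕ → ℝ} {β : ℝ}

lemma tendsto_filterSum_div (hτ : τ.Admissible c γ₁)
    (ha : Tendsto (fun m : ℕ => (∑ j ∈ Finset.range m, a j) / (m : ℝ) ^ (1 - β)) atTop
      (𝓝 (1 - β)⁻¹)) {m : ℕ → ℤ} {x : ℝ} (hx : x ≠ 0)
    (hm : Tendsto (fun n => (m n : ℝ) / n) atTop (𝓝 x)) :
    Tendsto (fun n : ℕ => filterSum a (c * (n : ℝ) ^ γ₁) (m n) / scale γ₁ n τ ^ (1 - β)) atTop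
      (𝓝 (if 0 < x then (1 - β)⁻¹ * limitScale c x τ ^ (1 - β) else 0)) := by
  split_ifs with hx0
  · have h1 := tendsto_min_div_scale hτ hx0 hm
    set q : ℕ → ℕ := fun n => min (m n + 1).toNat (⌊c * (n : ℝ) ^ γ₁⌋₊ + 1) with hq
    have hy : 0 < limitScale c x τ := by
      cases τ <;> simp only [limitScale]
      · exact one_pos
      · exact hx0
      · exact lt_min hx0 hτ.pos.1
    have hqt : Tendsto (fun n => (q n : ℝ)) atTop atTop := by
      refine (h1.pos_mul_atTop hy (tendsto_scale hτ)).congr' ?_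
      filter_upwards [eventually_gt_atTop 0] with n hn
      exact div_mul_cancel₀ _ (scale_pos hn).ne'
    have h2 := (ha.comp (tendsto_natCast_atTop_iff.1 hqt)).mul
      (h1.rpow_const (p := 1 - β) (Or.inl hy.ne'))
    refine h2.congr' ?_
    filter_upwards [eventually_gt_atTop 0, hqt.eventually_gt_atTop 0] with n hn hqn
    have hc : 0 ≤ c * (n : ℝ) ^ γ₁ := mul_nonneg hτ.pos.1.le (by positivity)
    simp only [Function.comp]
    rw [filterSum_eq a hc, Real.div_rpow hqn.le (scale_pos hn).le]
    have : (q n : ℝ) ^ (1 - β) ≠ 0 := (Real.rpow_pos_of_pos hqn _).ne'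
    rw [div_mul_div_comm, mul_comm ((q n : ℝ) ^ (1 - β)), mul_div_mul_right _ _ this]
  · have hx1 : x < 0 := lt_of_le_of_ne (not_lt.1 hx0) hx
    refine tendsto_const_nhds.congr' ?_
    filter_upwards [hm.eventually_lt_const hx1] with n hn
    have h0 : (m n : ℝ) < 0 := by
      by_contra hcon
      exact absurd hn (not_lt.2 (div_nonneg (not_lt.1 hcon) (Nat.cast_nonneg n)))
    rw [filterSum_of_neg _ _ (by exact_mod_cast h0), zero_div]

lemma exists_abs_filterSum_div_le (hτ : τ.Admissible c γ₁)
    (ha : Tendsto (fun m : ℕ => (∑ j ∈ Finset.range m, a j) / (m : ℝ) ^ (1 - β)) atTop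
      (𝓝 (1 - β)⁻¹)) (hβ : 0 < β) :
    ∃ K, 0 ≤ K ∧ ∀ n : ℕ, 0 < n → ∀ (m : ℤ) (x : ℝ), x ≠ 0 →
      (0 ≤ m → n * |x| ≤ m + 1 ∧ (m + 1 : ℝ) ≤ n * (|x| + 2)) →
      |filterSum a (c * (n : ℝ) ^ γ₁) m / scale γ₁ n τ ^ (1 - β)| ≤ K * (1 + |x| ^ (1 - β)) := by
  obtain ⟨K, hK, h⟩ := exists_abs_sum_le_rpow ha
  have hc0 := hτ.pos.1
  refine ⟨K * (1 + 4 ^ (1 - β) + c ^ (1 - β)), by positivity, fun n hn m x hx hm => ?_⟩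
  have hx0 : 0 < |x| := abs_pos.2 hx
  have hx1 : 0 < |x| ^ (1 - β) := by positivity
  by_cases hm0 : 0 ≤ m
  swap
  · rw [filterSum_of_neg _ _ (by omega), zero_div, abs_zero]
    positivity
  obtain ⟨hm1, hm2⟩ := hm hm0
  obtain ⟨hu, hl⟩ := div_scale_bounds hτ hn hm0
  have hn0 : (0 : ℝ) < n := by exact_mod_cast hn
  have hm3 : |x| ≤ ((m : ℝ) + 1) / n := by rw [le_div_iff₀ hn0]; linarith
  have hm4 : ((m : ℝ) + 1) / n ≤ |x| + 2 := by rw [div_le_iff₀ hn0]; linarith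
  have hc : 0 ≤ c * (n : ℝ) ^ γ₁ := mul_nonneg hτ.pos.1.le (by positivity)
  rw [filterSum_eq a hc]
  set q := min (m + 1).toNat (⌊c * (n : ℝ) ^ γ₁⌋₊ + 1) with hq
  have hq0 : 0 < q := by omega
  have hs := scale_pos (γ₁ := γ₁) (τ := τ) hn
  have h1 : |(∑ j ∈ Finset.range q, a j) / scale γ₁ n τ ^ (1 - β)| ≤
      K * ((q : ℝ) / scale γ₁ n τ) ^ (1 - β) := by
    rw [abs_div, abs_of_pos (Real.rpow_pos_of_pos hs _), Real.div_rpow (Nat.cast_nonneg _) hs.le,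
      mul_div_assoc']
    exact div_le_div_of_nonneg_right (h q hq0) (Real.rpow_pos_of_pos hs _).le
  have h2 : ((q : ℝ) / scale γ₁ n τ) ^ (1 - β) ≤ |x| ^ (1 - β) + 4 ^ (1 - β) + c ^ (1 - β) := by
    have hp4 : (0 : ℝ) < 4 ^ (1 - β) := by positivity
    have hpc : (0 : ℝ) < c ^ (1 - β) := by positivity
    -- For `β ≤ 1` the power is increasing and subadditive, so the upper bound `|x| + 4` is used,
    -- `4` collecting the two rounding allowances. For `β ≥ 1` it is decreasing, and the lower bound
    -- `min |x| c` is the relevant one.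
    rcases le_total β 1 with hb | hb
    · have h3 : ((q : ℝ) / scale γ₁ n τ) ^ (1 - β) ≤ (|x| + 4) ^ (1 - β) :=
        Real.rpow_le_rpow (by positivity) (by linarith) (by linarith)
      have h4 := Real.rpow_add_le_add_rpow (p := 1 - β) hx0.le (by norm_num : (0 : ℝ) ≤ 4)
        (by linarith) (by linarith)
      linarith
    · have h3 : ((q : ℝ) / scale γ₁ n τ) ^ (1 - β) ≤ (min |x| c) ^ (1 - β) :=
        Real.rpow_le_rpow_of_nonpos (lt_min hx0 hc0) ((min_le_min hm3 le_rfl).trans hl)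
          (by linarith)
      rcases min_choice |x| c with h5 | h5 <;> rw [h5] at h3 <;> linarith
  refine h1.trans ((mul_le_mul_of_nonneg_left h2 hK).trans ?_)
  rw [mul_assoc]
  refine mul_le_mul_of_nonneg_left ?_ hK
  have hp4 : (0 : ℝ) < 4 ^ (1 - β) := by positivity
  have hpc : (0 : ℝ) < c ^ (1 - β) := by positivity
  nlinarith [mul_pos hp4 hx1, mul_pos hpc hx1]

end Regular

/-! ### The normalized weights and their bounds -/

lemma tendsto_floor_mul_div (u : ℝ) :
    Tendsto (fun n : ℕ => (⌊(n : ℝ) * u⌋ : ℝ) / n) atTop (𝓝 u) := by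
  have h0 := tendsto_one_div_atTop_nhds_zero_nat (𝕜 := ℝ)
  have h1 : Tendsto (fun n : ℕ => u - 1 / (n : ℝ)) atTop (𝓝 u) := by simpa using h0.const_sub u
  refine tendsto_of_tendsto_of_tendsto_of_le_of_le' h1 tendsto_const_nhds ?_ ?_ <;>
  filter_upwards [eventually_gt_atTop 0] with n hn <;>
  have hn0 : (0 : ℝ) < n := by exact_mod_cast hn
  · rw [le_div_iff₀ hn0, sub_mul, div_mul_cancel₀ _ hn0.ne']
    linarith [Int.lt_floor_add_one ((n : ℝ) * u)]
  · rw [div_le_iff₀ hn0, mul_comm u]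
    exact Int.floor_le _

lemma natCast_floor_eq {x : ℝ} (hx : 0 ≤ x) : ((⌊x⌋₊ : ℤ)) = ⌊x⌋ := Int.natCast_floor_eq_floor hx

/-- The weight of the innovation `ξ i` in `∑_{k=0}^{⌊nt⌋} X_k`, divided by the growth of the
filter sums. -/
def normalizedWeight (a : ℕ → ℝ) (β γ₁ c : ℝ) (τ : Tapering) (δ : Dependence) (t : ℝ) (n : ℕ)
    (i : ℤ) : ℝ :=
  sumWeight a (c * (n : ℝ) ^ γ₁) ⌊(n : ℝ) * t⌋₊ i / growth β γ₁ n τ δ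

variable {a : ℕ → ℝ} {α β γ₁ c t : ℝ} {τ : Tapering} {δ : Dependence}

lemma measurable_normalizedWeight (n : ℕ) :
    Measurable fun u : ℝ => normalizedWeight a β γ₁ c τ δ t n ⌊(n : ℝ) * u⌋ :=
  (measurable_of_countable (normalizedWeight a β γ₁ c τ δ t n)).comp
    (Int.measurable_floor.comp (measurable_const_mul _))

lemma normalizedWeight_eq_zero_of_notMem (hc : 0 ≤ c) {n N : ℕ} (hN : ⌊(n : ℝ) * t⌋₊ ≤ N) {i : ℤ}
    (hi : i ∉ Finset.Icc (-(⌊c * (n : ℝ) ^ γ₁⌋₊ : ℤ)) N) :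
    normalizedWeight a β γ₁ c τ δ t n i = 0 := by
  rw [normalizedWeight, sumWeight_eq_zero_of_notMem a (by positivity) hN hi, zero_div]

lemma integrable_normalizedWeight (hα : 0 < α) (hc : 0 ≤ c) {n : ℕ} (hn : 0 < n) :
    Integrable fun u : ℝ => |normalizedWeight a β γ₁ c τ δ t n ⌊(n : ℝ) * u⌋| ^ α :=
  (integral_comp_floor hn (fun i => |normalizedWeight a β γ₁ c τ δ t n i| ^ α) _ fun i hi => by
    rw [normalizedWeight_eq_zero_of_notMem hc le_rfl hi, abs_zero, Real.zero_rpow hα.ne']).1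

lemma abs_sumWeight_le (a : ℕ → ℝ) (l : ℝ) (N : ℕ) {i : ℤ} (hi : i ≤ 0) :
    |sumWeight a l N i| ≤ ∑ k ∈ Finset.range (N + 1), |taperedFilter a l (k + (-i).toNat)| := by
  rw [sumWeight_eq_sum]
  refine (Finset.abs_sum_le_sum_abs _ _).trans (Finset.sum_le_sum fun k _ => le_of_eq ?_)
  rw [if_pos (by omega)]
  congr 3
  omega

lemma abs_taperedFilter_le (a : ℕ → ℝ) (l : ℝ) (j : ℕ) : |taperedFilter a l j| ≤ |a j| := by
  rw [taperedFilter]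
  split_ifs
  · exact le_rfl
  · rw [abs_zero]; exact abs_nonneg _

lemma normalizedWeight_of_lt (ht : 0 ≤ t) {n : ℕ} (hn : 0 < n) {u : ℝ} (hu : t + 1 < u) :
    normalizedWeight a β γ₁ c τ δ t n ⌊(n : ℝ) * u⌋ = 0 := by
  have hn1 : (1 : ℝ) ≤ n := by exact_mod_cast hn
  rw [normalizedWeight, sumWeight_of_gt _ _ (by positivity), zero_div]
  rw [natCast_floor_eq (by positivity), Int.lt_iff_add_one_le, Int.le_floor]
  push_cast
  nlinarith [Int.floor_le ((n : ℝ) * t)]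

/-- Under strong or moderate tapering the filter does not reach this far back. Under weak tapering
the weight is a block of at most `n (t + 1)` coefficients with indices at least `n |u|`, and
dividing by `n ^ (1 - β)` leaves `|u| ^ (-β)`. Bounding the two filter sums separately would give
`|u| ^ (1 - β)`, which is not in `L^α` at infinity. -/
lemma abs_normalizedWeight_far (hτ : τ.Admissible c γ₁) (hδ : δ ≠ .srd) (ht : 0 ≤ t) (hβ : 0 < β)
    {K : ℝ} (hK : 0 ≤ K) (ha : ∀ j : ℕ, 0 < j → |a j| ≤ K * (j : ℝ) ^ (-β)) {n : ℕ} (hn : 0 < n)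
    {u : ℝ} (hu : u < -(c + 2)) :
    |normalizedWeight a β γ₁ c τ δ t n ⌊(n : ℝ) * u⌋| ≤ K * (t + 1) * |u| ^ (-β) := by
  have hn0 : (0 : ℝ) < n := by exact_mod_cast hn
  have hn1 : (1 : ℝ) ≤ n := by exact_mod_cast hn
  have hc := hτ.pos.1
  have hu0 : 0 < |u| := abs_pos.2 (by linarith)
  have hfl := Int.floor_le ((n : ℝ) * u)
  have hsat : c * (n : ℝ) ^ γ₁ ≤ c * n → normalizedWeight a β γ₁ c τ δ t n ⌊(n : ℝ) * u⌋ = 0 := by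
    intro h
    rw [normalizedWeight, sumWeight_of_le a (by positivity) (by positivity), zero_div]
    rw [natCast_floor_eq (by positivity)]
    have h1 : (⌊c * (n : ℝ) ^ γ₁⌋ : ℝ) ≤ -1 - ⌊(n : ℝ) * u⌋ := by
      nlinarith [Int.floor_le (c * (n : ℝ) ^ γ₁)]
    exact_mod_cast h1
  have h0 : 0 ≤ K * (t + 1) * |u| ^ (-β) := by positivity
  have hweak : growth β γ₁ n τ δ = (n : ℝ) ^ (1 - β) →
      |normalizedWeight a β γ₁ c τ δ t n ⌊(n : ℝ) * u⌋| ≤ K * (t + 1) * |u| ^ (-β) := by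
    intro hg
    have hi0 : (⌊(n : ℝ) * u⌋ : ℝ) ≤ 0 := by nlinarith
    have hi : ⌊(n : ℝ) * u⌋ ≤ 0 := by exact_mod_cast hi0
    have hcast : (((-⌊(n : ℝ) * u⌋).toNat : ℕ) : ℝ) = -⌊(n : ℝ) * u⌋ := by
      have : ((-⌊(n : ℝ) * u⌋).toNat : ℤ) = -⌊(n : ℝ) * u⌋ := Int.toNat_of_nonneg (by omega)
      exact_mod_cast this
    have hlow : n * |u| ≤ (((-⌊(n : ℝ) * u⌋).toNat : ℕ) : ℝ) := by
      rw [hcast, abs_of_neg (by linarith)]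
      linarith
    have hpos : 0 < (n : ℝ) * |u| := by positivity
    have h1 : |sumWeight a (c * (n : ℝ) ^ γ₁) ⌊(n : ℝ) * t⌋₊ ⌊(n : ℝ) * u⌋| ≤
        ∑ _k ∈ Finset.range (⌊(n : ℝ) * t⌋₊ + 1), K * ((n : ℝ) * |u|) ^ (-β) := by
      refine (abs_sumWeight_le _ _ _ hi).trans (Finset.sum_le_sum fun k _ => ?_)
      have h2 : (n : ℝ) * |u| ≤ ((k + (-⌊(n : ℝ) * u⌋).toNat : ℕ) : ℝ) := by
        push_cast
        linarith [(Nat.cast_nonneg k : (0 : ℝ) ≤ k)]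
      have h3 : 0 < k + (-⌊(n : ℝ) * u⌋).toNat := by exact_mod_cast hpos.trans_le h2
      refine (abs_taperedFilter_le _ _ _).trans ((ha _ h3).trans ?_)
      exact mul_le_mul_of_nonneg_left (Real.rpow_le_rpow_of_nonpos hpos h2 (by linarith)) hK
    rw [Finset.sum_const, Finset.card_range, nsmul_eq_mul, Nat.cast_add_one] at h1
    have h4 : (⌊(n : ℝ) * t⌋₊ : ℝ) + 1 ≤ n * (t + 1) := by
      have := Nat.floor_le (show 0 ≤ (n : ℝ) * t by positivity)
      linarith
    have h5 : 0 < (n : ℝ) ^ (-β) := by positivity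
    have h6 : (n : ℝ) ^ (1 - β) = n * (n : ℝ) ^ (-β) := by
      rw [sub_eq_add_neg, Real.rpow_add hn0, Real.rpow_one]
    rw [normalizedWeight, hg, abs_div, abs_of_pos (by positivity : (0 : ℝ) < (n : ℝ) ^ (1 - β)),
      div_le_iff₀ (by positivity), h6]
    refine h1.trans ((mul_le_mul_of_nonneg_right h4 (by positivity)).trans (le_of_eq ?_))
    rw [Real.mul_rpow hn0.le hu0.le]
    ring
  cases τ with
  | strong =>
    obtain ⟨h1, h2, rfl⟩ := hτ
    rw [hsat, abs_zero]
    · exact h0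
    · simpa using Real.rpow_le_rpow_of_exponent_le hn1 h2.le
  | weak =>
    refine hweak ?_
    cases δ <;> simp [growth] at *
  | moderate =>
    obtain ⟨rfl, h1⟩ := hτ
    rw [hsat, abs_zero]
    · exact h0
    · simp

lemma exists_abs_normalizedWeight_le (hτ : τ.Admissible c γ₁) (hδ : δ ≠ .srd)
    (ha : Tendsto (fun m : ℕ => (∑ j ∈ Finset.range m, a j) / (m : ℝ) ^ (1 - β)) atTop
      (𝓝 (1 - β)⁻¹)) (hβ : 0 < β) :
    ∃ K, 0 ≤ K ∧ ∀ t, 0 ≤ t → ∀ n : ℕ, 0 < n → ∀ u : ℝ, u ≠ 0 → u ≠ t →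
      |normalizedWeight a β γ₁ c τ δ t n ⌊(n : ℝ) * u⌋| ≤
        K * (2 + |t - u| ^ (1 - β) + |u| ^ (1 - β)) := by
  obtain ⟨K, hK, h⟩ := exists_abs_filterSum_div_le hτ ha hβ
  refine ⟨K, hK, fun t ht n hn u hu hut => ?_⟩
  have hn1 : (1 : ℝ) ≤ n := by exact_mod_cast hn
  have hb1 := Int.floor_le ((n : ℝ) * u)
  have hb2 := Int.lt_floor_add_one ((n : ℝ) * u)
  have hb3 := Int.floor_le ((n : ℝ) * t)
  have hb4 := Int.lt_floor_add_one ((n : ℝ) * t)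
  have h1 := h n hn (⌊(n : ℝ) * t⌋₊ - ⌊(n : ℝ) * u⌋) (t - u) (sub_ne_zero.2 hut.symm) (by
    rw [natCast_floor_eq (by positivity)]
    intro hm
    have hm' : (0 : ℝ) ≤ ⌊(n : ℝ) * t⌋ - ⌊(n : ℝ) * u⌋ := by exact_mod_cast hm
    push_cast
    -- If `t < u`, nonnegativity of the index forces both floors to agree, hence `n |t - u| < 1`;
    -- the rounding allowance covers this.
    rcases abs_cases (t - u) with ⟨he, hs⟩ | ⟨he, hs⟩ <;> rw [he] <;> constructor <;> nlinarith)
  have h2 := h n hn (-1 - ⌊(n : ℝ) * u⌋) (-u) (neg_ne_zero.2 hu) (by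
    intro hm
    have hm' : (0 : ℝ) ≤ -1 - ⌊(n : ℝ) * u⌋ := by exact_mod_cast hm
    push_cast
    rcases abs_cases (-u) with ⟨he, hs⟩ | ⟨he, hs⟩ <;> rw [he] <;> constructor <;> nlinarith)
  rw [abs_neg] at h2
  rw [normalizedWeight, sumWeight, sub_div, growth_eq_scale_rpow _ _ _ _ hδ]
  refine (abs_sub _ _).trans ?_
  linarith

/-- The kernels of all three taperings are differences of one limit profile, matching the weights,
which are differences of filter sums. In the moderate case the indicator is automatic to the left of
`-c`: both terms equal `c ^ (1 - β)` there and cancel. -/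
lemma kernel_eq_sub (hβ : β ≠ 1) (hδ : δ ≠ .srd) (hc : 0 < c) (ht : 0 ≤ t) {u : ℝ}
    (hut : u ≠ t) :
    kernel a β c t u τ δ =
      (if 0 < t - u then (1 - β)⁻¹ * limitScale c (t - u) τ ^ (1 - β) else 0) -
      (if 0 < -u then (1 - β)⁻¹ * limitScale c (-u) τ ^ (1 - β) else 0) := by
  have h0 : (0 : ℝ) ^ (1 - β) = 0 := Real.zero_rpow (sub_ne_zero.2 hβ.symm)
  have hstrong : (1 - β)⁻¹ * (Set.Ico 0 t).indicator 1 u =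
      (if 0 < t - u then (1 - β)⁻¹ * limitScale c (t - u) .strong ^ (1 - β) else 0) -
      (if 0 < -u then (1 - β)⁻¹ * limitScale c (-u) .strong ^ (1 - β) else 0) := by
    simp only [limitScale, Real.one_rpow, Set.indicator, Set.mem_Ico, Pi.one_apply]
    split_ifs <;> first | (exfalso; grind) | simp
  have hweak : (1 - β)⁻¹ * ((max (t - u) 0) ^ (1 - β) - (max (-u) 0) ^ (1 - β)) =
      (if 0 < t - u then (1 - β)⁻¹ * limitScale c (t - u) .weak ^ (1 - β) else 0) -
      (if 0 < -u then (1 - β)⁻¹ * limitScale c (-u) .weak ^ (1 - β) else 0) := by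
    simp only [limitScale]
    split_ifs with h1 h2 h2
    · rw [max_eq_left h1.le, max_eq_left h2.le]; ring
    · rw [max_eq_left h1.le, max_eq_right (not_lt.1 h2), h0]; ring
    · exfalso; linarith
    · rw [max_eq_right (not_lt.1 h1), max_eq_right (not_lt.1 h2), h0]; ring
  have hmod : (1 - β)⁻¹ * (Set.Icc (-c) t).indicator 1 u *
        ((min (t - u) c) ^ (1 - β) - (max (-u) 0) ^ (1 - β)) =
      (if 0 < t - u then (1 - β)⁻¹ * limitScale c (t - u) .moderate ^ (1 - β) else 0) -
      (if 0 < -u then (1 - β)⁻¹ * limitScale c (-u) .moderate ^ (1 - β) else 0) := by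
    simp only [limitScale, Set.indicator, Set.mem_Icc, Pi.one_apply]
    by_cases h1 : u ≤ t
    · have h1' : 0 < t - u := sub_pos.2 (lt_of_le_of_ne h1 hut)
      by_cases h2 : -c ≤ u
      · rw [if_pos ⟨h2, h1⟩, if_pos h1', min_eq_left (by linarith : -u ≤ c)]
        split_ifs with h3
        · rw [max_eq_left h3.le]; ring
        · rw [max_eq_right (not_lt.1 h3), h0]; ring
      · rw [if_neg (by tauto), if_pos h1', if_pos (by linarith), min_eq_right (by linarith),
          min_eq_right (by linarith)]
        ring
    · rw [if_neg (by tauto), if_neg (by linarith), if_neg (by linarith)]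
      ring
  cases δ with
  | srd => exact absurd rfl hδ
  | lrd => cases τ <;> simp only [kernel] <;> assumption
  | nd => cases τ <;> simp only [kernel] <;> assumption

/-! ### Integrability of the dominating function -/

lemma memLp_of_integrable_rpow (hα : 0 < α) {f : ℝ → ℝ} (hf : Measurable f)
    (h : Integrable fun u => |f u| ^ α) : MemLp f (ENNReal.ofReal α) volume := by
  rw [← integrable_norm_rpow_iff hf.aestronglyMeasurable (by simpa using hα) ENNReal.ofReal_ne_top,
    ENNReal.toReal_ofReal hα.le]
  exact h

lemma intervalIntegrable_abs_rpow {r : ℝ} (hr : -1 < r) (x y : ℝ) :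
    IntervalIntegrable (fun u : ℝ => |u| ^ r) volume x y := by
  have h1 : ∀ b : ℝ, 0 ≤ b → IntervalIntegrable (fun u : ℝ => |u| ^ r) volume 0 b := by
    intro b hb
    refine (intervalIntegral.intervalIntegrable_rpow' (a := 0) (b := b) hr).congr ?_
    intro u hu
    rw [Set.uIoc_of_le hb] at hu
    simp only [abs_of_pos hu.1]
  have h2 : ∀ b : ℝ, IntervalIntegrable (fun u : ℝ => |u| ^ r) volume 0 b := by
    intro b
    rcases le_total 0 b with hb | hb
    · exact h1 b hb
    · have := (h1 (-b) (by linarith)).comp_sub_left 0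
      simpa using this
  exact (h2 x).symm.trans (h2 y)

lemma memLp_indicator_abs_rpow (hα : 0 < α) {r : ℝ} (hr : -1 < r * α) (s A B : ℝ) (hAB : A ≤ B) :
    MemLp ((Set.Ioc A B).indicator fun u : ℝ => |s - u| ^ r) (ENNReal.ofReal α) volume := by
  refine memLp_of_integrable_rpow hα (Measurable.indicator (by fun_prop) measurableSet_Ioc) ?_
  have h1 := (intervalIntegrable_abs_rpow hr (s - A) (s - B)).comp_sub_left s
  simp only [sub_sub_cancel] at h1
  rw [intervalIntegrable_iff_integrableOn_Ioc_of_le hAB, ← integrable_indicator_iff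
    measurableSet_Ioc] at h1
  refine h1.congr (Eventually.of_forall fun u => ?_)
  by_cases hu : u ∈ Set.Ioc A B
  · simp only [Set.indicator_of_mem hu]
    rw [abs_of_nonneg (Real.rpow_nonneg (abs_nonneg (s - u)) r), Real.rpow_mul (abs_nonneg _)]
  · simp only [Set.indicator_of_notMem hu, abs_zero, Real.zero_rpow hα.ne']

lemma memLp_indicator_Iic_abs_rpow (hα : 0 < α) {r : ℝ} (hr : r * α < -1) {A : ℝ} (hA : A < 0) :
    MemLp ((Set.Iic A).indicator fun u : ℝ => |u| ^ r) (ENNReal.ofReal α) volume := by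
  refine memLp_of_integrable_rpow hα (Measurable.indicator (by fun_prop) measurableSet_Iic) ?_
  have h1 := integrableOn_Ioi_rpow_of_lt hr (neg_pos.2 hA)
  have h2 := h1.comp_neg_Iio
  rw [← integrableOn_Iic_iff_integrableOn_Iio, ← integrable_indicator_iff
    measurableSet_Iic] at h2
  refine h2.congr (Eventually.of_forall fun u => ?_)
  by_cases hu : u ∈ Set.Iic A
  · simp only [Set.indicator_of_mem hu]
    rw [abs_of_nonneg (Real.rpow_nonneg (abs_nonneg u) r), ← Real.rpow_mul (abs_nonneg _),
      abs_of_neg (lt_of_le_of_lt hu hA)]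
  · simp only [Set.indicator_of_notMem hu, abs_zero, Real.zero_rpow hα.ne']

/-- The dominating function has singularities of order `1 - β` at `0` and `t`, admissible because
`(1 - β) α > -1`, and decays like `|u| ^ (-β)` on the far left, admissible because `β α > 1`. It
works on the whole line, so the exceptional part is empty. -/
lemma exists_dominatedConv (hα : 0 < α) (hτ : τ.Admissible c γ₁) (hδ : δ ≠ .srd)
    (hequiv : a ~[atTop] fun n : ℕ => (n : ℝ) ^ (-β))
    (ha : Tendsto (fun m : ℕ => (∑ j ∈ Finset.range m, a j) / (m : ℝ) ^ (1 - β)) atTop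
      (𝓝 (1 - β)⁻¹)) (hβ : 0 < β) (hβ1 : β ≠ 1) (h1 : -1 < (1 - β) * α) (h2 : -β * α < -1)
    (ht : 0 ≤ t) :
    ∃ g : ℝ → ℝ, Measurable g ∧ DominatedConv α Set.univ g
      (fun n u => normalizedWeight a β γ₁ c τ δ t n ⌊(n : ℝ) * u⌋)
      (fun u => kernel a β c t u τ δ) := by
  obtain ⟨K₁, hK₁, hK₁'⟩ := exists_abs_le_rpow hequiv
  obtain ⟨K, hK, hK'⟩ := exists_abs_normalizedWeight_le hτ hδ ha hβ
  have hc := hτ.pos.1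
  set I := Set.Ioc (-(c + 3)) (t + 1)
  set J := Set.Iic (-(c + 3))
  -- The constant term is written as a power with exponent zero so that one integrability lemma
  -- covers all terms on the bounded interval.
  set g : ℝ → ℝ := fun u => K * (2 * I.indicator (fun u => |0 - u| ^ (0 : ℝ)) u +
    I.indicator (fun u => |t - u| ^ (1 - β)) u + I.indicator (fun u => |0 - u| ^ (1 - β)) u) +
    K₁ * (t + 1) * J.indicator (fun u => |u| ^ (-β)) u with hg
  have hgm : MemLp g (ENNReal.ofReal α) volume := by
    have hle : -(c + 3) ≤ t + 1 := by linarith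
    have m1 := memLp_indicator_abs_rpow hα (r := 0) (by linarith) 0 _ _ hle
    have m2 := memLp_indicator_abs_rpow hα h1 t _ _ hle
    have m3 := memLp_indicator_abs_rpow hα h1 0 _ _ hle
    have m4 := memLp_indicator_Iic_abs_rpow hα h2 (A := -(c + 3)) (by linarith)
    exact ((((m1.const_mul 2).add m2).add m3).const_mul K).add (m4.const_mul (K₁ * (t + 1)))
  have hmeas : Measurable g := by
    have hI : MeasurableSet I := measurableSet_Ioc
    have hJ : MeasurableSet J := measurableSet_Iic
    refine (((((Measurable.indicator ?_ hI).const_mul 2).add (Measurable.indicator ?_ hI)).add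
      (Measurable.indicator ?_ hI)).const_mul K).add ((Measurable.indicator ?_ hJ).const_mul _) <;>
    fun_prop
  have hne : ∀ᵐ u : ℝ, u ≠ 0 ∧ u ≠ t := by
    have h3 : ∀ x : ℝ, ∀ᵐ u : ℝ, u ≠ x := fun x => by
      simp [ae_iff]
    exact (h3 0).and (h3 t)
  refine ⟨g, hmeas, fun n => measurable_normalizedWeight n, ?_, ?_, ?_, ?_, ?_, ?_⟩
  · filter_upwards [eventually_gt_atTop 0] with n hn
    exact integrable_normalizedWeight hα hc.le hn
  · filter_upwards [hne] with u ⟨hu, hut⟩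
    rw [kernel_eq_sub hβ1 hδ hc ht hut]
    have h3 := tendsto_floor_mul_div u
    have h4 := tendsto_floor_mul_div t
    have h5 : Tendsto (fun n : ℕ => ((((⌊(n : ℝ) * t⌋₊ : ℤ) - ⌊(n : ℝ) * u⌋ : ℤ)) : ℝ) / n) atTop
        (𝓝 (t - u)) := by
      refine (h4.sub h3).congr fun n => ?_
      rw [natCast_floor_eq (by positivity), Int.cast_sub, sub_div]
    have h6 : Tendsto (fun n : ℕ => ((-1 - ⌊(n : ℝ) * u⌋ : ℤ) : ℝ) / n) atTop (𝓝 (-u)) := by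
      have := (tendsto_one_div_atTop_nhds_zero_nat (𝕜 := ℝ)).neg.sub h3
      rw [neg_zero, zero_sub] at this
      refine this.congr fun n => ?_
      push_cast
      ring
    have h7 := (tendsto_filterSum_div hτ ha (sub_ne_zero.2 hut.symm) h5).sub
      (tendsto_filterSum_div hτ ha (neg_ne_zero.2 hu) h6)
    refine h7.congr fun n => ?_
    rw [normalizedWeight, sumWeight, sub_div, growth_eq_scale_rpow _ _ _ _ hδ]
  · filter_upwards [eventually_gt_atTop 0] with n hn
    filter_upwards [hne] with u ⟨hu, hut⟩ _
    have hj := hK' t ht n hn u hu hut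
    simp only [hg]
    by_cases hI : u ∈ I
    · have hJ : u ∉ J := not_le.2 hI.1
      simp only [Set.indicator_of_mem hI, Set.indicator_of_notMem hJ, Real.rpow_zero, zero_sub,
        abs_neg]
      linarith
    · simp only [Set.indicator_of_notMem hI]
      by_cases hJ : u ∈ J
      · simp only [Set.indicator_of_mem hJ]
        have hu1 : u ≤ -(c + 3) := hJ
        have := abs_normalizedWeight_far (δ := δ) hτ hδ ht hβ hK₁ hK₁' hn
          (show u < -(c + 2) by linarith)
        linarith
      · simp only [Set.indicator_of_notMem hJ]
        rw [normalizedWeight_of_lt ht hn (by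
          by_contra hcon
          exact hI ⟨not_le.1 hJ, not_lt.1 hcon⟩)]
        simp
  · exact (integrable_abs_rpow hα hgm).integrableOn
  · simp
  · simp

/-! ### The case of short-range dependence -/

section ShortRange

variable {a : ℕ → ℝ} {α β γ₁ c t : ℝ} {τ : Tapering}

lemma growth_srd (β γ₁ : ℝ) (n : ℕ) (τ : Tapering) : growth β γ₁ n τ .srd = 1 := by
  cases τ <;> rfl

lemma kernel_srd (a : ℕ → ℝ) (β c t u : ℝ) (τ : Tapering) :
    kernel a β c t u τ .srd = (∑' k, a k) * (Set.Ico 0 t).indicator 1 u := by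
  cases τ <;> rfl

lemma tendsto_inv_mul_sum {u : ℕ → ℝ} (hu0 : ∀ k, 0 ≤ u k) (hu : Tendsto u atTop (𝓝 0))
    {M : ℕ → ℕ} {C : ℕ} (hM : ∀ᶠ n in atTop, M n ≤ C * n) :
    Tendsto (fun n : ℕ => (n : ℝ)⁻¹ * ∑ k ∈ Finset.range (M n), u k) atTop (𝓝 0) := by
  have hM' : ∀ᶠ n in atTop, M n ≤ (C + 1) * n := hM.mono fun n hn => by linarith
  have h1 := (hu.cesaro.comp (tendsto_id.const_mul_atTop' (Nat.succ_pos C))).const_mul (C + 1 : ℝ)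
  rw [mul_zero] at h1
  refine squeeze_zero' (Eventually.of_forall fun n => mul_nonneg (by positivity)
    (Finset.sum_nonneg fun k _ => hu0 k)) ?_ h1
  filter_upwards [hM', eventually_gt_atTop 0] with n hn hn0
  have hn1 : (0 : ℝ) < n := by exact_mod_cast hn0
  simp only [Function.comp, id]
  rw [← mul_assoc, Nat.cast_mul, mul_inv, ← mul_assoc, Nat.succ_eq_add_one, Nat.cast_add_one,
    mul_inv_cancel₀ (by positivity), one_mul]
  refine mul_le_mul_of_nonneg_left ?_ (by positivity)
  exact Finset.sum_le_sum_of_subset_of_nonneg (Finset.range_mono hn) fun k _ _ => hu0 k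

lemma sum_rpow_le_sum_rpow {p : ℝ} (hp : 0 < p) (hp1 : p ≤ 1) {f : ℕ → ℝ} (hf : ∀ i, 0 ≤ f i)
    (s : Finset ℕ) : (∑ i ∈ s, f i) ^ p ≤ ∑ i ∈ s, f i ^ p := by
  induction s using Finset.cons_induction with
  | empty => simp [Real.zero_rpow hp.ne']
  | cons i s hi ih =>
    rw [Finset.sum_cons, Finset.sum_cons]
    have := Real.rpow_add_le_add_rpow (hf i) (Finset.sum_nonneg fun j (_ : j ∈ s) => hf j) hp.le hp1
    linarith

lemma sum_add_le_tsum {b : ℕ → ℝ} (hb0 : ∀ i, 0 ≤ b i) (hb : Summable b) (N k : ℕ) :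
    ∑ d ∈ Finset.range N, b (d + k) ≤ ∑' d, b (d + k) :=
  ((summable_nat_add_iff k).2 hb).sum_le_tsum _ fun _ _ => hb0 _

lemma tsum_add_le_tsum {b : ℕ → ℝ} (hb0 : ∀ i, 0 ≤ b i) (hb : Summable b) (k : ℕ) :
    ∑' d, b (d + k) ≤ ∑' d, b d := by
  rw [← hb.sum_add_tsum_nat_add k]
  linarith [Finset.sum_nonneg fun i (_ : i ∈ Finset.range k) => hb0 i]

/-- For `α < 1` subadditivity of the power allows `b = |a| ^ α`, which is where summability of that
sequence enters. For `α ≥ 1` one factor of the block sum is kept and the others are bounded by the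
total sum. -/
lemma exists_summable_sum_rpow_le (hα : 0 < α) (ha : Summable fun i => |a i|)
    (hwd : α < 1 → Summable fun i => |a i| ^ α) :
    ∃ b : ℕ → ℝ, (∀ i, 0 ≤ b i) ∧ Summable b ∧ ∀ N k : ℕ,
      (∑ d ∈ Finset.range N, |a (d + k)|) ^ α ≤ ∑ d ∈ Finset.range N, b (d + k) := by
  rcases lt_or_ge α 1 with h | h
  · exact ⟨fun i => |a i| ^ α, fun i => by positivity, hwd h, fun N k =>
      sum_rpow_le_sum_rpow hα h.le (fun i => abs_nonneg (a (i + k))) _⟩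
  · have hS : 0 ≤ ∑' i, |a i| := tsum_nonneg fun i => abs_nonneg _
    refine ⟨fun i => (∑' i, |a i|) ^ (α - 1) * |a i|, fun i => by positivity, ha.mul_left _,
      fun N k => ?_⟩
    rw [← Finset.mul_sum]
    have h0 : 0 ≤ ∑ d ∈ Finset.range N, |a (d + k)| := Finset.sum_nonneg fun _ _ => abs_nonneg _
    have h1 : ∑ d ∈ Finset.range N, |a (d + k)| ≤ ∑' i, |a i| :=
      (sum_add_le_tsum (b := fun i => |a i|) (fun i => abs_nonneg _) ha N k).trans
        (tsum_add_le_tsum (b := fun i => |a i|) (fun i => abs_nonneg _) ha k)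
    rcases h0.eq_or_lt with h2 | h2
    · rw [← h2, Real.zero_rpow hα.ne', mul_zero]
    · calc (∑ d ∈ Finset.range N, |a (d + k)|) ^ α
          = (∑ d ∈ Finset.range N, |a (d + k)|) ^ (α - 1) * ∑ d ∈ Finset.range N, |a (d + k)| := by
            rw [← Real.rpow_add_one h2.ne', sub_add_cancel]
        _ ≤ _ := mul_le_mul_of_nonneg_right (Real.rpow_le_rpow h0 h1 (by linarith)) h0

lemma abs_filterSum_le_tsum (ha : Summable fun i => |a i|) (l : ℝ) (m : ℤ) :
    |filterSum a l m| ≤ ∑' i, |a i| := by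
  refine (Finset.abs_sum_le_sum_abs _ _).trans ((Finset.sum_le_sum fun i _ =>
    abs_taperedFilter_le a l i).trans ?_)
  exact ha.sum_le_tsum _ fun _ _ => abs_nonneg _

lemma tendsto_filterSum (ha : Summable a) (hτ : τ.Admissible c γ₁) {m : ℕ → ℤ} {x : ℝ} (hx : x ≠ 0)
    (hm : Tendsto (fun n => (m n : ℝ) / n) atTop (𝓝 x)) :
    Tendsto (fun n : ℕ => filterSum a (c * (n : ℝ) ^ γ₁) (m n)) atTop
      (𝓝 (if 0 < x then ∑' i, a i else 0)) := by
  split_ifs with hx0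
  · have h1 : Tendsto (fun n => (m n : ℝ)) atTop atTop := by
      refine (hm.pos_mul_atTop hx0 tendsto_natCast_atTop_atTop).congr' ?_
      filter_upwards [eventually_gt_atTop 0] with n hn
      exact div_mul_cancel₀ _ (by exact_mod_cast hn.ne')
    have h2 : Tendsto (fun n => min (m n + 1).toNat (⌊c * (n : ℝ) ^ γ₁⌋₊ + 1)) atTop atTop := by
      refine tendsto_atTop.2 fun N => ?_
      filter_upwards [h1.eventually_ge_atTop (N : ℝ),
        (tendsto_level hτ).eventually_ge_atTop (N : ℝ)] with n h3 h4
      have h5 : (N : ℤ) ≤ m n := by exact_mod_cast h3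
      have h6 := Nat.le_floor h4
      exact le_min (by omega) (by omega)
    refine (ha.hasSum.tendsto_sum_nat.comp h2).congr fun n => ?_
    rw [filterSum_eq a (mul_nonneg hτ.pos.1.le (by positivity))]
    rfl
  · have hx1 : x < 0 := lt_of_le_of_ne (not_lt.1 hx0) hx
    refine tendsto_const_nhds.congr' ?_
    filter_upwards [hm.eventually_lt_const hx1] with n hn
    have h0 : (m n : ℝ) < 0 := by
      by_contra hcon
      exact absurd hn (not_lt.2 (div_nonneg (not_lt.1 hcon) (Nat.cast_nonneg n)))
    rw [filterSum_of_neg _ _ (by exact_mod_cast h0)]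

/-- The negative half-line collects the innovations `-1 - k` that the filter still reaches; each has
a weight bounded by a block of consecutive coefficients. -/
lemma setIntegral_normalizedWeight_le (hα : 0 < α) (hc : 0 ≤ c) {n : ℕ} (hn : 0 < n) :
    ∫ u in (Set.Ici (0 : ℝ))ᶜ, |normalizedWeight a β γ₁ c τ .srd t n ⌊(n : ℝ) * u⌋| ^ α ≤
      (n : ℝ)⁻¹ * ∑ k ∈ Finset.range ⌊c * (n : ℝ) ^ γ₁⌋₊,
        (∑ d ∈ Finset.range (⌊(n : ℝ) * t⌋₊ + 1), |a (d + (k + 1))|) ^ α := by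
  have hn0 : (0 : ℝ) < n := by exact_mod_cast hn
  set f : ℤ → ℝ := fun i => if i < 0 then |normalizedWeight a β γ₁ c τ .srd t n i| ^ α else 0
  have h1 := (integral_comp_floor hn f
    ((Finset.range ⌊c * (n : ℝ) ^ γ₁⌋₊).image fun k : ℕ => -1 - (k : ℤ)) fun i hi => by
      simp only [f]
      split_ifs with hi0
      · rw [normalizedWeight_eq_zero_of_notMem hc le_rfl, abs_zero, Real.zero_rpow hα.ne']
        intro hmem
        rw [Finset.mem_Icc] at hmem
        refine hi (Finset.mem_image.2 ⟨(-1 - i).toNat, ?_, ?_⟩)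
        · rw [Finset.mem_range]; omega
        · omega
      · rfl).2
  rw [Finset.sum_image (fun k _ j _ h => by simpa using h), smul_eq_mul] at h1
  rw [← integral_indicator measurableSet_Ici.compl]
  refine le_of_eq_of_le (Eq.trans (integral_congr_ae (Eventually.of_forall fun u => ?_)) h1) ?_
  · simp only [f, Set.indicator, Set.mem_compl_iff, Set.mem_Ici, not_le]
    have : ⌊(n : ℝ) * u⌋ < 0 ↔ u < 0 := by
      rw [Int.floor_lt, Int.cast_zero]
      constructor <;> intro h <;> nlinarith
    simp only [this]
  · refine mul_le_mul_of_nonneg_left (Finset.sum_le_sum fun k _ => ?_) (by positivity)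
    simp only [f]
    rw [if_pos (by omega)]
    refine Real.rpow_le_rpow (abs_nonneg _) ?_ hα.le
    rw [normalizedWeight, growth_srd, div_one]
    refine (abs_sumWeight_le _ _ _ (by omega)).trans (Finset.sum_le_sum fun d _ => ?_)
    rw [show (-(-1 - (k : ℤ))).toNat = k + 1 by omega]
    exact abs_taperedFilter_le _ _ _

/-- Strong and moderate tapering leave `O(n)` blocks, each below a vanishing tail to the power `α`,
so a Cesàro mean concludes. Weak tapering leaves far more than `n` blocks and needs a bound summable
over all of them. -/
lemma tendsto_setIntegral_normalizedWeight (hα : 0 < α) (hτ : τ.Admissible c γ₁)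
    (ha : Summable fun i => |a i|) (hwd : τ = .weak → α < 1 → Summable fun i => |a i| ^ α) :
    Tendsto (fun n : ℕ => ∫ u in (Set.Ici (0 : ℝ))ᶜ,
      |normalizedWeight a β γ₁ c τ .srd t n ⌊(n : ℝ) * u⌋| ^ α) atTop (𝓝 0) := by
  have h0 : Tendsto (fun n : ℕ => (n : ℝ)⁻¹ * ∑ k ∈ Finset.range ⌊c * (n : ℝ) ^ γ₁⌋₊,
        (∑ d ∈ Finset.range (⌊(n : ℝ) * t⌋₊ + 1), |a (d + (k + 1))|) ^ α) atTop (𝓝 0) := by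
    have hlin : (∃ C : ℕ, ∀ᶠ n : ℕ in atTop, ⌊c * (n : ℝ) ^ γ₁⌋₊ ≤ C * n) →
        Tendsto (fun n : ℕ => (n : ℝ)⁻¹ * ∑ k ∈ Finset.range ⌊c * (n : ℝ) ^ γ₁⌋₊,
        (∑ d ∈ Finset.range (⌊(n : ℝ) * t⌋₊ + 1), |a (d + (k + 1))|) ^ α) atTop (𝓝 0) := by
      rintro ⟨C, hC⟩
      have h1 : Tendsto (fun k => (∑' d, |a (d + (k + 1))|) ^ α) atTop (𝓝 0) := by
        have := (((tendsto_sum_nat_add fun i => |a i|).comp (tendsto_add_atTop_nat 1)).rpow_const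
          (p := α) (Or.inr hα.le))
        rwa [Real.zero_rpow hα.ne'] at this
      have hT : ∀ k, 0 ≤ ∑' d, |a (d + (k + 1))| := fun k => tsum_nonneg fun _ => abs_nonneg _
      refine squeeze_zero (fun n => by positivity) (fun n => ?_)
        (tendsto_inv_mul_sum (fun k => Real.rpow_nonneg (hT k) α) h1 hC)
      refine mul_le_mul_of_nonneg_left (Finset.sum_le_sum fun k _ => ?_) (by positivity)
      exact Real.rpow_le_rpow (Finset.sum_nonneg fun _ _ => abs_nonneg _)
        (sum_add_le_tsum (b := fun i => |a i|) (fun _ => abs_nonneg _) ha _ _) hα.le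
    cases τ with
    | strong =>
      obtain ⟨-, h2, rfl⟩ := hτ
      refine hlin ⟨1, (eventually_gt_atTop 0).mono fun n hn => ?_⟩
      have hn1 : (1 : ℝ) ≤ n := by exact_mod_cast hn
      refine Nat.floor_le_of_le ?_
      rw [one_mul, one_mul]
      simpa using Real.rpow_le_rpow_of_exponent_le hn1 h2.le
    | moderate =>
      obtain ⟨rfl, -⟩ := hτ
      refine hlin ⟨⌈c⌉₊, Eventually.of_forall fun n => Nat.floor_le_of_le ?_⟩
      rw [Real.rpow_one, Nat.cast_mul]
      exact mul_le_mul_of_nonneg_right (Nat.le_ceil c) (Nat.cast_nonneg n)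
    | weak =>
      obtain ⟨b, hb0, hb, hle⟩ := exists_summable_sum_rpow_le hα ha (hwd rfl)
      have h1 : Tendsto (fun k => ∑' d, b (d + (k + 1))) atTop (𝓝 0) :=
        (tendsto_sum_nat_add b).comp (tendsto_add_atTop_nat 1)
      have hC : ∀ᶠ n : ℕ in atTop, ⌊(n : ℝ) * t⌋₊ + 1 ≤ (⌈t⌉₊ + 1) * n := by
        filter_upwards [eventually_gt_atTop 0] with n hn
        have : ⌊(n : ℝ) * t⌋₊ ≤ ⌈t⌉₊ * n := by
          refine Nat.floor_le_of_le ?_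
          rw [Nat.cast_mul, mul_comm (n : ℝ)]
          exact mul_le_mul_of_nonneg_right (Nat.le_ceil t) (Nat.cast_nonneg n)
        linarith
      refine squeeze_zero (fun n => by positivity) (fun n => ?_)
        (tendsto_inv_mul_sum (fun k => tsum_nonneg fun _ => hb0 _) h1 hC)
      refine mul_le_mul_of_nonneg_left ?_ (by positivity)
      refine (Finset.sum_le_sum fun k _ => hle _ (k + 1)).trans ?_
      -- Summing over `k` first bounds the long range by a tail of `b`. What remains is a sum over
      -- `O(n)` values of `d`, to which the Cesàro argument applies.
      rw [Finset.sum_comm]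
      refine Finset.sum_le_sum fun d _ => ?_
      refine le_trans (le_of_eq (Finset.sum_congr rfl fun k _ => ?_))
        (sum_add_le_tsum hb0 hb ⌊c * (n : ℝ) ^ γ₁⌋₊ (d + 1))
      congr 1
      omega
  refine squeeze_zero' (Eventually.of_forall fun n => integral_nonneg fun u => by positivity) ?_ h0
  filter_upwards [eventually_gt_atTop 0] with n hn
  exact setIntegral_normalizedWeight_le hα hτ.pos.1.le hn

/-- To the right of zero the weights are bounded by `2 ∑ |a i|` and have bounded support. On the
left, only vanishing of the `L^α` mass is used, which suffices because the kernel is zero there;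
hence `E = [0, ∞)`. -/
lemma exists_dominatedConv_srd (hα : 0 < α) (hτ : τ.Admissible c γ₁)
    (ha : Summable fun i => |a i|) (hwd : τ = .weak → α < 1 → Summable fun i => |a i| ^ α)
    (ht : 0 ≤ t) :
    ∃ g : ℝ → ℝ, Measurable g ∧ DominatedConv α (Set.Ici 0) g
      (fun n u => normalizedWeight a β γ₁ c τ .srd t n ⌊(n : ℝ) * u⌋)
      (fun u => kernel a β c t u τ .srd) := by
  have hS : 0 ≤ ∑' i, |a i| := tsum_nonneg fun i => abs_nonneg _
  have hc := hτ.pos.1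
  set g : ℝ → ℝ := (Set.Icc 0 (t + 1)).indicator fun _ => 2 * ∑' i, |a i| with hg
  have hgm : MemLp g (ENNReal.ofReal α) volume :=
    memLp_indicator_const _ measurableSet_Icc _ (Or.inr (by simp))
  have hne : ∀ᵐ u : ℝ, u ≠ 0 ∧ u ≠ t := by
    have h3 : ∀ x : ℝ, ∀ᵐ u : ℝ, u ≠ x := fun x => by
      simp [ae_iff]
    exact (h3 0).and (h3 t)
  refine ⟨g, measurable_const.indicator measurableSet_Icc,
    fun n => measurable_normalizedWeight n, ?_, ?_, ?_, ?_, ?_, ?_⟩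
  · filter_upwards [eventually_gt_atTop 0] with n hn
    exact integrable_normalizedWeight hα hc.le hn
  · filter_upwards [hne] with u ⟨hu, hut⟩
    have h3 := tendsto_floor_mul_div u
    have h4 := tendsto_floor_mul_div t
    have h5 : Tendsto (fun n : ℕ => ((((⌊(n : ℝ) * t⌋₊ : ℤ) - ⌊(n : ℝ) * u⌋ : ℤ)) : ℝ) / n) atTop
        (𝓝 (t - u)) := by
      refine (h4.sub h3).congr fun n => ?_
      rw [natCast_floor_eq (by positivity), Int.cast_sub, sub_div]
    have h6 : Tendsto (fun n : ℕ => ((-1 - ⌊(n : ℝ) * u⌋ : ℤ) : ℝ) / n) atTop (𝓝 (-u)) := by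
      have := (tendsto_one_div_atTop_nhds_zero_nat (𝕜 := ℝ)).neg.sub h3
      rw [neg_zero, zero_sub] at this
      refine this.congr fun n => ?_
      push_cast
      ring
    have h7 := (tendsto_filterSum ha.of_abs hτ (sub_ne_zero.2 hut.symm) h5).sub
      (tendsto_filterSum ha.of_abs hτ (neg_ne_zero.2 hu) h6)
    have h8 : kernel a β c t u τ .srd =
        (if 0 < t - u then ∑' i, a i else 0) - (if 0 < -u then ∑' i, a i else 0) := by
      rw [kernel_srd]
      simp only [Set.indicator, Set.mem_Ico, Pi.one_apply]
      split_ifs <;> first | (exfalso; grind) | simp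
    rw [h8]
    refine h7.congr fun n => ?_
    rw [normalizedWeight, sumWeight, growth_srd, div_one]
  · filter_upwards [eventually_gt_atTop 0] with n hn
    refine Eventually.of_forall fun u hu => ?_
    simp only [hg]
    by_cases hI : u ∈ Set.Icc 0 (t + 1)
    · rw [Set.indicator_of_mem hI, normalizedWeight, sumWeight, growth_srd, div_one, two_mul]
      exact (abs_sub _ _).trans
        (add_le_add (abs_filterSum_le_tsum ha _ _) (abs_filterSum_le_tsum ha _ _))
    · rw [Set.indicator_of_notMem hI, normalizedWeight_of_lt ht hn (by
        by_contra hcon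
        exact hI ⟨hu, not_lt.1 hcon⟩), abs_zero]
  · exact (integrable_abs_rpow hα hgm).integrableOn
  · exact tendsto_setIntegral_normalizedWeight hα hτ ha hwd
  · intro u hu
    rw [kernel_srd, Set.indicator_of_notMem (fun h => hu h.1), mul_zero]

end ShortRange

/-- In all nine cases, the normalized weights converge to the kernel of the limit process. -/
lemma exists_dominatedConv_normalizedWeight {a : ℕ → ℝ} {α β γ₁ c : ℝ} {τ : Tapering}
    {δ : Dependence} (hα : 0 < α) (hτ : τ.Admissible c γ₁) (hδ : δ.Admissible α β a)
    (hwd : τ = .weak → δ = .srd → α < 1 → Summable fun i => |a i| ^ α) :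
    ∃ E : Set ℝ, MeasurableSet E ∧ ∀ t, 0 ≤ t → ∃ g : ℝ → ℝ, Measurable g ∧ DominatedConv α E g
      (fun n u => normalizedWeight a β γ₁ c τ δ t n ⌊(n : ℝ) * u⌋)
      (fun u => kernel a β c t u τ δ) := by
  cases δ with
  | srd =>
    exact ⟨_, measurableSet_Ici, fun t ht =>
      exists_dominatedConv_srd hα hτ hδ.1 (fun h => hwd h rfl) ht⟩
  | lrd =>
    obtain ⟨ha, h1, h2⟩ := hδ
    have h3 : 0 < β := lt_trans (by positivity) h1
    rw [div_lt_iff₀ hα] at h1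
    refine ⟨_, MeasurableSet.univ, fun t ht => exists_dominatedConv hα hτ (by simp) ha
      (tendsto_sum_div_of_lt_one h2 ha) h3 h2.ne ?_ ?_ ht⟩ <;> nlinarith
  | nd =>
    obtain ⟨ha, h1, h2, h0⟩ := hδ
    obtain ⟨h1, h3⟩ := max_lt_iff.1 h1
    rw [div_lt_iff₀ hα] at h3
    have h4 : (β - 1) * α < 1 := by rw [← lt_div_iff₀ hα]; linarith
    refine ⟨_, MeasurableSet.univ, fun t ht => exists_dominatedConv hα hτ (by simp) ha
      (tendsto_sum_div_of_one_lt h1 ha h0) (by linarith) h1.ne' ?_ ?_ ht⟩ <;> nlinarith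

/-! ### Convergence of the finite-dimensional distributions -/

/-- Vectors are moved to Euclidean space, whose inner product makes the multivariate characteristic
function a univariate one of the linear combination, evaluated at 1. -/
lemma charFun_map_toLp {Ω : Type*} [MeasurableSpace Ω] (P : Measure Ω) {m : ℕ}
    {X : Fin m → Ω → ℝ} (hX : ∀ l, Measurable (X l)) (θ : EuclideanSpace ℝ (Fin m)) :
    charFun (P.map fun ω => WithLp.toLp 2 fun l => X l ω) θ =
      charFun (P.map fun ω => ∑ l, θ l * X l ω) 1 := by
  have h1 : Measurable fun ω => WithLp.toLp 2 fun l => X l ω :=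
    (WithLp.measurable_toLp 2 _).comp (measurable_pi_lambda _ hX)
  have h2 : Measurable fun ω => ∑ l, θ l * X l ω :=
    Finset.measurable_fun_sum _ fun l _ => (hX l).const_mul _
  rw [charFun_apply, charFun_apply, integral_map h1.aemeasurable (by fun_prop),
    integral_map h2.aemeasurable (by fun_prop)]
  refine integral_congr_ae (Eventually.of_forall fun ω => ?_)
  simp [PiLp.inner_apply]

lemma tendstoInDistribution_of_tendsto_charFun {Ω : ℕ → Type*} [∀ n, MeasurableSpace (Ω n)]
    (P : ∀ n, Measure (Ω n)) [∀ n, IsProbabilityMeasure (P n)] {Ω' : Type*} [MeasurableSpace Ω']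
    (P' : Measure Ω') [IsProbabilityMeasure P'] {m : ℕ} {X : ∀ n, Fin m → Ω n → ℝ}
    {Y : Fin m → Ω' → ℝ} (hX : ∀ n l, Measurable (X n l)) (hY : ∀ l, Measurable (Y l))
    (h : ∀ θ : Fin m → ℝ, Tendsto
      (fun n => charFun ((P n).map fun ω => ∑ l, θ l * X n l ω) 1) atTop
      (𝓝 (charFun (P'.map fun ω => ∑ l, θ l * Y l ω) 1))) :
    TendstoInDistribution (fun n ω l => X n l ω) atTop (fun ω l => Y l ω) P P' := by
  have hX' : ∀ n, Measurable fun ω => WithLp.toLp 2 fun l => X n l ω := fun n =>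
    (WithLp.measurable_toLp 2 _).comp (measurable_pi_lambda _ (hX n))
  have hY' : Measurable fun ω => WithLp.toLp 2 fun l => Y l ω :=
    (WithLp.measurable_toLp 2 _).comp (measurable_pi_lambda _ hY)
  have H : TendstoInDistribution (fun n ω => WithLp.toLp 2 fun l => X n l ω) atTop
      (fun ω => WithLp.toLp 2 fun l => Y l ω) P P' := by
    refine ⟨fun n => (hX' n).aemeasurable, hY'.aemeasurable, ?_⟩
    refine ProbabilityMeasure.tendsto_of_tendsto_charFun fun θ => ?_
    refine Tendsto.congr (fun n => (charFun_map_toLp (P n) (hX n) θ).symm) ?_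
    rw [ProbabilityMeasure.coe_mk, charFun_map_toLp P' hY θ]
    exact h fun l => θ l
  exact H.continuous_comp (PiLp.continuous_ofLp 2 _)

variable {a : ℕ → ℝ} {α β γ₁ c : ℝ} {τ : Tapering} {δ : Dependence}

lemma normalizedSum_eq (h0 : 0 < α) (h2 : α < 2) (h1 : α ≠ 1) (hc : 0 ≤ c) {Ω : Type*} (ξ : ℤ → Ω → ℝ)
    {t : ℝ} {n N : ℕ} (hN : ⌊(n : ℝ) * t⌋₊ ≤ N) (ω : Ω) :
    normalizedSum α β γ₁ c a τ δ n ξ t ω = ∑ i ∈ Finset.Icc (-(⌊c * (n : ℝ) ^ γ₁⌋₊ : ℤ)) N,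
      (normalizedWeight a β γ₁ c τ δ t n i *
        ((Real.Gamma (1 - α) * Real.cos (Real.pi * α / 2)) ^ (-1 / α) * (n : ℝ) ^ (-1 / α))) *
        ξ i ω := by
  rw [normalizedSum, sum_linearProcess a (by positivity) ξ hN, Finset.mul_sum]
  refine Finset.sum_congr rfl fun i _ => ?_
  rw [normalization, normalizedWeight, neg_div, Real.rpow_neg (Gamma_mul_cos_pos h0 h2 h1).le,
    Real.rpow_neg (Nat.cast_nonneg n), mul_inv, mul_inv]
  ring

theorem tendstoInDistribution_normalizedSum {γ : ℝ} (h0 : 0 < α) (h2 : α < 2) (h1 : α ≠ 1)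
    (hγ : 1 / α < γ) (hτ : τ.Admissible c γ₁) (hδ : δ.Admissible α β a)
    (hwd : τ = .weak → δ = .srd → α < 1 → Summable fun i => |a i| ^ α)
    {Ω : ℕ → Type*} [∀ n, MeasurableSpace (Ω n)] (P : ∀ n, Measure (Ω n))
    [∀ n, IsProbabilityMeasure (P n)] (ξ : ∀ n, ℤ → Ω n → ℝ)
    (hmeas : ∀ n k, Measurable (ξ n k)) (hindep : ∀ n, iIndepFun (ξ n) (P n))
    (hlaw : ∀ n k, (P n).map (ξ n k) = innovationLaw α ((n : ℝ) ^ γ))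
    {Ω' : Type*} [MeasurableSpace Ω'] (P' : Measure Ω') [IsProbabilityMeasure P']
    {M : Set ℝ → Ω' → ℝ} (hM : IsStableRandomMeasure P' α 1 M) {m : ℕ} {t : Fin m → ℝ}
    (ht : ∀ l, 0 ≤ t l) {Y : Fin m → Ω' → ℝ}
    (hY : ∀ l, IsStableIntegral P' α M (fun u => kernel a β c (t l) u τ δ) (Y l)) :
    TendstoInDistribution (fun n ω l => normalizedSum α β γ₁ c a τ δ n (ξ n) (t l) ω) atTop
      (fun ω l => Y l ω) P P' := by
  obtain ⟨E, hE, H⟩ := exists_dominatedConv_normalizedWeight h0 hτ hδ hwd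
  have hc := hτ.pos.1.le
  -- The largest of the time indices gives a common range, so that a linear combination over times
  -- is again a single weighted sum.
  set N : ℕ → ℕ := fun n => Finset.univ.sup fun l => ⌊(n : ℝ) * t l⌋₊
  have hN : ∀ (n : ℕ) l, ⌊(n : ℝ) * t l⌋₊ ≤ N n := fun n l =>
    Finset.le_sup (f := fun l => ⌊(n : ℝ) * t l⌋₊) (Finset.mem_univ l)
  refine tendstoInDistribution_of_tendsto_charFun P P' (fun n l => ?_) (fun l => (hY l).2.1)
    fun θ => ?_
  · rw [funext (normalizedSum_eq (β := β) (τ := τ) (δ := δ) h0 h2 h1 hc (ξ n) (hN n l))]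
    exact Finset.measurable_fun_sum _ fun i _ => (hmeas n i).const_mul _
  · rw [charFun_isStableIntegral hM h0 hY]
    choose g hg hD using fun l => H (t l) (ht l)
    refine (tendsto_charFun_weightedSum h0 h2 h1 hγ hmeas hindep hlaw hE
      (f := fun n i => ∑ l, θ l * normalizedWeight a β γ₁ c τ δ (t l) n i)
      (fun n => Finset.Icc (-(⌊c * (n : ℝ) ^ γ₁⌋₊ : ℤ)) (N n)) (fun n i hi => ?_)
      (DominatedConv.sum h0 hD θ hg)).congr fun n => ?_
    · exact Finset.sum_eq_zero fun l _ => by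
        rw [normalizedWeight_eq_zero_of_notMem hc (hN n l) hi, mul_zero]
    · refine congrArg (fun X => charFun ((P n).map X) 1) (funext fun ω => ?_)
      have h3 : ∀ l, normalizedSum α β γ₁ c a τ δ n (ξ n) (t l) ω = _ := fun l =>
        normalizedSum_eq h0 h2 h1 hc (ξ n) (hN n l) ω
      simp only [h3, Finset.mul_sum]
      rw [Finset.sum_comm]
      refine Finset.sum_congr rfl fun i _ => ?_
      rw [Finset.sum_mul, Finset.sum_mul]
      refine Finset.sum_congr rfl fun l _ => ?_
      ring

end TaperedLinear

end

theorem mainTheorem4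
    -- the stability index and the soft tapering levels `b_n = n ^ γ` of the innovations
    (α γ : ℝ) (hα0 : 0 < α) (hα2 : α < 2) (hα1 : α ≠ 1) (hγ : 1 / α < γ)
    -- the case: type of filter tapering and type of dependence
    (τ : TaperedLinear.Tapering) (δ : TaperedLinear.Dependence)
    -- the filter and its tapering level `c * n ^ γ₁`
    (a : ℕ → ℝ) (β γ₁ c : ℝ)
    (hτ : τ.Admissible c γ₁) (hδ : δ.Admissible α β a)
    -- the linear process with the untapered filter is well defined
    (hwd : τ = TaperedLinear.Tapering.weak → δ = TaperedLinear.Dependence.srd → α < 1 →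
      Summable (fun i => |a i| ^ α))
    -- for each `n`, i.i.d. copies of the tapered innovation
    {Ω : ℕ → Type*} [∀ n, MeasurableSpace (Ω n)] (P : ∀ n, Measure (Ω n))
    [∀ n, IsProbabilityMeasure (P n)] (ξ : ∀ n, ℤ → Ω n → ℝ)
    (hmeas : ∀ n k, Measurable (ξ n k)) (hindep : ∀ n, iIndepFun (ξ n) (P n))
    (hlaw : ∀ n k, (P n).map (ξ n k) = TaperedLinear.innovationLaw α ((n : ℝ) ^ γ))
    -- the totally right-skewed stable random measure
    {Ω' : Type*} [MeasurableSpace Ω'] (P' : Measure Ω') [IsProbabilityMeasure P']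
    (M : Set ℝ → Ω' → ℝ) (hM : TaperedLinear.IsStableRandomMeasure P' α 1 M) :
    -- the limit process `U t = ∫ H(u, t, c) M(du)` exists, and
    (∃ U : ℝ → Ω' → ℝ, ∀ t, 0 ≤ t → TaperedLinear.IsStableIntegral P' α M
      (fun u => TaperedLinear.kernel a β c t u τ δ) (U t)) ∧
    -- the finite-dimensional distributions converge to those of `U`
    ∀ U : ℝ → Ω' → ℝ,
      (∀ t, 0 ≤ t → TaperedLinear.IsStableIntegral P' α M
        (fun u => TaperedLinear.kernel a β c t u τ δ) (U t)) →
      ∀ (m : ℕ) (t : Fin m → ℝ), (∀ i, 0 ≤ t i) →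
        TendstoInDistribution
          (fun n ω i => TaperedLinear.normalizedSum α β γ₁ c a τ δ n (ξ n) (t i) ω)
          atTop (fun ω i => U (t i) ω) P P' := by
  refine ⟨?_, fun U hU m t ht => ?_⟩
  -- The domination that drives the convergence also puts each kernel in `L^α`, so its integral
  -- exists.
  · obtain ⟨E, hE, H⟩ := TaperedLinear.exists_dominatedConv_normalizedWeight hα0 hτ hδ hwd
    choose! U hU using fun (t : ℝ) (ht : 0 ≤ t) =>
      TaperedLinear.exists_isStableIntegral hM hα0 hα2 ((H t ht).choose_spec.2.memLp hα0 hE)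
    exact ⟨U, hU⟩
  · exact TaperedLinear.tendstoInDistribution_normalizedSum hα0 hα2 hα1 hγ hτ hδ hwd P ξ hmeas
      hindep hlaw P' hM ht fun l => hU (t l) (ht l)
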